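/- Let $K_n$ be the complete graph on the vertex set $\{0,\dots,n-1\}$ with an edge weight $w$ that is a metric (real-valued, symmetric, positive on distinct vertices, satisfying the triangle inequality). For integers $1\le m\le k\le n$, the problem $k$-MinWP$_m$ asks for a family $\mathcal P$ of $m$ pairwise vertex-disjoint paths in $K_n$ (a single vertex counts as a path) spanning at least $k$ vertices whose total edge weight $w(\mathcal P)=\sum_{P\in\mathcal P}w(P)$ is minimum. Let $\mathrm{opt}$ be this minimum, and let $V(\mathcal P)$ be the set of vertices spanned by $\mathcal P$. Theorem. There is a polynomial-time algorithm, with parameters $\alpha\in(0,1)$ and $\varepsilon>0$, that for every $\alpha$, every $\varepsilon$ and every instance $(n,w,m,k)$ as above outputs a family $\mathcal P$ of $m$ pairwise vertex-disjoint paths such that at least one of the following holds: (a) $|V(\mathcal P)|\ge k$ and $w(\mathcal P)\le\left(\frac{16}{1-\alpha}+\varepsilon\right)\mathrm{opt}$ (a $\left(\frac{16}{1-\alpha}+\varepsilon\right)$-approximate solution); (b) $|V(\mathcal P)|\ge\alpha k$ and $w(\mathcal P)\le\left(\frac{8-2\alpha}{1-\alpha}+\varepsilon\right)\mathrm{opt}$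 (an $\left(\alpha,\frac{8-2\alpha}{1-\alpha}+\varepsilon\right)$-bicriteria approximate solution). Here the algorithm is one fixed program, which receives $n,m,k,w,\alpha,\varepsilon$ as input, for a random access machine on natural numbers and real numbers with addition, subtraction, comparison, indirect addressing and halving of reals as elementary operations (each taking one step; there is no multiplication and no rounding). Polynomial time means that there are absolute constants $C,d$ such that the number of steps is at most $C\,(n+1/\varepsilon)^d$. -/

import Mathlib

namespace KMinWP

/-! ### Metric graphs, path systems and the optimization problem

A metric graph on `n` vertices is the complete graph on `Fin n` together with an edge weight that is
a metric. -/

/-- `w` is a metric on the vertex set `Fin n`. -/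
structure IsMetric {n : ℕ} (w : Fin n → Fin n → ℝ) : Prop where
  self : ∀ u, w u u = 0
  pos : ∀ u v, u ≠ v → 0 < w u v
  symm : ∀ u v, w u v = w v u
  triangle : ∀ u v x, w u x ≤ w u v + w v x

/-- Weight of a path, given by its sequence of vertices: the sum of the weights of its edges. -/
def pathWeight {n : ℕ} (w : Fin n → Fin n → ℝ) : List (Fin n) → ℝ
  | [] => 0
  | [_] => 0
  | u :: v :: l => w u v + pathWeight w (v :: l)

/-- `P` is a family of `m` vertex-disjoint paths of the complete graph on `Fin n`. A path is a
nonempty sequence of distinct vertices; a single vertex is a (trivial) path. -/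
structure IsPathSystem {n m : ℕ} (P : Fin m → List (Fin n)) : Prop where
  nonempty : ∀ i, P i ≠ []
  nodup : ∀ i, (P i).Nodup
  disjoint : ∀ i j, i ≠ j → (P i).Disjoint (P j)

/-- The set of vertices spanned by a family of paths. -/
def spanned {n m : ℕ} (P : Fin m → List (Fin n)) : Finset (Fin n) :=
  Finset.univ.biUnion fun i => (P i).toFinset

/-- Total weight of a family of paths. -/
def totalWeight {n m : ℕ} (w : Fin n → Fin n → ℝ) (P : Fin m → List (Fin n)) : ℝ :=
  ∑ i, pathWeight w (P i)

/-- Feasible solutions of the problem: `m` vertex-disjoint paths spanning at least `k` vertices. -/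
def Feasible {n m : ℕ} (k : ℕ) (P : Fin m → List (Fin n)) : Prop :=
  IsPathSystem P ∧ k ≤ (spanned P).card

/-- The optimal value: the minimum total weight of `m` vertex-disjoint paths spanning at least `k`
vertices. (For `1 ≤ m ≤ k ≤ n` the set is nonempty and finite, and the infimum is attained.) -/
noncomputable def opt {n : ℕ} (w : Fin n → Fin n → ℝ) (m k : ℕ) : ℝ :=
  sInf {x | ∃ P : Fin m → List (Fin n), Feasible k P ∧ totalWeight w P = x}

/-- `P` is a feasible solution of weight at most `β` times the optimum. -/
def IsApprox {n m : ℕ} (w : Fin n → Fin n → ℝ) (k : ℕ) (β : ℝ) (P : Fin m → List (Fin n)) : Prop :=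
  Feasible k P ∧ totalWeight w P ≤ β * opt w m k

/-- `P` is an `(α, β)`-bicriteria solution: `m` vertex-disjoint paths spanning at least `α * k`
vertices, of weight at most `β` times the optimum. -/
def IsBicriteria {n m : ℕ} (w : Fin n → Fin n → ℝ) (k : ℕ) (α β : ℝ)
    (P : Fin m → List (Fin n)) : Prop :=
  IsPathSystem P ∧ α * (k : ℝ) ≤ ((spanned P).card : ℝ) ∧ totalWeight w P ≤ β * opt w m k

/-! ### The machine model

A random access machine with cells for natural numbers and cells for real numbers, programmed in a
structured language. The elementary operations are addition, subtraction, comparison, indirect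
addressing and, on reals, halving. There is no multiplication and no rounding, so each step
lengthens the numbers that occur by a bounded number of bits, and on rational inputs a polynomial
number of steps amounts to polynomial time on a Turing machine. -/

/-- The memory: two-dimensional arrays of natural numbers and of real numbers. Arrays are named by
natural numbers; entry `(0, 0)` of an array serves as a scalar variable. -/
structure Memory where
  nat : ℕ → ℕ → ℕ → ℕ
  real : ℕ → ℕ → ℕ → ℝ

/-- Expressions for natural numbers. Subtraction is truncated. `read a i j` is entry `(i, j)` of
the array `a`. -/
inductive NExpr where
  | const (c : ℕ)
  | read (a : ℕ) (i j : NExpr)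
  | add (e f : NExpr)
  | sub (e f : NExpr)

/-- Expressions for real numbers. -/
inductive RExpr where
  | const (q : ℚ)
  | read (a : ℕ) (i j : NExpr)
  | add (e f : RExpr)
  | sub (e f : RExpr)
  | half (e : RExpr)

/-- Tests. -/
inductive Test where
  | nle (e f : NExpr)
  | rle (e f : RExpr)
  | not (b : Test)
  | and (b c : Test)

def NExpr.eval (s : Memory) : NExpr → ℕ
  | const c => c
  | read a i j => s.nat a (i.eval s) (j.eval s)
  | add e f => e.eval s + f.eval s
  | sub e f => e.eval s - f.eval s

noncomputable def RExpr.eval (s : Memory) : RExpr → ℝ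
  | const q => (q : ℝ)
  | read a i j => s.real a (i.eval s) (j.eval s)
  | add e f => e.eval s + f.eval s
  | sub e f => e.eval s - f.eval s
  | half e => e.eval s / 2

def Test.Holds (s : Memory) : Test → Prop
  | nle e f => e.eval s ≤ f.eval s
  | rle e f => e.eval s ≤ f.eval s
  | not b => ¬ b.Holds s
  | and b c => b.Holds s ∧ c.Holds s

/-- Programs. `setNat a i j e` and `setReal a i j e` store the value of `e` in entry `(i, j)` of the
array `a`. -/
inductive Program where
  | skip
  | setNat (a : ℕ) (i j : NExpr) (e : NExpr)
  | setReal (a : ℕ) (i j : NExpr) (e : RExpr)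
  | seq (c d : Program)
  | ite (b : Test) (c d : Program)
  | loop (b : Test) (c : Program)

def Memory.writeNat (s : Memory) (a i j x : ℕ) : Memory :=
  { s with nat := fun a' i' j' => if a' = a ∧ i' = i ∧ j' = j then x else s.nat a' i' j' }

noncomputable def Memory.writeReal (s : Memory) (a i j : ℕ) (x : ℝ) : Memory :=
  { s with real := fun a' i' j' => if a' = a ∧ i' = i ∧ j' = j then x else s.real a' i' j' }

/-- `Exec c s t s'`: started in memory `s`, the program `c` halts after `t` steps in memory `s'`.
Every executed assignment (or `skip`) and every evaluated test of a branching or of a loop counts as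
one step; as the expressions of a fixed program have bounded size, this is the number of elementary
operations up to a constant factor. -/
inductive Exec : Program → Memory → ℕ → Memory → Prop where
  | skip (s : Memory) : Exec .skip s 1 s
  | setNat (a : ℕ) (i j e : NExpr) (s : Memory) :
      Exec (.setNat a i j e) s 1 (s.writeNat a (i.eval s) (j.eval s) (e.eval s))
  | setReal (a : ℕ) (i j : NExpr) (e : RExpr) (s : Memory) :
      Exec (.setReal a i j e) s 1 (s.writeReal a (i.eval s) (j.eval s) (e.eval s))
  | seq {c d : Program} {s s₁ s₂ : Memory} {t₁ t₂ : ℕ} :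
      Exec c s t₁ s₁ → Exec d s₁ t₂ s₂ → Exec (.seq c d) s (t₁ + t₂) s₂
  | iteTrue {b : Test} {c d : Program} {s s₁ : Memory} {t : ℕ} :
      b.Holds s → Exec c s t s₁ → Exec (.ite b c d) s (t + 1) s₁
  | iteFalse {b : Test} {c d : Program} {s s₁ : Memory} {t : ℕ} :
      ¬ b.Holds s → Exec d s t s₁ → Exec (.ite b c d) s (t + 1) s₁
  | loopTrue {b : Test} {c : Program} {s s₁ s₂ : Memory} {t₁ t₂ : ℕ} :
      b.Holds s → Exec c s t₁ s₁ → Exec (.loop b c) s₁ t₂ s₂ →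
        Exec (.loop b c) s (t₁ + t₂ + 1) s₂
  | loopFalse {b : Test} {c : Program} {s : Memory} :
      ¬ b.Holds s → Exec (.loop b c) s 1 s

/-- The initial memory. The natural scalars `0, 1, 2` hold `n, m, k`, the real array `0` holds the
weights, the real scalars `1, 2` hold the parameters `α, ε`; every other cell is `0`. -/
noncomputable def inputMemory {n : ℕ} (w : Fin n → Fin n → ℝ) (m k : ℕ) (α ε : ℝ) : Memory where
  nat
    | 0, 0, 0 => n
    | 1, 0, 0 => m
    | 2, 0, 0 => k
    | _, _, _ => 0
  real
    | 0, i, j => if h : i < n ∧ j < n then w ⟨i, h.1⟩ ⟨j, h.2⟩ else 0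
    | 1, 0, 0 => α
    | 2, 0, 0 => ε
    | _, _, _ => 0

/-- The memory `s` holds the family `P` as output: entry `(i, 0)` of the natural array `3` is the
number of vertices of the `i`-th path, and row `i` of the natural array `4` lists these vertices. -/
def IsOutput {n m : ℕ} (s : Memory) (P : Fin m → List (Fin n)) : Prop :=
  ∀ i : Fin m, (List.range (s.nat 3 i 0)).map (fun j => s.nat 4 i j) = (P i).map Fin.val

end KMinWP

/-! The algorithm is a Lagrangian relaxation solved by primal-dual moat growing. Fix a potential
`lam` per vertex. Every vertex starts as an active component; moats around active components grow at
unit speed and use up the potential of the component. A component with no potential left is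
deactivated, two components joined by a tight edge are merged and pool their potentials, and the
process stops when `m` components are active.

Dual side: for every path system `Q` the moats give a lower bound on its weight (`Row.Inv`). While
an active component grows, either some path of `Q` crosses its moat and pays, or a path lies
entirely inside (which costs the time term `t`, once per path), or `Q` avoids the component.
Summation yields `Row.Inv.le_totalWeight`.

Primal side: the merges are undone in reverse order, and inactive components without kept edges are
dropped. The kept edges form a forest with `m` trees on the kept set `K`, in which inactive
components always have degree at least 2, so the active ones have total degree at most twice their
number minus `2 * m` (`Row.Pruned.of_grow`). Comparing both sides gives `Pruning.cost_le`: the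
forest weighs at most `2 * (w(Q) + lam * (|K| - k))` for every feasible `Q`. Doubling the trees
gives at most `m` tours (`Tour`), which are listed as one sequence of `N = |K|` vertices with at
most `m` pieces and weight `S ≤ 4 * (w(Q) + lam * (N - k))`.

Windows: any interval of the sequence again has at most `m` pieces and can be cut further into
exactly `m` paths. A window with at least `k` vertices scores a quarter of its weight, a shorter one
with at least `α * k` and at least `m` vertices scores its full weight. If `N ≥ k`, some block of
`k` vertices weighs at most `S / ⌊N / k⌋` (`exists_segCost_le`).

Choice of the potential (`le_of_beaten`): the grid `w u v * 2 ^ n / 2 ^ i` contains values so large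
that `N ≥ k` is forced and so small that `lam * n` is at most `w(Q)`. If no potential gives `N < k`,
the smallest one does the job. Otherwise take the first with `N < k`. If `N ≥ α * k`, the whole
sequence scores at most `4 * w(Q)`. If `N < α * k`, the dual bound forces `lam * (1 - α) * k ≤
w(Q)`, and the preceding potential `2 * lam`, for which `N ≥ k`, yields a good block
(`le_of_density`). No monotonicity in `lam` is needed. The best score is thus at most `4 / (1 - α)`
times the optimum, which gives the factor `16 / (1 - α)` for long windows and `4 / (1 - α)`, at most
`(8 - 2 * α) / (1 - α)`, for short ones.

The program is written in a language `Stm` whose loops run `c * n` rounds, so termination and a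
polynomial step count are automatic (`Stm.exec_toProgram`, `Stm.exists_cost_le`), and correctness is
proved by loop invariants (`Stm.run_iter`). -/

namespace KMinWP

/-! ### A structured language with bounded loops -/

/-- Statements of a language whose loops run a fixed multiple of `n` times. -/
inductive Stm where
  | skip
  | setN (a : ℕ) (i j e : NExpr)
  | setR (a : ℕ) (i j : NExpr) (e : RExpr)
  | seq (p q : Stm)
  | ite (b : Test) (p q : Stm)
  | iter (v c : ℕ) (p : Stm)

namespace Stm

/-- The expression `c * n`, where `n` is the natural scalar `0`. -/
def bound : ℕ → NExpr
  | 0 => .const 0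
  | c + 1 => .add (bound c) (.read 0 (.const 0) (.const 0))

/-- The program that a statement stands for. -/
def toProgram : Stm → Program
  | skip => .skip
  | setN a i j e => .setNat a i j e
  | setR a i j e => .setReal a i j e
  | seq p q => .seq p.toProgram q.toProgram
  | ite b p q => .ite b p.toProgram q.toProgram
  | .iter v c p => .seq (.setNat v (.const 0) (.const 0) (.const 0))
      (.loop (.nle (.add (.read v (.const 0) (.const 0)) (.const 1)) (bound c))
        (.seq p.toProgram (.setNat v (.const 0) (.const 0)
          (.add (.read v (.const 0) (.const 0)) (.const 1)))))

/-- The first `i` rounds of a loop with counter `v` and body `f`. -/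
noncomputable def rounds (f : Memory → Memory) (v : ℕ) (s : Memory) : ℕ → Memory
  | 0 => s
  | i + 1 => f ((rounds f v s i).writeNat v 0 0 i)

open Classical in
/-- The memory after the execution of a statement. -/
noncomputable def run (n : ℕ) : Stm → Memory → Memory
  | skip, s => s
  | setN a i j e, s => s.writeNat a (i.eval s) (j.eval s) (e.eval s)
  | setR a i j e, s => s.writeReal a (i.eval s) (j.eval s) (e.eval s)
  | seq p q, s => q.run n (p.run n s)
  | ite b p q, s => if b.Holds s then p.run n s else q.run n s
  | .iter v c p, s => (rounds (p.run n) v s (c * n)).writeNat v 0 0 (c * n)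

/-- The arrays of natural numbers that a statement writes. -/
def natWrites : Stm → List ℕ
  | skip => []
  | setN a _ _ _ => [a]
  | setR _ _ _ _ => []
  | seq p q => p.natWrites ++ q.natWrites
  | ite _ p q => p.natWrites ++ q.natWrites
  | .iter v _ p => v :: p.natWrites

/-- The arrays of real numbers that a statement writes. -/
def realWrites : Stm → List ℕ
  | skip => []
  | setN _ _ _ _ => []
  | setR a _ _ _ => [a]
  | seq p q => p.realWrites ++ q.realWrites
  | ite _ p q => p.realWrites ++ q.realWrites
  | .iter _ _ p => p.realWrites

/-- No statement writes to the array `0`, and no loop body writes to its loop counter. -/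
def WellFormed : Stm → Prop
  | skip => True
  | setN a _ _ _ => a ≠ 0
  | setR _ _ _ _ => True
  | seq p q => p.WellFormed ∧ q.WellFormed
  | ite _ p q => p.WellFormed ∧ q.WellFormed
  | .iter v _ p => v ≠ 0 ∧ v ∉ p.natWrites ∧ p.WellFormed

/-- A bound on the number of steps. -/
def cost (n : ℕ) : Stm → ℕ
  | skip => 1
  | setN _ _ _ _ => 1
  | setR _ _ _ _ => 1
  | seq p q => p.cost n + q.cost n
  | ite _ p q => p.cost n + q.cost n + 1
  | .iter _ c p => c * n * (p.cost n + 2) + 2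

/-! ### Frame rules, termination, cost and loop invariants -/

/-- The frame rule. Since the list of written arrays is computed syntactically, later specifications
only have to describe the arrays that a statement touches. -/
theorem run_nat_of_notMem {n a : ℕ} (p : Stm) (s : Memory) (h : a ∉ p.natWrites) :
    (p.run n s).nat a = s.nat a := by
  induction p generalizing s with
  | skip => rfl
  | setN b i j e =>
    have : a ≠ b := by simpa [natWrites] using h
    funext i' j'
    simp [run, Memory.writeNat, this]
  | setR b i j e => rfl
  | seq p q hp hq =>
    simp only [natWrites, List.mem_append, not_or] at h
    simp only [run]
    rw [hq _ h.2, hp _ h.1]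
  | ite b p q hp hq =>
    simp only [natWrites, List.mem_append, not_or] at h
    simp only [run]
    split
    · exact hp _ h.1
    · exact hq _ h.2
  | iter v c p hp =>
    simp only [natWrites, List.mem_cons, not_or] at h
    have key : ∀ i, (rounds (p.run n) v s i).nat a = s.nat a := by
      intro i
      induction i with
      | zero => rfl
      | succ i ih =>
        rw [rounds, hp _ h.2, ← ih]
        funext i' j'
        simp [Memory.writeNat, h.1]
    rw [run, ← key (c * n)]
    funext i' j'
    simp [Memory.writeNat, h.1]

theorem run_real_of_notMem {n a : ℕ} (p : Stm) (s : Memory) (h : a ∉ p.realWrites) :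
    (p.run n s).real a = s.real a := by
  induction p generalizing s with
  | skip => rfl
  | setN b i j e => rfl
  | setR b i j e =>
    have : a ≠ b := by simpa [realWrites] using h
    funext i' j'
    simp [run, Memory.writeReal, this]
  | seq p q hp hq =>
    simp only [realWrites, List.mem_append, not_or] at h
    simp only [run]
    rw [hq _ h.2, hp _ h.1]
  | ite b p q hp hq =>
    simp only [realWrites, List.mem_append, not_or] at h
    simp only [run]
    split
    · exact hp _ h.1
    · exact hq _ h.2
  | iter v c p hp =>
    simp only [realWrites] at h
    have key : ∀ i, (rounds (p.run n) v s i).real a = s.real a := by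
      intro i
      induction i with
      | zero => rfl
      | succ i ih => rw [rounds, hp _ h, ← ih]; rfl
    rw [run, ← key (c * n)]
    rfl

theorem bound_eval {n : ℕ} {s : Memory} (hs : s.nat 0 0 0 = n) (c : ℕ) :
    (bound c).eval s = c * n := by
  induction c with
  | zero => simp [bound, NExpr.eval]
  | succ c ih => simp [bound, NExpr.eval, ih, hs]; ring

theorem WellFormed.zero_notMem {p : Stm} (h : p.WellFormed) : 0 ∉ p.natWrites := by
  induction p with
  | skip => simp [natWrites]
  | setN a i j e => simpa [natWrites] using fun h' => h h'.symm
  | setR a i j e => simp [natWrites]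
  | seq p q hp hq => simp [natWrites, hp h.1, hq h.2]
  | ite b p q hp hq => simp [natWrites, hp h.1, hq h.2]
  | iter v c p hp =>
    simp only [natWrites, List.mem_cons, not_or]
    exact ⟨fun h' => h.1 h'.symm, hp h.2.2⟩

/-- A well-formed statement halts within its cost, in the memory given by `run`. -/
theorem exec_toProgram {n : ℕ} {p : Stm} (hp : p.WellFormed) {s : Memory} (hs : s.nat 0 0 0 = n) :
    ∃ t, Exec p.toProgram s t (p.run n s) ∧ t ≤ p.cost n := by
  induction p generalizing s with
  | skip => exact ⟨1, .skip s, le_rfl⟩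
  | setN a i j e => exact ⟨1, .setNat a i j e s, le_rfl⟩
  | setR a i j e => exact ⟨1, .setReal a i j e s, le_rfl⟩
  | seq p q ihp ihq =>
    obtain ⟨t₁, h₁, l₁⟩ := ihp hp.1 hs
    obtain ⟨t₂, h₂, l₂⟩ := ihq (s := p.run n s) hp.2 (by
      rw [run_nat_of_notMem p s hp.1.zero_notMem, hs])
    exact ⟨t₁ + t₂, .seq h₁ h₂, by simp only [cost]; omega⟩
  | ite b p q ihp ihq =>
    by_cases hb : b.Holds s
    · obtain ⟨t₁, h₁, l₁⟩ := ihp hp.1 hs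
      refine ⟨t₁ + 1, ?_, by simp only [cost]; omega⟩
      simp only [run, if_pos hb]
      exact .iteTrue hb h₁
    · obtain ⟨t₁, h₁, l₁⟩ := ihq hp.2 hs
      refine ⟨t₁ + 1, ?_, by simp only [cost]; omega⟩
      simp only [run, if_neg hb]
      exact .iteFalse hb h₁
  | iter v c p ihp =>
    obtain ⟨hv, hvp, hpw⟩ := hp
    set f := rounds (p.run n) v s with hf
    have hf0 : ∀ i, (f i).nat 0 0 0 = n := by
      intro i
      induction i with
      | zero => exact hs
      | succ i ih =>
        rw [hf, rounds, run_nat_of_notMem p _ hpw.zero_notMem]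
        simpa [Memory.writeNat, hv.symm] using ih
    have hw0 : ∀ i x, ((f i).writeNat v 0 0 x).nat 0 0 0 = n := by
      intro i x
      simpa [Memory.writeNat, hv.symm] using hf0 i
    have hwv : ∀ i x, ((f i).writeNat v 0 0 x).nat v 0 0 = x := by
      intro i x
      simp [Memory.writeNat]
    -- Induction on the number `j` of rounds still to run; the loop is entered with counter `i = c *
    -- n - j`.
    have key : ∀ j i, i + j = c * n → ∃ t,
        Exec (.loop (.nle (.add (.read v (.const 0) (.const 0)) (.const 1)) (bound c))
          (.seq p.toProgram (.setNat v (.const 0) (.const 0)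
            (.add (.read v (.const 0) (.const 0)) (.const 1)))))
          ((f i).writeNat v 0 0 i) t ((f (c * n)).writeNat v 0 0 (c * n)) ∧
          t ≤ j * (p.cost n + 2) + 1 := by
      intro j
      induction j with
      | zero =>
        intro i hi
        obtain rfl : i = c * n := by omega
        refine ⟨1, .loopFalse ?_, by omega⟩
        simp only [Test.Holds, NExpr.eval, bound_eval (hw0 _ _), hwv]
        omega
      | succ j ih =>
        intro i hi
        obtain ⟨t₂, h₂, l₂⟩ := ih (i + 1) (by omega)
        obtain ⟨t₁, h₁, l₁⟩ := ihp hpw (hw0 i i)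
        refine ⟨t₁ + 1 + t₂ + 1, .loopTrue ?_ (.seq h₁ (.setNat _ _ _ _ _)) ?_, ?_⟩
        · simp only [Test.Holds, NExpr.eval, bound_eval (hw0 _ _), hwv]
          omega
        · simp only [NExpr.eval]
          rw [run_nat_of_notMem p _ hvp, hwv]
          exact h₂
        · calc t₁ + 1 + t₂ + 1 ≤ p.cost n + 1 + (j * (p.cost n + 2) + 1) + 1 := by omega
            _ = (j + 1) * (p.cost n + 2) + 1 := by ring
    obtain ⟨t, h, l⟩ := key (c * n) 0 (by omega)
    exact ⟨1 + t, .seq (.setNat _ _ _ _ _) h, by simp only [cost]; omega⟩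

/-- The cost is bounded by a polynomial. -/
theorem exists_cost_le (p : Stm) : ∃ C d : ℕ, ∀ n, 1 ≤ n → p.cost n ≤ C * n ^ d := by
  have add : ∀ f g : ℕ → ℕ, (∃ C d : ℕ, ∀ n, 1 ≤ n → f n ≤ C * n ^ d) →
      (∃ C d : ℕ, ∀ n, 1 ≤ n → g n ≤ C * n ^ d) → ∃ C d : ℕ, ∀ n, 1 ≤ n → f n + g n ≤ C * n ^ d := by
    rintro f g ⟨C, d, h⟩ ⟨C', d', h'⟩
    -- The exponents are added rather than maximized; `1 ≤ n` makes either power at most the common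
    -- one.
    refine ⟨C + C', d + d', fun n hn => ?_⟩
    have h1 : n ^ d ≤ n ^ (d + d') := Nat.pow_le_pow_right hn (by omega)
    have h2 : n ^ d' ≤ n ^ (d + d') := Nat.pow_le_pow_right hn (by omega)
    calc f n + g n ≤ C * n ^ d + C' * n ^ d' := add_le_add (h n hn) (h' n hn)
      _ ≤ C * n ^ (d + d') + C' * n ^ (d + d') := by gcongr
      _ = _ := by ring
  have const : ∀ c : ℕ, ∃ C d : ℕ, ∀ n, 1 ≤ n → c ≤ C * n ^ d := fun c => ⟨c, 0, by simp⟩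
  induction p with
  | skip => exact const 1
  | setN a i j e => exact const 1
  | setR a i j e => exact const 1
  | seq p q hp hq => exact add _ _ hp hq
  | ite b p q hp hq => exact add _ _ (add _ _ hp hq) (const 1)
  | iter v c p hp =>
    refine add _ _ ?_ (const 2)
    obtain ⟨C, d, h⟩ := add _ _ hp (const 2)
    refine ⟨c * C, d + 1, fun n hn => ?_⟩
    calc c * n * (p.cost n + 2) ≤ c * n * (C * n ^ d) := by gcongr; exact h n hn
      _ = _ := by ring

/-- Invariants of loops. A round does not change the arrays that the loop does not write. -/
theorem run_iter {n v c : ℕ} {p : Stm} {s : Memory} (I : ℕ → Memory → Prop)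
    (hI : ∀ i s j, I i s → I i (s.writeNat v 0 0 j)) (h₀ : I 0 s)
    (hs : ∀ i s', i < c * n → (∀ a, a ≠ v → a ∉ p.natWrites → s'.nat a = s.nat a) →
      (∀ a, a ∉ p.realWrites → s'.real a = s.real a) → s'.nat v 0 0 = i → I i s' →
      I (i + 1) (p.run n s')) :
    I (c * n) ((Stm.iter v c p).run n s) := by
  have frame : ∀ i, (∀ a, a ≠ v → a ∉ p.natWrites → (rounds (p.run n) v s i).nat a = s.nat a) ∧
      ∀ a, a ∉ p.realWrites → (rounds (p.run n) v s i).real a = s.real a := by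
    intro i
    induction i with
    | zero => exact ⟨fun _ _ _ => rfl, fun _ _ => rfl⟩
    | succ i ih =>
      constructor
      · intro a ha h
        rw [rounds, run_nat_of_notMem p _ h, ← ih.1 a ha h]
        funext i' j'
        simp [Memory.writeNat, ha]
      · intro a h
        rw [rounds, run_real_of_notMem p _ h, ← ih.2 a h]
        rfl
  have key : ∀ i, i ≤ c * n → I i (rounds (p.run n) v s i) := by
    intro i
    induction i with
    | zero => exact fun _ => h₀
    | succ i ih =>
      refine fun hi => hs i _ (by omega) (fun a ha h => ?_) (fun a h => (frame i).2 a h)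
        (by simp [Memory.writeNat]) (hI _ _ _ (ih (by omega)))
      rw [← (frame i).1 a ha h]
      funext i' j'
      simp [Memory.writeNat, ha]
  exact hI _ _ _ (key _ le_rfl)

end Stm

/-! ### Reading the memory after a write -/

theorem Memory.nat_writeNat_of_ne {s : Memory} {a b i j x : ℕ} (h : b ≠ a) :
    (s.writeNat a i j x).nat b = s.nat b := by
  funext i' j'
  simp [Memory.writeNat, h]

theorem Memory.nat_writeNat_self {s : Memory} {a i j x i' j' : ℕ} :
    (s.writeNat a i j x).nat a i' j' = if i' = i ∧ j' = j then x else s.nat a i' j' := by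
  simp [Memory.writeNat]

theorem Memory.real_writeNat {s : Memory} {a i j x : ℕ} :
    (s.writeNat a i j x).real = s.real := rfl

theorem Memory.real_writeReal_of_ne {s : Memory} {a b i j : ℕ} {x : ℝ} (h : b ≠ a) :
    (s.writeReal a i j x).real b = s.real b := by
  funext i' j'
  simp [Memory.writeReal, h]

theorem Memory.real_writeReal_self {s : Memory} {a i j i' j' : ℕ} {x : ℝ} :
    (s.writeReal a i j x).real a i' j' = if i' = i ∧ j' = j then x else s.real a i' j' := by
  simp [Memory.writeReal]

theorem Memory.nat_writeReal {s : Memory} {a i j : ℕ} {x : ℝ} :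
    (s.writeReal a i j x).nat = s.nat := rfl

end KMinWP

namespace KMinWP

/-! ### Weights of paths -/

section PathWeight

variable {n : ℕ}

theorem pathWeight_mono {f g : Fin n → Fin n → ℝ} (h : ∀ a b, f a b ≤ g a b) (l : List (Fin n)) :
    pathWeight f l ≤ pathWeight g l := by
  induction l using pathWeight.induct with
  | case1 => simp [pathWeight]
  | case2 => simp [pathWeight]
  | case3 u v l ih => simp only [pathWeight]; exact add_le_add (h u v) ih

theorem pathWeight_nonneg {f : Fin n → Fin n → ℝ} (h : ∀ a b, 0 ≤ f a b) (l : List (Fin n)) :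
    0 ≤ pathWeight f l := by
  induction l using pathWeight.induct with
  | case1 => simp [pathWeight]
  | case2 => simp [pathWeight]
  | case3 u v l ih => simp only [pathWeight]; exact add_nonneg (h u v) ih

theorem pathWeight_add (f g : Fin n → Fin n → ℝ) (l : List (Fin n)) :
    pathWeight (fun a b => f a b + g a b) l = pathWeight f l + pathWeight g l := by
  induction l using pathWeight.induct with
  | case1 => simp [pathWeight]
  | case2 => simp [pathWeight]
  | case3 u v l ih => simp only [pathWeight, ih]; ring

theorem pathWeight_sum {ι : Type*} (s : Finset ι) (f : ι → Fin n → Fin n → ℝ) (l : List (Fin n)) :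
    pathWeight (fun a b => ∑ c ∈ s, f c a b) l = ∑ c ∈ s, pathWeight (f c) l := by
  induction l using pathWeight.induct with
  | case1 => simp [pathWeight]
  | case2 => simp [pathWeight]
  | case3 u v l ih => simp only [pathWeight, ih, Finset.sum_add_distrib]

/-- A path stays inside a set, or outside of it, or uses an edge that leaves it. -/
theorem le_pathWeight_crossing {Δ : ℝ} (hΔ : 0 ≤ Δ) (C : Finset (Fin n)) (l : List (Fin n)) :
    (∀ x ∈ l, x ∈ C) ∨ (∀ x ∈ l, x ∉ C) ∨
      Δ ≤ pathWeight (fun a b => if (a ∈ C) ↔ (b ∈ C) then 0 else Δ) l := by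
  induction l using pathWeight.induct with
  | case1 => simp
  | case2 u => by_cases h : u ∈ C <;> simp [h]
  | case3 u v l ih =>
    by_cases h : (u ∈ C) ↔ (v ∈ C)
    · rcases ih with ih | ih | ih
      · left
        intro x hx
        rcases List.mem_cons.1 hx with rfl | hx
        · exact h.2 (ih v (by simp))
        · exact ih x hx
      · right; left
        intro x hx
        rcases List.mem_cons.1 hx with rfl | hx
        · exact fun h' => ih v (by simp) (h.1 h')
        · exact ih x hx
      · right; right
        simpa [pathWeight, h] using ih
    · right; right
      have : 0 ≤ pathWeight (fun a b => if (a ∈ C) ↔ (b ∈ C) then 0 else Δ) (v :: l) :=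
        pathWeight_nonneg (fun a b => by split <;> simp [hΔ]) _
      simp only [pathWeight, if_neg h]
      linarith

end PathWeight

theorem IsMetric.nonneg {n : ℕ} {w : Fin n → Fin n → ℝ} (hw : IsMetric w) (u v : Fin n) :
    0 ≤ w u v := by
  by_cases h : u = v
  · rw [h, hw.self]
  · exact (hw.pos u v h).le

/-! ### Moat growing -/

/-- A state of the moat growing process: the label of the component of each vertex; for each label,
whether the component is active (value `1`) and its remaining potential; the total width of the
moats around each vertex; the number of active components. -/
structure Row (n : ℕ) where
  lab : Fin n → Fin n
  act : Fin n → ℕ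
  d : Fin n → ℝ
  pot : Fin n → ℝ
  cnt : ℕ

namespace Row

variable {n m : ℕ} {w : Fin n → Fin n → ℝ} {lam t Δ : ℝ} {Q : Fin m → List (Fin n)} {r : Row n}
  {u v : Fin n}

/-- All vertices are active components of their own. -/
def init (n : ℕ) (lam : ℝ) : Row n where
  lab x := x
  act _ := 1
  d _ := 0
  pot _ := lam
  cnt := n

/-- Growing the moats around all active components by `Δ`. -/
def grow (r : Row n) (Δ : ℝ) : Row n :=
  { r with
    d := fun x => if r.act (r.lab x) = 1 then r.d x + Δ else r.d x
    pot := fun c => if r.act c = 1 then r.pot c - Δ else r.pot c }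

/-- Deactivating the component of `u`. -/
def deact (r : Row n) (u : Fin n) : Row n :=
  { r with
    act := fun c => if c = r.lab u then 0 else r.act c
    cnt := r.cnt - 1 }

/-- Merging the component of `v` into the component of `u`. -/
def merge (r : Row n) (u v : Fin n) : Row n :=
  { r with
    lab := fun x => if r.lab x = r.lab v then r.lab u else r.lab x
    pot := fun c => if c = r.lab u then r.pot (r.lab u) + r.pot (r.lab v) else r.pot c
    cnt := if r.act (r.lab v) = 1 then r.cnt - 1 else r.cnt }

/-- The growth after which the pair `u`, `v` triggers an event, for `u` in an active component:
the potential of the component is used up (if `v` is in it too), or the edge becomes tight. -/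
noncomputable def val (w : Fin n → Fin n → ℝ) (r : Row n) (u v : Fin n) : ℝ :=
  if r.lab u = r.lab v then r.pot (r.lab u)
  else if r.act (r.lab v) = 1 then (w u v - r.d u - r.d v) / 2
  else w u v - r.d u - r.d v

/-- The pair `u`, `v` triggers the next event, after a growth by `Δ`. -/
structure IsEvent (w : Fin n → Fin n → ℝ) (r : Row n) (u v : Fin n) (Δ : ℝ) : Prop where
  act : r.act (r.lab u) = 1
  eq : r.val w u v = Δ
  le : ∀ u' v', r.act (r.lab u') = 1 → Δ ≤ r.val w u' v'

/-- One step of the process; `typ = 1` means that two components are merged. -/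
def Step (w : Fin n → Fin n → ℝ) (m : ℕ) (r r' : Row n) (typ : ℕ) (u v : Fin n) (Δ : ℝ) : Prop :=
  (r.cnt ≤ m ∧ r' = r ∧ typ = 0 ∧ Δ = 0) ∨
  (m < r.cnt ∧ r.IsEvent w u v Δ ∧ r.lab u = r.lab v ∧ r' = (r.grow Δ).deact u ∧ typ = 0) ∨
  (m < r.cnt ∧ r.IsEvent w u v Δ ∧ r.lab u ≠ r.lab v ∧ r' = (r.grow Δ).merge u v ∧ typ = 1)

/-- The component with label `c`. -/
def comp (r : Row n) (c : Fin n) : Finset (Fin n) := {x | r.lab x = c}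

@[simp] theorem mem_comp {x c : Fin n} : x ∈ r.comp c ↔ r.lab x = c := by simp [comp]

/-- The weights of the edges inside `C`, and the moats inside `C` that other edges cross. -/
def inside (w : Fin n → Fin n → ℝ) (d : Fin n → ℝ) (C : Finset (Fin n)) (a b : Fin n) : ℝ :=
  if a ∈ C then if b ∈ C then w a b else d a else if b ∈ C then d b else 0

theorem inside_nonneg {d : Fin n → ℝ} {C : Finset (Fin n)} (hw : IsMetric w) (hd : ∀ x, 0 ≤ d x)
    (a b : Fin n) : 0 ≤ inside w d C a b := by
  unfold inside
  split_ifs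
  exacts [hw.nonneg a b, hd a, hd b, le_rfl]

/-- The invariant of the process: the moats form a dual solution, which bounds the weight of the
part of `Q` inside each component from below. -/
structure Inv (w : Fin n → Fin n → ℝ) (lam : ℝ) (Q : Fin m → List (Fin n)) (t : ℝ) (r : Row n) :
    Prop where
  time_nonneg : 0 ≤ t
  d_nonneg : ∀ x, 0 ≤ r.d x
  pot_nonneg : ∀ x, 0 ≤ r.pot (r.lab x)
  pot_zero : ∀ x, r.act (r.lab x) ≠ 1 → r.pot (r.lab x) = 0
  feas : ∀ u v, r.lab u ≠ r.lab v → r.d u + r.d v ≤ w u v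
  lb : ∀ x, lam * ((r.comp (r.lab x) ∩ spanned Q).card : ℝ) - r.pot (r.lab x)
      - t * ((Finset.univ.filter fun i => ∀ y ∈ Q i, y ∈ r.comp (r.lab x)).card : ℝ)
      ≤ ∑ i, pathWeight (inside w r.d (r.comp (r.lab x))) (Q i)

theorem Inv.init (hw : IsMetric w) (hlam : 0 ≤ lam) : Inv w lam Q 0 (init n lam) where
  time_nonneg := le_rfl
  d_nonneg x := le_rfl
  pot_nonneg x := hlam
  pot_zero x h := absurd rfl h
  feas u v _ := by simpa [Row.init] using hw.nonneg u v
  lb x := by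
    -- Components are singletons, so at most one vertex of `Q` is counted and its gain `lam` is
    -- offset by the full potential.
    have h1 : ((Row.init n lam).comp ((Row.init n lam).lab x) ∩ spanned Q).card ≤ 1 := by
      refine (Finset.card_le_card Finset.inter_subset_left).trans ?_
      rw [Finset.card_le_one]
      intro a ha b hb
      simp only [mem_comp, Row.init] at ha hb
      rw [ha, hb]
    have h2 : (0 : ℝ) ≤ ∑ i, pathWeight (inside w (Row.init n lam).d
        ((Row.init n lam).comp ((Row.init n lam).lab x))) (Q i) :=
      Finset.sum_nonneg fun i _ => pathWeight_nonneg (inside_nonneg hw fun _ => le_rfl) _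
    have h3 : (((Row.init n lam).comp ((Row.init n lam).lab x) ∩ spanned Q).card : ℝ) ≤ 1 := by
      exact_mod_cast h1
    have h4 : (Row.init n lam).pot ((Row.init n lam).lab x) = lam := rfl
    rw [h4]
    nlinarith

/-- Potentials are nonnegative and moats of different components do not overlap, so every candidate
growth is nonnegative. -/
theorem IsEvent.nonneg (he : r.IsEvent w u v Δ) (h : Inv w lam Q t r) : 0 ≤ Δ := by
  rw [← he.eq, val]
  split_ifs with h1 h2
  · exact h.pot_nonneg u
  · have := h.feas u v h1; linarith
  · have := h.feas u v h1; linarith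

/-- As `Δ` is the smallest growth that triggers an event, no potential becomes negative and no edge
is overpacked. For the lower bound of an active component, the left side loses a potential of `Δ`,
that is, it grows by `Δ`; this is paid by a path that crosses the new moat, or by the time term of a
path inside, unless `Q` avoids the component. -/
theorem Inv.grow (hw : IsMetric w) (h : Inv w lam Q t r) (he : r.IsEvent w u v Δ) :
    Inv w lam Q (t + Δ) (r.grow Δ) := by
  have hΔ := he.nonneg h
  -- The pair `x`, `x` stands for the exhaustion of the potential of its component.
  have hpot : ∀ x, r.act (r.lab x) = 1 → Δ ≤ r.pot (r.lab x) := fun x hx => by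
    simpa [val] using he.le x x hx
  have hd : ∀ x, 0 ≤ (r.grow Δ).d x := fun x => by
    have := h.d_nonneg x
    simp only [Row.grow]
    split_ifs <;> linarith
  refine ⟨add_nonneg h.time_nonneg hΔ, hd, fun x => ?_, fun x hx => ?_, fun a b hab => ?_,
    fun x => ?_⟩
  · simp only [Row.grow]
    split_ifs with hx
    · linarith [hpot x hx]
    · exact h.pot_nonneg x
  · simp only [Row.grow] at hx ⊢
    rw [if_neg hx]
    exact h.pot_zero x hx
  · change r.lab a ≠ r.lab b at hab
    have h0 := h.feas a b hab
    simp only [Row.grow]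
    split_ifs with ha hb hb
    · have := he.le a b ha
      rw [val, if_neg hab, if_pos hb] at this
      linarith
    · have := he.le a b ha
      rw [val, if_neg hab, if_neg hb] at this
      linarith
    · have := he.le b a hb
      rw [val, if_neg hab.symm, if_neg ha, hw.symm b a] at this
      linarith
    · exact h0
  · change lam * ((r.comp (r.lab x) ∩ spanned Q).card : ℝ) - (r.grow Δ).pot (r.lab x)
      - (t + Δ) * ((Finset.univ.filter fun i => ∀ y ∈ Q i, y ∈ r.comp (r.lab x)).card : ℝ)
      ≤ ∑ i, pathWeight (inside w (r.grow Δ).d (r.comp (r.lab x))) (Q i)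
    set C := r.comp (r.lab x) with hC
    set q := ((Finset.univ.filter fun i => ∀ y ∈ Q i, y ∈ C).card : ℝ) with hq
    have hq0 : 0 ≤ q := Nat.cast_nonneg _
    have hlb := h.lb x
    by_cases hx : r.act (r.lab x) = 1
    · have hpx := hpot x hx
      have e1 : (r.grow Δ).pot (r.lab x) = r.pot (r.lab x) - Δ := by simp [Row.grow, hx]
      -- Only edges with exactly one end in `C` pay for the new layer of the moat.
      have e2 : inside w (r.grow Δ).d C = fun a b => inside w r.d C a b +
          (if (a ∈ C) ↔ (b ∈ C) then 0 else Δ) := by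
        funext a b
        by_cases ha : a ∈ C <;> by_cases hb : b ∈ C <;> simp only [inside, ha, hb, if_true, if_false,
          iff_true, iff_false, not_true, add_zero]
        · have : r.lab a = r.lab x := by simpa [hC] using ha
          simp [Row.grow, this, hx]
        · have : r.lab b = r.lab x := by simpa [hC] using hb
          simp [Row.grow, this, hx]
      have hcr : ∀ i, 0 ≤ pathWeight (fun a b => if (a ∈ C) ↔ (b ∈ C) then 0 else Δ) (Q i) :=
        fun i => pathWeight_nonneg (fun a b => by split_ifs <;> simp [hΔ]) _
      by_cases hc : ∃ i, Δ ≤ pathWeight (fun a b => if (a ∈ C) ↔ (b ∈ C) then 0 else Δ) (Q i)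
      · obtain ⟨i, hi⟩ := hc
        have := Finset.single_le_sum (fun i _ => hcr i) (Finset.mem_univ i)
        simp only [e1, e2, pathWeight_add, Finset.sum_add_distrib]
        nlinarith
      by_cases hin : ∃ i, ∀ y ∈ Q i, y ∈ C
      · obtain ⟨i, hi⟩ := hin
        have h1 : 1 ≤ q := by
          rw [hq]
          exact_mod_cast Finset.card_pos.2 ⟨i, by simpa using hi⟩
        have := Finset.sum_nonneg fun i (_ : i ∈ Finset.univ) => hcr i
        simp only [e1, e2, pathWeight_add, Finset.sum_add_distrib]
        nlinarith
      -- No path crosses and none lies inside, so `Q` misses `C` and the left side is nonpositive.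
      · have hout : ∀ i, ∀ y ∈ Q i, y ∉ C := fun i => by
          rcases le_pathWeight_crossing hΔ C (Q i) with h' | h' | h'
          · exact absurd ⟨i, h'⟩ hin
          · exact h'
          · exact absurd ⟨i, h'⟩ hc
        have : C ∩ spanned Q = ∅ := by
          ext y
          simp only [spanned, Finset.mem_inter, Finset.mem_biUnion, List.mem_toFinset]
          simp only [Finset.notMem_empty, iff_false, not_and]
          rintro hy ⟨i, -, hi⟩
          exact hout i y hi hy
        have h0 : (0 : ℝ) ≤ ∑ i, pathWeight (inside w (r.grow Δ).d C) (Q i) :=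
          Finset.sum_nonneg fun i _ => pathWeight_nonneg (inside_nonneg hw hd) _
        have ht : 0 ≤ (t + Δ) * q := mul_nonneg (add_nonneg h.time_nonneg hΔ) hq0
        rw [this, e1]
        simp only [Finset.card_empty, Nat.cast_zero, mul_zero]
        linarith
    · have e1 : (r.grow Δ).pot (r.lab x) = r.pot (r.lab x) := by simp [Row.grow, hx]
      have e2 : inside w (r.grow Δ).d C = inside w r.d C := by
        funext a b
        have key : ∀ a ∈ C, (r.grow Δ).d a = r.d a := fun a ha => by
          have : r.lab a = r.lab x := by simpa [hC] using ha
          simp [Row.grow, this, hx]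
        unfold inside
        split_ifs with ha hb hb
        exacts [rfl, key a ha, key b hb, rfl]
      rw [e1, e2]
      nlinarith

/-- The potential has to be exhausted, because inactive components must not carry any: dropping them
in the pruning and in the final summation must be free. -/
theorem Inv.deact (h : Inv w lam Q t r) (hu : r.pot (r.lab u) = 0) : Inv w lam Q t (r.deact u) where
  time_nonneg := h.time_nonneg
  d_nonneg := h.d_nonneg
  pot_nonneg := h.pot_nonneg
  pot_zero x hx := by
    simp only [Row.deact] at hx ⊢
    split_ifs at hx with h'
    · rw [h', hu]
    · exact h.pot_zero x hx
  feas := h.feas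
  lb := h.lb

theorem comp_merge_left :
    (r.merge u v).comp (r.lab u) = r.comp (r.lab u) ∪ r.comp (r.lab v) := by
  ext x
  simp only [mem_comp, merge, Finset.mem_union]
  split_ifs with h <;> simp [h]

theorem comp_merge_of_ne {c : Fin n} (hc : c ≠ r.lab u) (hc' : c ≠ r.lab v) :
    (r.merge u v).comp c = r.comp c := by
  ext x
  simp only [mem_comp, merge]
  split_ifs with h
  · simp [h, hc.symm, hc'.symm]
  · rfl

/-- The two lower bounds are added. Vertices and potentials are additive, paths inside are
superadditive (a nonempty path cannot be inside both), and an edge between the two components covers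
both moats by `feas`. -/
theorem Inv.merge (h : Inv w lam Q t r) (huv : r.lab u ≠ r.lab v) (hu : r.act (r.lab u) = 1)
    (hQ : IsPathSystem Q) : Inv w lam Q t (r.merge u v) := by
  have hlab : ∀ x, (r.merge u v).lab x = r.lab u ∨
      ((r.merge u v).lab x = r.lab x ∧ r.lab x ≠ r.lab u ∧ r.lab x ≠ r.lab v) := by
    intro x
    simp only [Row.merge]
    split_ifs with hx
    · exact .inl rfl
    · by_cases h' : r.lab x = r.lab u
      · exact .inl h'
      · exact .inr ⟨rfl, h', hx⟩
  have e1 : (r.merge u v).pot (r.lab u) = r.pot (r.lab u) + r.pot (r.lab v) := by simp [Row.merge]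
  have e2 : ∀ c, c ≠ r.lab u → (r.merge u v).pot c = r.pot c := fun c hc => by simp [Row.merge, hc]
  refine ⟨h.time_nonneg, h.d_nonneg, fun x => ?_, fun x hx => ?_, fun a b hab => ?_, fun x => ?_⟩
  · rcases hlab x with hx | ⟨hx, hxu, hxv⟩
    · rw [hx, e1]; exact add_nonneg (h.pot_nonneg u) (h.pot_nonneg v)
    · rw [hx, e2 _ hxu]; exact h.pot_nonneg x
  · change r.act _ ≠ 1 at hx
    rcases hlab x with hx' | ⟨hx', hxu, hxv⟩
    · rw [hx'] at hx; exact absurd hu hx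
    · rw [hx'] at hx ⊢
      rw [e2 _ hxu]; exact h.pot_zero x hx
  · refine h.feas a b fun hab' => hab ?_
    simp only [Row.merge, hab']
  · rcases hlab x with hx | ⟨hx, hxu, hxv⟩
    · rw [hx, e1, comp_merge_left]
      set A := r.comp (r.lab u) with hA
      set B := r.comp (r.lab v) with hB
      have hAB : Disjoint A B := by
        rw [Finset.disjoint_left]
        intro y hy hy'
        rw [hA, mem_comp] at hy
        rw [hB, mem_comp] at hy'
        exact huv (hy.symm.trans hy')
      have c1 : ((A ∪ B) ∩ spanned Q).card = (A ∩ spanned Q).card + (B ∩ spanned Q).card := by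
        rw [Finset.union_inter_distrib_right, Finset.card_union_of_disjoint]
        exact hAB.mono Finset.inter_subset_left Finset.inter_subset_left
      have c2 : (Finset.univ.filter fun i => ∀ y ∈ Q i, y ∈ A).card +
          (Finset.univ.filter fun i => ∀ y ∈ Q i, y ∈ B).card ≤
          (Finset.univ.filter fun i => ∀ y ∈ Q i, y ∈ A ∪ B).card := by
        rw [← Finset.card_union_of_disjoint]
        · refine Finset.card_le_card fun i hi => ?_
          simp only [Finset.mem_union, Finset.mem_filter, Finset.mem_univ, true_and] at hi ⊢
          rcases hi with hi | hi
          · exact fun y hy => .inl (hi y hy)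
          · exact fun y hy => .inr (hi y hy)
        · rw [Finset.disjoint_left]
          intro i hi hi'
          simp only [Finset.mem_filter, Finset.mem_univ, true_and] at hi hi'
          obtain ⟨y, hy⟩ := List.exists_mem_of_ne_nil _ (hQ.nonempty i)
          exact Finset.disjoint_left.1 hAB (hi y hy) (hi' y hy)
      have c2' : ((Finset.univ.filter fun i => ∀ y ∈ Q i, y ∈ A).card : ℝ) +
          ((Finset.univ.filter fun i => ∀ y ∈ Q i, y ∈ B).card : ℝ) ≤
          ((Finset.univ.filter fun i => ∀ y ∈ Q i, y ∈ A ∪ B).card : ℝ) := by exact_mod_cast c2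
      have c3 : ∑ i, pathWeight (inside w r.d A) (Q i) + ∑ i, pathWeight (inside w r.d B) (Q i) ≤
          ∑ i, pathWeight (inside w r.d (A ∪ B)) (Q i) := by
        rw [← Finset.sum_add_distrib]
        refine Finset.sum_le_sum fun i _ => ?_
        rw [← pathWeight_add]
        refine pathWeight_mono (fun a b => ?_) _
        have hf : ∀ a ∈ A, ∀ b ∈ B, r.d a + r.d b ≤ w a b ∧ r.d b + r.d a ≤ w b a := by
          intro a ha b hb
          rw [hA, mem_comp] at ha
          rw [hB, mem_comp] at hb
          have : r.lab a ≠ r.lab b := by rw [ha, hb]; exact huv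
          exact ⟨h.feas a b this, h.feas b a this.symm⟩
        have hd : ∀ a, a ∈ A → a ∉ B := fun a ha => Finset.disjoint_left.1 hAB ha
        unfold inside
        by_cases haA : a ∈ A <;> by_cases hbA : b ∈ A <;> by_cases haB : a ∈ B <;>
          by_cases hbB : b ∈ B <;>
          first
          | exact absurd haB (hd a haA)
          | exact absurd hbB (hd b hbA)
          | simp [haA, hbA, haB, hbB]
        · exact (hf a haA b hbB).1
        · rw [add_comm]; exact (hf b hbA a haB).2
      have l1 := h.lb u
      have l2 := h.lb v
      have := mul_le_mul_of_nonneg_left c2' h.time_nonneg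
      change _ ≤ ∑ i, pathWeight (inside w r.d (A ∪ B)) (Q i)
      rw [c1]
      push_cast
      linarith
    · rw [hx, e2 _ hxu, comp_merge_of_ne hxu hxv]
      exact h.lb x

/-- Summed over all components, the invariant bounds the total weight of `Q` from below. -/
theorem Inv.le_totalWeight (h : Inv w lam Q t r) (hQ : IsPathSystem Q) :
    lam * ((spanned Q).card : ℝ) - ∑ c ∈ Finset.univ.image r.lab, r.pot c - t * m ≤
      totalWeight w Q := by
  set L := Finset.univ.image r.lab with hL
  have hmem : ∀ x, r.lab x ∈ L := fun x => Finset.mem_image_of_mem _ (Finset.mem_univ x)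
  have h1 : ∀ c ∈ L, lam * ((r.comp c ∩ spanned Q).card : ℝ) - r.pot c
      - t * ((Finset.univ.filter fun i => ∀ y ∈ Q i, y ∈ r.comp c).card : ℝ)
      ≤ ∑ i, pathWeight (inside w r.d (r.comp c)) (Q i) := by
    intro c hc
    obtain ⟨x, -, rfl⟩ := Finset.mem_image.1 hc
    exact h.lb x
  have h2 := Finset.sum_le_sum h1
  rw [Finset.sum_sub_distrib, Finset.sum_sub_distrib, ← Finset.mul_sum, ← Finset.mul_sum,
    Finset.sum_comm] at h2
  have c1 : (∑ c ∈ L, ((r.comp c ∩ spanned Q).card : ℝ)) = ((spanned Q).card : ℝ) := by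
    rw [Finset.card_eq_sum_card_fiberwise (fun x _ => hmem x) (s := spanned Q)]
    push_cast
    refine Finset.sum_congr rfl fun c _ => ?_
    congr 2
    ext x
    simp [and_comm]
  -- Each of the `m` paths is nonempty and so lies inside at most one component.
  have c2 : (∑ c ∈ L, ((Finset.univ.filter fun i => ∀ y ∈ Q i, y ∈ r.comp c).card : ℝ)) ≤ m := by
    have : ∑ c ∈ L, (Finset.univ.filter fun i => ∀ y ∈ Q i, y ∈ r.comp c).card ≤ m := by
      rw [← Finset.card_biUnion]
      · exact (Finset.card_le_univ _).trans_eq (Fintype.card_fin m)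
      · intro a _ b _ hab
        refine Finset.disjoint_left.2 fun i hi hi' => ?_
        simp only [Finset.mem_filter, Finset.mem_univ, true_and, mem_comp] at hi hi'
        obtain ⟨y, hy⟩ := List.exists_mem_of_ne_nil _ (hQ.nonempty i)
        exact hab ((hi y hy).symm.trans (hi' y hy))
    exact_mod_cast this
  have c3 : ∑ i, ∑ c ∈ L, pathWeight (inside w r.d (r.comp c)) (Q i) ≤ totalWeight w Q := by
    refine Finset.sum_le_sum fun i _ => ?_
    rw [← pathWeight_sum]
    refine pathWeight_mono (fun a b => ?_) _
    -- An edge inside a component is counted there at full weight; an edge between two components is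
    -- counted as two moats, which fit into it by `feas`.
    by_cases hab : r.lab a = r.lab b
    · rw [Finset.sum_eq_single (r.lab a)]
      · simp [inside, hab]
      · intro c _ hc
        simp [inside, hc.symm, ← hab]
      · exact fun h' => absurd (hmem a) h'
    · rw [Finset.sum_eq_add (r.lab a) (r.lab b) hab]
      · simpa [inside, hab, Ne.symm hab] using h.feas a b hab
      · rintro c _ ⟨hc, hc'⟩
        simp [inside, hc.symm, hc'.symm]
      · exact fun h' => absurd (hmem a) h'
      · exact fun h' => absurd (hmem b) h'
  have := mul_le_mul_of_nonneg_left c2 h.time_nonneg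
  rw [c1] at h2
  linarith

end Row

end KMinWP

namespace KMinWP

namespace Row

variable {n m : ℕ} {w : Fin n → Fin n → ℝ} {t Δ : ℝ} {r : Row n} {u v : Fin n}

/-! ### The number of active components -/

/-- The labels of the components. -/
def labels (r : Row n) : Finset (Fin n) := Finset.univ.image r.lab

theorem lab_mem_labels (x : Fin n) : r.lab x ∈ r.labels :=
  Finset.mem_image_of_mem _ (Finset.mem_univ x)

/-- `cnt` is the number of active components. -/
def CntOk (r : Row n) : Prop := r.cnt = (r.labels.filter fun c => r.act c = 1).card

theorem CntOk.init (lam : ℝ) : (Row.init n lam).CntOk := by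
  simp [CntOk, labels, Row.init]

theorem CntOk.grow (h : r.CntOk) : (r.grow Δ).CntOk := h

theorem CntOk.deact (h : r.CntOk) (hu : r.act (r.lab u) = 1) : (r.deact u).CntOk := by
  have : ((r.deact u).labels.filter fun c => (r.deact u).act c = 1) =
      (r.labels.filter fun c => r.act c = 1).erase (r.lab u) := by
    ext c
    rw [Finset.mem_filter, Finset.mem_erase, Finset.mem_filter]
    by_cases hc : c = r.lab u <;> simp [Row.deact, labels, hc]
  rw [CntOk, this, Finset.card_erase_of_mem (by simp [hu, lab_mem_labels]), ← h]
  rfl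

theorem labels_merge (huv : r.lab u ≠ r.lab v) : (r.merge u v).labels = r.labels.erase (r.lab v) := by
  ext c
  simp only [labels, Finset.mem_image, Finset.mem_univ, true_and, Finset.mem_erase, Row.merge]
  constructor
  · rintro ⟨x, rfl⟩
    split_ifs with hx
    · exact ⟨huv, u, rfl⟩
    · exact ⟨hx, x, rfl⟩
  · rintro ⟨hc, x, rfl⟩
    exact ⟨x, by simp [hc]⟩

theorem CntOk.merge (h : r.CntOk) (huv : r.lab u ≠ r.lab v) : (r.merge u v).CntOk := by
  rw [CntOk, labels_merge huv, Finset.filter_erase]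
  change (if r.act (r.lab v) = 1 then r.cnt - 1 else r.cnt) =
    ((r.labels.filter fun c => r.act c = 1).erase (r.lab v)).card
  split_ifs with hv
  · rw [Finset.card_erase_of_mem (by simp [hv, lab_mem_labels]), ← h]
  · rw [Finset.erase_eq_of_notMem (by simp [hv]), ← h]

/-- Guarantees that the search for the next event finds a pair as long as the process has not
stopped. -/
theorem CntOk.exists_act (h : r.CntOk) (h0 : 0 < r.cnt) : ∃ x, r.act (r.lab x) = 1 := by
  rw [h, Finset.card_pos] at h0
  obtain ⟨c, hc⟩ := h0
  simp only [labels, Finset.mem_filter, Finset.mem_image, Finset.mem_univ, true_and] at hc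
  obtain ⟨⟨x, rfl⟩, hx⟩ := hc
  exact ⟨x, hx⟩

/-! ### Pruning -/

/-- The state of the pruning process, which undoes the steps of the growing process: `K` is the set
of vertices that are still kept, `deg x` is the number of edges at `x` kept so far, and `cost` is
their weight. -/
structure Pruned (m : ℕ) (M : ℝ) (t : ℝ) (r : Row n) (K : Finset (Fin n)) (deg : Fin n → ℕ)
    (cost : ℝ) : Prop where
  closed : ∀ x ∈ K, ∀ y, r.lab y = r.lab x → y ∈ K
  mem : ∀ x, deg x ≠ 0 → x ∈ K
  two_le : ∀ x ∈ K, r.act (r.lab x) ≠ 1 → 2 ≤ ∑ y ∈ r.comp (r.lab x), deg y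
  count : ∑ x, deg x + 2 * m = 2 * (K.image r.lab).card
  cost_le : cost - ∑ x, (deg x : ℝ) * r.d x - 2 * ∑ c ∈ K.image r.lab, r.pot c - 2 * m * t ≤ M

variable {M cost : ℝ} {K : Finset (Fin n)} {deg : Fin n → ℕ}

/-- Passes from degrees of vertices to degrees of components. Since `K` is a union of components and
vertices outside have degree 0, only components in `K` occur. -/
theorem Pruned.sum_mul (h : Pruned m M t r K deg cost) (g : Fin n → ℝ) :
    ∑ x, (deg x : ℝ) * g (r.lab x) =
      ∑ c ∈ K.image r.lab, ((∑ y ∈ r.comp c, deg y : ℕ) : ℝ) * g c := by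
  have h1 : ∑ x, (deg x : ℝ) * g (r.lab x) = ∑ x ∈ K, (deg x : ℝ) * g (r.lab x) := by
    symm
    refine Finset.sum_subset (Finset.subset_univ _) fun x _ hx => ?_
    have : deg x = 0 := by
      by_contra h'
      exact hx (h.mem x h')
    simp [this]
  rw [h1, ← Finset.sum_fiberwise_of_maps_to (g := r.lab) (t := K.image r.lab)
    (fun x hx => Finset.mem_image_of_mem _ hx)]
  refine Finset.sum_congr rfl fun c hc => ?_
  obtain ⟨x, hx, rfl⟩ := Finset.mem_image.1 hc
  push_cast
  rw [Finset.sum_mul]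
  refine Finset.sum_congr ?_ fun y hy => ?_
  · ext y
    simp only [Finset.mem_filter, mem_comp, and_iff_right_iff_imp]
    exact fun hy => h.closed x hx y hy
  · rw [mem_comp.1 hy]

/-- The average degree argument. Undoing a growth by `Δ` changes the left side of `cost_le` by `Δ`
times the total degree of the active components, minus twice their number, plus `2 * m`. The kept
forest has total degree twice the number of components minus `2 * m`, and each inactive component
takes at least 2 of it, so this change is nonpositive. -/
theorem Pruned.of_grow (h : Pruned m M (t + Δ) (r.grow Δ) K deg cost) (hΔ : 0 ≤ Δ) :
    Pruned m M t r K deg cost := by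
  refine ⟨h.closed, h.mem, h.two_le, h.count, ?_⟩
  set g : Fin n → ℝ := fun c => if r.act c = 1 then 1 else 0 with hg
  have e1 := h.sum_mul g
  have e2 := h.sum_mul fun _ => 1
  change ∑ x, (deg x : ℝ) * g (r.lab x) =
    ∑ c ∈ K.image r.lab, ((∑ y ∈ r.comp c, deg y : ℕ) : ℝ) * g c at e1
  change ∑ x, (deg x : ℝ) * 1 =
    ∑ c ∈ K.image r.lab, ((∑ y ∈ r.comp c, deg y : ℕ) : ℝ) * 1 at e2
  have e3 : ∑ x, (deg x : ℝ) * (r.grow Δ).d x =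
      ∑ x, (deg x : ℝ) * r.d x + Δ * ∑ x, (deg x : ℝ) * g (r.lab x) := by
    rw [Finset.mul_sum, ← Finset.sum_add_distrib]
    refine Finset.sum_congr rfl fun x _ => ?_
    simp only [Row.grow, hg]
    split_ifs <;> ring
  have e4 : ∑ c ∈ K.image r.lab, (r.grow Δ).pot c =
      ∑ c ∈ K.image r.lab, r.pot c - Δ * ∑ c ∈ K.image r.lab, g c := by
    rw [Finset.mul_sum, ← Finset.sum_sub_distrib]
    refine Finset.sum_congr rfl fun x _ => ?_
    simp only [Row.grow, hg]
    split_ifs <;> ring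
  -- Per component: an equality if it is active, and the degree bound `2 ≤ deg` if it is inactive.
  have e5 : ∑ c ∈ K.image r.lab, ((∑ y ∈ r.comp c, deg y : ℕ) : ℝ) * g c ≤
      ∑ c ∈ K.image r.lab, (((∑ y ∈ r.comp c, deg y : ℕ) : ℝ) * 1 - 2 + 2 * g c) := by
    refine Finset.sum_le_sum fun c hc => ?_
    obtain ⟨x, hx, rfl⟩ := Finset.mem_image.1 hc
    simp only [hg]
    split_ifs with hx'
    · linarith
    · have : (2 : ℝ) ≤ ((∑ y ∈ r.comp (r.lab x), deg y : ℕ) : ℝ) := by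
        exact_mod_cast h.two_le x hx hx'
      linarith
  rw [Finset.sum_add_distrib, Finset.sum_sub_distrib, ← e2, ← e1, ← Finset.mul_sum,
    Finset.sum_const, nsmul_eq_mul] at e5
  have e6 : (∑ x, (deg x : ℝ) * 1) + 2 * m = 2 * ((K.image r.lab).card : ℝ) := by
    simp only [mul_one]
    exact_mod_cast h.count
  have := h.cost_le
  rw [e3] at this
  change cost - _ - 2 * ∑ c ∈ K.image r.lab, (r.grow Δ).pot c - 2 * m * (t + Δ) ≤ M at this
  rw [e4] at this
  nlinarith [mul_le_mul_of_nonneg_left e5 hΔ]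

/-- Going back in time the component becomes active, so fewer components are subject to the degree
bound. -/
theorem Pruned.of_deact (h : Pruned m M t (r.deact u) K deg cost) :
    Pruned m M t r K deg cost where
  closed := h.closed
  mem := h.mem
  two_le x hx hx' := by
    refine h.two_le x hx ?_
    simp only [Row.deact]
    split_ifs
    · simp
    · exact hx'
  count := h.count
  cost_le := h.cost_le

theorem lab_merge_eq_iff {x y : Fin n} (hu : r.lab x ≠ r.lab u) (hv : r.lab x ≠ r.lab v) :
    (r.merge u v).lab y = (r.merge u v).lab x ↔ r.lab y = r.lab x := by
  simp only [merge, if_neg hv]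
  split_ifs with h
  · simp [h, hu.symm, hv.symm]
  · rfl

theorem lab_merge_of_eq {x y : Fin n} (h : r.lab y = r.lab x) :
    (r.merge u v).lab y = (r.merge u v).lab x := by
  simp only [merge, h]

/-- Keeping the edge `u`, `v`. -/
theorem Pruned.of_merge_keep (h : Pruned m M t (r.merge u v) K deg cost)
    (huv : r.lab u ≠ r.lab v) (hu : r.act (r.lab u) = 1) (hK : u ∈ K)
    (hw : w u v = r.d u + r.d v)
    (hv : r.act (r.lab v) = 1 ∨ ∃ x, r.lab x = r.lab v ∧ deg x ≠ 0) :
    v ∈ K ∧ Pruned m M t r K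
      (fun x => deg x + (if x = u then 1 else 0) + (if x = v then 1 else 0)) (cost + w u v) := by
  have hvK : v ∈ K := h.closed u hK v (by simp [Row.merge])
  have hbL : r.lab v ∉ K.image (r.merge u v).lab := by
    simp only [Finset.mem_image, not_exists, not_and, Row.merge]
    intro x _
    split_ifs with hx
    · exact huv
    · exact hx
  have hL : K.image r.lab = insert (r.lab v) (K.image (r.merge u v).lab) := by
    ext c
    simp only [Finset.mem_insert, Finset.mem_image, Row.merge]
    constructor
    · rintro ⟨x, hx, rfl⟩
      by_cases hx' : r.lab x = r.lab v
      · exact .inl hx'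
      · exact .inr ⟨x, hx, by simp [hx']⟩
    · rintro (rfl | ⟨x, hx, rfl⟩)
      · exact ⟨v, hvK, rfl⟩
      · split_ifs
        · exact ⟨u, hK, rfl⟩
        · exact ⟨x, hx, rfl⟩
  have huL : r.lab u ∈ K.image (r.merge u v).lab :=
    Finset.mem_image.2 ⟨u, hK, by simp [Row.merge, huv]⟩
  refine ⟨hvK, fun x hx y hy => h.closed x hx y (lab_merge_of_eq hy), fun x hx => ?_,
    fun x hx hx' => ?_, ?_, ?_⟩
  · by_cases hxu : x = u
    · rwa [hxu]
    by_cases hxv : x = v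
    · rwa [hxv]
    · simp only [hxu, hxv, if_false, add_zero] at hx
      exact h.mem x hx
  · have hxu : r.lab x ≠ r.lab u := fun h' => hx' (h' ▸ hu)
    by_cases hxv : r.lab x = r.lab v
    · rw [hxv] at hx' ⊢
      -- If the component of `v` is inactive, it is kept only because it has a kept edge already;
      -- the new edge is its second one.
      obtain ⟨y, hy, hy'⟩ := hv.resolve_left hx'
      rw [Finset.sum_add_distrib, Finset.sum_add_distrib]
      have h1 : 1 ≤ ∑ y ∈ r.comp (r.lab v), deg y :=
        (Nat.one_le_iff_ne_zero.2 hy').trans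
          (Finset.single_le_sum (f := deg) (fun _ _ => Nat.zero_le _) (by simpa using hy))
      have h2 : ∑ y ∈ r.comp (r.lab v), (if y = v then 1 else 0) = 1 := by simp
      omega
    · have h1 := h.two_le x hx (by simpa [Row.merge, hxv] using hx')
      have h2 : (r.merge u v).lab x = r.lab x := by simp [Row.merge, hxv]
      rw [h2, comp_merge_of_ne hxu hxv] at h1
      refine h1.trans (Finset.sum_le_sum fun y _ => ?_)
      omega
  · rw [hL, Finset.card_insert_of_notMem hbL, Finset.sum_add_distrib, Finset.sum_add_distrib]
    have := h.count
    simp only [Finset.sum_ite_eq', Finset.mem_univ, if_true]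
    omega
  · rw [hL, Finset.sum_insert hbL]
    have h1 : ∑ c ∈ K.image (r.merge u v).lab, (r.merge u v).pot c =
        ∑ c ∈ K.image (r.merge u v).lab, r.pot c + r.pot (r.lab v) := by
      rw [← Finset.add_sum_erase _ _ huL, ← Finset.add_sum_erase _ _ huL]
      have : ∑ c ∈ (K.image (r.merge u v).lab).erase (r.lab u), (r.merge u v).pot c =
          ∑ c ∈ (K.image (r.merge u v).lab).erase (r.lab u), r.pot c :=
        Finset.sum_congr rfl fun c hc => by simp [Row.merge, (Finset.mem_erase.1 hc).1]
      rw [this]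
      simp only [Row.merge, if_true]
      ring
    have h2 : ∑ x, ((deg x + (if x = u then 1 else 0) + (if x = v then 1 else 0) : ℕ) : ℝ) * r.d x =
        ∑ x, (deg x : ℝ) * r.d x + r.d u + r.d v := by
      simp [add_mul, Finset.sum_add_distrib]
    have h3 := h.cost_le
    rw [h1] at h3
    change cost - ∑ x, (deg x : ℝ) * r.d x - _ - _ ≤ M at h3
    rw [h2, hw]
    linarith

/-- Deleting the component of `v`. -/
theorem Pruned.of_merge_delete (h : Pruned m M t (r.merge u v) K deg cost)
    (huv : r.lab u ≠ r.lab v) (hpot : r.act (r.lab v) ≠ 1 → r.pot (r.lab v) = 0)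
    (hv : ¬ (u ∈ K ∧ (r.act (r.lab v) = 1 ∨ ∃ x, r.lab x = r.lab v ∧ deg x ≠ 0))) :
    Pruned m M t r (K.filter fun x => r.lab x ≠ r.lab v) deg cost := by
  have hlab : ∀ x, r.lab x ≠ r.lab v → (r.merge u v).lab x = r.lab x := fun x hx => by
    simp [Row.merge, hx]
  have hL : (K.filter fun x => r.lab x ≠ r.lab v).image r.lab = K.image (r.merge u v).lab := by
    ext c
    simp only [Finset.mem_image, Finset.mem_filter]
    constructor
    · rintro ⟨x, ⟨hx, hx'⟩, rfl⟩
      exact ⟨x, hx, hlab x hx'⟩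
    · rintro ⟨x, hx, rfl⟩
      by_cases hx' : r.lab x = r.lab v
      · refine ⟨u, ⟨h.closed x hx u ?_, huv⟩, ?_⟩ <;> simp [Row.merge, hx', huv]
      · exact ⟨x, ⟨hx, hx'⟩, (hlab x hx').symm⟩
  -- A kept edge at this component would put the merged component, hence `u`, into `K`, against
  -- `hv`.
  have hdeg : ∀ x, r.lab x = r.lab v → deg x = 0 := by
    intro x hx
    by_contra h0
    exact hv ⟨h.closed x (h.mem x h0) u (by simp [Row.merge, hx]), .inr ⟨x, hx, h0⟩⟩
  refine ⟨fun x hx y hy => ?_, fun x hx => ?_, fun x hx hx' => ?_, ?_, ?_⟩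
  · rw [Finset.mem_filter] at hx ⊢
    exact ⟨h.closed x hx.1 y (lab_merge_of_eq hy), by rw [hy]; exact hx.2⟩
  · exact Finset.mem_filter.2 ⟨h.mem x hx, fun h' => hx (hdeg x h')⟩
  · rw [Finset.mem_filter] at hx
    have h1 := h.two_le x hx.1 (by rw [hlab x hx.2]; exact hx')
    rw [hlab x hx.2] at h1
    by_cases hxu : r.lab x = r.lab u
    · rw [hxu, comp_merge_left] at h1
      rw [hxu]
      have h2 := Finset.sum_union_inter (s₁ := r.comp (r.lab u)) (s₂ := r.comp (r.lab v)) (f := deg)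
      rw [Finset.sum_eq_zero (s := r.comp (r.lab v)) fun y hy => hdeg y (mem_comp.1 hy)] at h2
      omega
    · rwa [comp_merge_of_ne hxu hx.2] at h1
  · rw [hL]; exact h.count
  -- No potential is lost: if the merged component is in `K`, then `hv` says that the deleted part
  -- is inactive, so its potential is zero.
  · have h1 : ∑ c ∈ K.image (r.merge u v).lab, (r.merge u v).pot c =
        ∑ c ∈ K.image (r.merge u v).lab, r.pot c := by
      refine Finset.sum_congr rfl fun c hc => ?_
      simp only [Row.merge]
      split_ifs with hc'
      · rw [hc', hpot, add_zero]
        intro hact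
        refine hv ⟨?_, .inl hact⟩
        obtain ⟨x, hx, hx'⟩ := Finset.mem_image.1 hc
        refine h.closed x hx u ?_
        rw [hx', hc']
        simp [Row.merge, huv]
      · rfl
    have h3 := h.cost_le
    rw [h1] at h3
    rw [hL]
    exact h3

/-- At the end of the growing process, all vertices in active components are kept. -/
theorem Pruned.of_final (h : r.CntOk) (hm : r.cnt = m) :
    Pruned m (-2 * ∑ c ∈ r.labels with r.act c = 1, r.pot c - 2 * m * t) t r
      (Finset.univ.filter fun x => r.act (r.lab x) = 1) (fun _ => 0) 0 := by
  have hL : (Finset.univ.filter fun x => r.act (r.lab x) = 1).image r.lab =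
      r.labels.filter fun c => r.act c = 1 := by
    ext c
    simp only [Finset.mem_image, Finset.mem_filter, Finset.mem_univ, true_and, labels]
    constructor
    · rintro ⟨x, hx, rfl⟩; exact ⟨⟨x, rfl⟩, hx⟩
    · rintro ⟨⟨x, rfl⟩, hx⟩; exact ⟨x, hx, rfl⟩
  refine ⟨fun x hx y hy => ?_, fun x hx => absurd rfl hx, fun x hx hx' => ?_, ?_, ?_⟩
  · simpa [hy] using hx
  · exact absurd (by simpa using hx) hx'
  · rw [hL, ← h, hm]; simp
  -- No edge is kept yet, and the bound is an equality by the choice of the constant.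
  · rw [hL]; simp

end Row

end KMinWP

namespace KMinWP

open Row Equiv

/-! ### The whole growing process -/

section History

variable {n m k : ℕ} {w : Fin n → Fin n → ℝ} {lam : ℝ}

/-- A run of the growing process with `2 * n` steps. -/
structure History (w : Fin n → Fin n → ℝ) (lam : ℝ) (m : ℕ) (R : ℕ → Row n) (typ : ℕ → ℕ)
    (eu ev : ℕ → Fin n) (Δ : ℕ → ℝ) : Prop where
  init : R 0 = Row.init n lam
  step : ∀ s, s < 2 * n → Step w m (R s) (R (s + 1)) (typ s) (eu s) (ev s) (Δ s)

variable {R : ℕ → Row n} {typ : ℕ → ℕ} {eu ev : ℕ → Fin n} {Δ : ℕ → ℝ}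

namespace History

theorem cntOk (H : History w lam m R typ eu ev Δ) {s : ℕ} (hs : s ≤ 2 * n) : (R s).CntOk := by
  induction s with
  | zero => rw [H.init]; exact .init lam
  | succ s ih =>
    have ih := ih (by omega)
    rcases H.step s (by omega) with ⟨-, h, -⟩ | ⟨-, he, -, h, -⟩ | ⟨-, he, huv, h, -⟩
    · rwa [h]
    · rw [h]; exact ih.grow.deact he.act
    · rw [h]; exact ih.grow.merge huv

theorem cnt_ge (H : History w lam m R typ eu ev Δ) (hmn : m ≤ n) {s : ℕ} (hs : s ≤ 2 * n) :
    m ≤ (R s).cnt := by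
  induction s with
  | zero => rw [H.init]; exact hmn
  | succ s ih =>
    have ih := ih (by omega)
    rcases H.step s (by omega) with ⟨-, h, -⟩ | ⟨hm, he, -, h, -⟩ | ⟨hm, he, huv, h, -⟩
    · rwa [h]
    · rw [h]; simp only [Row.deact, Row.grow]; omega
    · rw [h]
      change m ≤ if (R s).act ((R s).lab (ev s)) = 1 then (R s).cnt - 1 else (R s).cnt
      split_ifs <;> omega

/-- The number of active components plus the number of all components starts at `2 * n` and drops
with every event: a deactivation lowers the first, a merge the second. Hence `2 * n` steps suffice.
-/
theorem cnt_add_le (H : History w lam m R typ eu ev Δ) (hmn : m ≤ n) {s : ℕ} (hs : s ≤ 2 * n) :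
    (R s).cnt = m ∨ (R s).cnt + (R s).labels.card + s ≤ 2 * n := by
  induction s with
  | zero =>
    right
    rw [H.init]
    simp [Row.init, labels]
    omega
  | succ s ih =>
    have hge := H.cnt_ge hmn (s := s) (by omega)
    rcases H.step s (by omega) with ⟨hm, h, -⟩ | ⟨hm, he, -, h, -⟩ | ⟨hm, he, huv, h, -⟩
    · left; rw [h]; omega
    · right
      have ih := (ih (by omega)).resolve_left (by omega)
      rw [h]
      change (R s).cnt - 1 + (R s).labels.card + (s + 1) ≤ 2 * n
      omega
    · right
      have ih := (ih (by omega)).resolve_left (by omega)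
      have hl : (R s).lab (ev s) ∈ (R s).labels := lab_mem_labels _
      have hl' := Finset.card_erase_add_one hl
      rw [h, labels_merge (r := (R s).grow (Δ s)) huv]
      change (if (R s).act ((R s).lab (ev s)) = 1 then (R s).cnt - 1 else (R s).cnt) +
        ((R s).labels.erase ((R s).lab (ev s))).card + (s + 1) ≤ 2 * n
      split_ifs <;> omega

theorem cnt_final (H : History w lam m R typ eu ev Δ) (hm : 1 ≤ m) (hmn : m ≤ n) :
    (R (2 * n)).cnt = m := by
  rcases H.cnt_add_le hmn le_rfl with h | h
  · exact h
  · have := H.cnt_ge hmn le_rfl; omega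

theorem inv (H : History w lam m R typ eu ev Δ) (hw : IsMetric w) (hlam : 0 ≤ lam)
    {Q : Fin m → List (Fin n)} (hQ : IsPathSystem Q) {s : ℕ} (hs : s ≤ 2 * n) :
    Inv w lam Q (∑ j ∈ Finset.range s, Δ j) (R s) := by
  induction s with
  | zero => rw [H.init]; exact .init hw hlam
  | succ s ih =>
    have ih := ih (by omega)
    rw [Finset.sum_range_succ]
    rcases H.step s (by omega) with ⟨-, h, -, h0⟩ | ⟨-, he, huv, h, -⟩ | ⟨-, he, huv, h, -⟩
    · rw [h, h0, add_zero]; exact ih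
    · rw [h]
      -- For a pair inside one component the growth equals the remaining potential, which is
      -- therefore used up exactly.
      refine (ih.grow hw he).deact ?_
      have h1 := he.eq
      rw [val, if_pos huv] at h1
      simp [Row.grow, he.act, h1]
    · rw [h]
      exact (ih.grow hw he).merge huv he.act hQ

end History

/-! ### The whole pruning process -/

/-- The state of the pruning process after the steps with numbers at least `s` have been undone. -/
structure Pruning (w : Fin n → Fin n → ℝ) (m : ℕ) (R : ℕ → Row n) (typ : ℕ → ℕ)
    (eu ev : ℕ → Fin n) (Δ : ℕ → ℝ) (s : ℕ) (K : Finset (Fin n)) (deg : Fin n → ℕ)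
    (keep : ℕ → ℕ) : Prop where
  pruned : Pruned m (-2 * ∑ c ∈ (R (2 * n)).labels with (R (2 * n)).act c = 1, (R (2 * n)).pot c
    - 2 * m * ∑ j ∈ Finset.range (2 * n), Δ j) (∑ j ∈ Finset.range s, Δ j) (R s) K deg
    (∑ j ∈ Finset.Ico s (2 * n) with keep j = 1, w (eu j) (ev j))
  active : ∀ x ∈ K, (R (2 * n)).act ((R (2 * n)).lab x) = 1
  kept : ∀ j, s ≤ j → j < 2 * n → keep j = 1 → typ j = 1 ∧ deg (eu j) ≠ 0 ∧ deg (ev j) ≠ 0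
  unkept : ∀ j, s ≤ j → j < 2 * n → keep j ≠ 1 → typ j = 1 →
    ∀ x ∈ K, (R j).lab x ≠ (R j).lab (ev j)

variable {s : ℕ} {K : Finset (Fin n)} {deg : Fin n → ℕ} {keep keep' : ℕ → ℕ}

theorem Pruning.of_final (H : History w lam m R typ eu ev Δ) (hm : 1 ≤ m) (hmn : m ≤ n)
    (keep : ℕ → ℕ) : Pruning w m R typ eu ev Δ (2 * n)
      (Finset.univ.filter fun x => (R (2 * n)).act ((R (2 * n)).lab x) = 1) (fun _ => 0) keep where
  pruned := by
    have := Pruned.of_final (t := ∑ j ∈ Finset.range (2 * n), Δ j) (H.cntOk le_rfl)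
      (H.cnt_final hm hmn)
    simpa using this
  active := by simp
  kept j h h' := by omega
  unkept j h h' := by omega

theorem sum_keep_succ (hs : s < 2 * n) (hk : ∀ j, j ≠ s → keep' j = keep j) :
    ∑ j ∈ Finset.Ico s (2 * n) with keep' j = 1, w (eu j) (ev j) =
      ∑ j ∈ Finset.Ico (s + 1) (2 * n) with keep j = 1, w (eu j) (ev j) +
        if keep' s = 1 then w (eu s) (ev s) else 0 := by
  rw [Finset.sum_filter, Finset.sum_eq_sum_Ico_succ_bot hs, add_comm, Finset.sum_filter]
  congr 1
  refine Finset.sum_congr rfl fun j hj => ?_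
  rw [hk j (by have := Finset.mem_Ico.1 hj; omega)]

/-- The path system `Q` serves only to make the invariant `Inv` available, from which the growth is
known to be nonnegative; any `Q` will do. -/
theorem Pruning.of_typ_ne (P : Pruning w m R typ eu ev Δ (s + 1) K deg keep)
    (H : History w lam m R typ eu ev Δ) (hw : IsMetric w) (hlam : 0 ≤ lam)
    {Q : Fin m → List (Fin n)} (hQ : IsPathSystem Q)
    (hs : s < 2 * n) (ht : typ s ≠ 1) (hk : ∀ j, j ≠ s → keep' j = keep j) (hks : keep' s ≠ 1) :
    Pruning w m R typ eu ev Δ s K deg keep' where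
  pruned := by
    have h1 := P.pruned
    rw [Finset.sum_range_succ] at h1
    rw [sum_keep_succ hs hk, if_neg hks, add_zero]
    rcases H.step s hs with ⟨-, h, -, h0⟩ | ⟨-, he, huv, h, -⟩ | ⟨-, he, huv, h, ht'⟩
    · rwa [h, h0, add_zero] at h1
    · rw [h] at h1
      exact h1.of_deact.of_grow (he.nonneg (H.inv hw hlam hQ hs.le))
    · exact absurd ht' ht
  active := P.active
  kept j h h' hj := by
    have : j ≠ s := fun h' => hks (h' ▸ hj)
    exact P.kept j (by omega) h' (by rwa [← hk j this])
  unkept j h h' hj hj' := by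
    have : j ≠ s := fun h' => ht (h' ▸ hj')
    exact P.unkept j (by omega) h' (by rwa [← hk j this]) hj'

/-- A forward step grows first and merges second, so the merge is undone by `Pruned.of_merge_keep`
and then the growth by `Pruned.of_grow`. -/
theorem Pruning.of_keep (P : Pruning w m R typ eu ev Δ (s + 1) K deg keep)
    (H : History w lam m R typ eu ev Δ) (hw : IsMetric w) (hlam : 0 ≤ lam)
    {Q : Fin m → List (Fin n)} (hQ : IsPathSystem Q)
    (hs : s < 2 * n) (ht : typ s = 1) (hk : ∀ j, j ≠ s → keep' j = keep j) (hks : keep' s = 1)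
    (hu : eu s ∈ K)
    (hv : (R s).act ((R s).lab (ev s)) = 1 ∨ ∃ x, (R s).lab x = (R s).lab (ev s) ∧ deg x ≠ 0) :
    Pruning w m R typ eu ev Δ s K
      (fun x => deg x + (if x = eu s then 1 else 0) + (if x = ev s then 1 else 0)) keep' := by
  have h1 := P.pruned
  rw [Finset.sum_range_succ] at h1
  obtain ⟨-, he, huv, h, -⟩ : m < (R s).cnt ∧ (R s).IsEvent w (eu s) (ev s) (Δ s) ∧
      (R s).lab (eu s) ≠ (R s).lab (ev s) ∧
      R (s + 1) = ((R s).grow (Δ s)).merge (eu s) (ev s) ∧ typ s = 1 := by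
    rcases H.step s hs with ⟨-, h, h', -⟩ | ⟨-, he, huv, h, h'⟩ | h
    · omega
    · omega
    · exact h
  rw [h] at h1
  -- The edge is tight after the growth: the growth is half of the gap if both ends grow, and the
  -- whole gap if only the first one does.
  have hd : w (eu s) (ev s) = ((R s).grow (Δ s)).d (eu s) + ((R s).grow (Δ s)).d (ev s) := by
    have h2 := he.eq
    simp only [val, if_neg huv] at h2
    simp only [Row.grow, if_pos he.act]
    split_ifs at h2 ⊢ <;> linarith
  obtain ⟨hvK, h3⟩ := h1.of_merge_keep huv he.act hu hd hv
  refine ⟨?_, P.active, fun j hj hj' hj'' => ?_, fun j hj hj' hj'' hjt => ?_⟩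
  · rw [sum_keep_succ hs hk, if_pos hks]
    exact h3.of_grow (he.nonneg (H.inv hw hlam hQ hs.le))
  · by_cases hjs : j = s
    · subst hjs
      exact ⟨ht, by simp, by simp⟩
    · obtain ⟨h4, h5, h6⟩ := P.kept j (by omega) hj' (by rwa [← hk j hjs])
      exact ⟨h4, by omega, by omega⟩
  · have : j ≠ s := fun h' => hj'' (h' ▸ hks)
    exact P.unkept j (by omega) hj' (by rwa [← hk j this]) hjt

theorem Pruning.of_delete (P : Pruning w m R typ eu ev Δ (s + 1) K deg keep)
    (H : History w lam m R typ eu ev Δ) (hw : IsMetric w) (hlam : 0 ≤ lam)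
    {Q : Fin m → List (Fin n)} (hQ : IsPathSystem Q)
    (hs : s < 2 * n) (ht : typ s = 1) (hk : ∀ j, j ≠ s → keep' j = keep j) (hks : keep' s ≠ 1)
    (hv : ¬ (eu s ∈ K ∧ ((R s).act ((R s).lab (ev s)) = 1 ∨
      ∃ x, (R s).lab x = (R s).lab (ev s) ∧ deg x ≠ 0))) :
    Pruning w m R typ eu ev Δ s (K.filter fun x => (R s).lab x ≠ (R s).lab (ev s)) deg keep' := by
  have h1 := P.pruned
  rw [Finset.sum_range_succ] at h1
  obtain ⟨-, he, huv, h, -⟩ : m < (R s).cnt ∧ (R s).IsEvent w (eu s) (ev s) (Δ s) ∧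
      (R s).lab (eu s) ≠ (R s).lab (ev s) ∧
      R (s + 1) = ((R s).grow (Δ s)).merge (eu s) (ev s) ∧ typ s = 1 := by
    rcases H.step s hs with ⟨-, h, h', -⟩ | ⟨-, he, huv, h, h'⟩ | h
    · omega
    · omega
    · exact h
  rw [h] at h1
  have hpot : ((R s).grow (Δ s)).act (((R s).grow (Δ s)).lab (ev s)) ≠ 1 →
      ((R s).grow (Δ s)).pot (((R s).grow (Δ s)).lab (ev s)) = 0 := fun hact =>
    ((H.inv hw hlam hQ hs.le).grow hw he).pot_zero _ hact
  have h3 := h1.of_merge_delete huv hpot hv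
  refine ⟨?_, fun x hx => P.active x (Finset.mem_filter.1 hx).1, fun j hj hj' hj'' => ?_,
    fun j hj hj' hj'' hjt x hx => ?_⟩
  · rw [sum_keep_succ hs hk, if_neg hks, add_zero]
    exact h3.of_grow (he.nonneg (H.inv hw hlam hQ hs.le))
  · have : j ≠ s := fun h' => hks (h' ▸ hj'')
    exact P.kept j (by omega) hj' (by rwa [← hk j this])
  · rw [Finset.mem_filter] at hx
    by_cases hjs : j = s
    · subst hjs; exact hx.2
    · exact P.unkept j (by omega) hj' (by rwa [← hk j hjs]) hjt x hx.1

/-- The kept edges satisfy the Lagrangian guarantee. -/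
theorem Pruning.cost_le (P : Pruning w m R typ eu ev Δ 0 K deg keep)
    (H : History w lam m R typ eu ev Δ) (hw : IsMetric w) (hlam : 0 ≤ lam)
    {Q : Fin m → List (Fin n)} (hQ : Feasible k Q) :
    ∑ j ∈ Finset.Ico 0 (2 * n) with keep j = 1, w (eu j) (ev j) ≤
      2 * (totalWeight w Q + lam * (K.card - k)) := by
  have h1 := (H.inv hw hlam hQ.1 le_rfl).le_totalWeight hQ.1
  have h2 := P.pruned.cost_le
  rw [H.init] at h2
  have h3 : K.image (Row.init n lam).lab = K := Finset.image_id
  rw [h3] at h2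
  have h4 : ∑ x, (deg x : ℝ) * (Row.init n lam).d x = 0 := by simp [Row.init]
  have h5 : ∑ c ∈ K, (Row.init n lam).pot c = K.card * lam := by simp [Row.init]
  -- The dual bound sums over all components, the primal one over the active ones; inactive
  -- components have no potential left, so the two terms cancel.
  have h6 : ∑ c ∈ Finset.univ.image (R (2 * n)).lab, (R (2 * n)).pot c =
      ∑ c ∈ (R (2 * n)).labels with (R (2 * n)).act c = 1, (R (2 * n)).pot c := by
    rw [Finset.sum_filter]
    refine Finset.sum_congr rfl fun c hc => ?_
    split_ifs with hact
    · rfl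
    · obtain ⟨x, -, rfl⟩ := Finset.mem_image.1 hc
      exact (H.inv hw hlam hQ.1 le_rfl).pot_zero x hact
  have h7 : (k : ℝ) ≤ (spanned Q).card := by exact_mod_cast hQ.2
  rw [h4, h5, Finset.sum_range_zero] at h2
  rw [h6] at h1
  nlinarith

/-- At the start all components are singletons, so the forest identity in `count` reads `∑ deg + 2 *
m = 2 * |K|`. -/
theorem Pruning.le_card (P : Pruning w m R typ eu ev Δ 0 K deg keep)
    (H : History w lam m R typ eu ev Δ) : m ≤ K.card := by
  have h := P.pruned.count
  rw [H.init] at h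
  have h3 : K.image (Row.init n lam).lab = K := Finset.image_id
  rw [h3] at h
  omega

/-- Kept vertices lie in components that are active at the end, and there are exactly `m` of these.
This bounds the number of tours. -/
theorem Pruning.card_image_le (P : Pruning w m R typ eu ev Δ 0 K deg keep)
    (H : History w lam m R typ eu ev Δ) (hm : 1 ≤ m) (hmn : m ≤ n) :
    (K.image (R (2 * n)).lab).card ≤ m := by
  rw [← H.cnt_final hm hmn, H.cntOk le_rfl]
  refine Finset.card_le_card fun c hc => ?_
  obtain ⟨x, hx, rfl⟩ := Finset.mem_image.1 hc
  exact Finset.mem_filter.2 ⟨lab_mem_labels x, P.active x hx⟩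

/-! ### Tours -/

/-- Following `σ` from `x` until `u` is reached, neither `u` nor `v` (which is on another cycle) is
met earlier, so the transposition does not interfere. -/
theorem sameCycle_mul_swap_of_pow {σ : Perm (Fin n)} {u v : Fin n} (huv : ¬ σ.SameCycle u v) (i : ℕ) :
    ∀ x, (σ ^ i) x = u → (σ * swap u v).SameCycle x u := by
  induction i with
  | zero => rintro x rfl; exact .rfl
  | succ i ih =>
    intro x hx
    by_cases hxu : x = u
    · rw [hxu]
    have hxv : x ≠ v := by
      rintro rfl
      exact huv (Perm.SameCycle.symm ⟨(i + 1 : ℕ), by rw [zpow_natCast]; exact hx⟩)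
    have h1 : (σ * swap u v) x = σ x := by rw [Perm.mul_apply, swap_apply_of_ne_of_ne hxu hxv]
    have h2 := ih (σ x) (by rwa [pow_succ, Perm.mul_apply] at hx)
    rw [← h1] at h2
    exact Perm.sameCycle_apply_left.1 h2

theorem sameCycle_mul_swap_left {σ : Perm (Fin n)} {u v x : Fin n} (huv : ¬ σ.SameCycle u v)
    (hx : σ.SameCycle x u) : (σ * swap u v).SameCycle x u := by
  obtain ⟨i, hi⟩ := hx.exists_nat_pow_eq
  exact sameCycle_mul_swap_of_pow huv i x hi

/-- Multiplication by a transposition joins two cycles. -/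
theorem sameCycle_mul_swap {σ : Perm (Fin n)} {u v : Fin n} (huv : ¬ σ.SameCycle u v) :
    (σ * swap u v).SameCycle u v := by
  have h1 : (σ * swap v u).SameCycle (σ v) v :=
    sameCycle_mul_swap_left (fun h => huv h.symm) (Perm.sameCycle_apply_left.2 .rfl)
  rw [swap_comm] at h1
  have h2 : (σ * swap u v) u = σ v := by simp
  rw [← h2] at h1
  exact Perm.sameCycle_apply_left.1 h1

/-- The cycles of `σ` are tours of the kept vertices of the components, of total weight at most
twice `cost`. -/
structure Tour (w : Fin n → Fin n → ℝ) (r : Row n) (K : Finset (Fin n)) (σ : Perm (Fin n))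
    (cost : ℝ) : Prop where
  lab : ∀ x, r.lab (σ x) = r.lab x
  fix : ∀ x, x ∉ K → σ x = x
  same : ∀ x ∈ K, ∀ y ∈ K, r.lab x = r.lab y → σ.SameCycle x y
  weight : ∑ x, w x (σ x) ≤ 2 * cost

variable {r : Row n} {σ : Perm (Fin n)} {cost : ℝ} {u v : Fin n}

theorem Tour.init (hw : IsMetric w) : Tour w (Row.init n lam) K 1 0 where
  lab _ := rfl
  fix _ _ := rfl
  same x _ y _ h := by
    have : x = y := h
    rw [this]
  weight := by simp [hw.self]

theorem Tour.lab_eq (h : Tour w r K σ cost) {x y : Fin n} (hxy : σ.SameCycle x y) :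
    r.lab x = r.lab y := by
  obtain ⟨i, rfl⟩ := hxy.exists_nat_pow_eq
  induction i with
  | zero => rfl
  | succ i ih =>
    rw [pow_succ', Perm.mul_apply, h.lab]
    exact ih ((Perm.SameCycle.refl σ x).symm.trans ⟨i, by simp⟩)

/-- A merge along a discarded edge adds only discarded vertices, so no tours need to be joined. -/
theorem Tour.merge_unkept (h : Tour w r K σ cost) (hK : ∀ x ∈ K, r.lab x ≠ r.lab v) :
    Tour w (r.merge u v) K σ cost where
  lab x := lab_merge_of_eq (h.lab x)
  fix := h.fix
  same x hx y hy hxy := by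
    refine h.same x hx y hy ?_
    simpa [Row.merge, hK x hx, hK y hy] using hxy
  weight := h.weight

/-- The tours through `u` and `v` are spliced by exchanging the successors of `u` and `v`. Each of
the two new edges is short-cut through the edge `u`, `v`, which is where the factor 2 comes from. -/
theorem Tour.merge_kept (h : Tour w r K σ cost) (hw : IsMetric w) (huv : r.lab u ≠ r.lab v)
    (hu : u ∈ K) (hv : v ∈ K) :
    Tour w (r.merge u v) K (σ * swap u v) (cost + w u v) := by
  have hne : u ≠ v := fun h' => huv (h' ▸ rfl)
  have hcyc : ¬ σ.SameCycle u v := fun h' => huv (h.lab_eq h')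
  have hcyc' : ¬ σ.SameCycle v u := fun h' => hcyc h'.symm
  have hj := sameCycle_mul_swap hcyc
  have hl : ∀ x, σ.SameCycle x u → (σ * swap u v).SameCycle x u := fun x =>
    sameCycle_mul_swap_left hcyc
  have hr : ∀ x, σ.SameCycle x v → (σ * swap u v).SameCycle x u := fun x hx => by
    have := sameCycle_mul_swap_left hcyc' hx
    rw [swap_comm] at this
    exact this.trans hj.symm
  -- Tours through neither `u` nor `v` stay as they are.
  have hother : ∀ x i, ¬ σ.SameCycle x u → ¬ σ.SameCycle x v →
      ((σ * swap u v) ^ i) x = (σ ^ i) x := by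
    intro x i hxu hxv
    induction i with
    | zero => rfl
    | succ i ih =>
      rw [pow_succ', Perm.mul_apply, ih, pow_succ', Perm.mul_apply, Perm.mul_apply,
        swap_apply_of_ne_of_ne]
      · exact fun h' => hxu ⟨i, by rw [zpow_natCast, h']⟩
      · exact fun h' => hxv ⟨i, by rw [zpow_natCast, h']⟩
  refine ⟨fun x => ?_, fun x hx => ?_, fun x hx y hy hxy => ?_, ?_⟩
  · by_cases hxu : x = u
    · subst hxu; simp [Row.merge, h.lab]
    by_cases hxv : x = v
    · subst hxv; simp [Row.merge, h.lab]
    · rw [Perm.mul_apply, swap_apply_of_ne_of_ne hxu hxv]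
      exact lab_merge_of_eq (h.lab x)
  · rw [Perm.mul_apply, swap_apply_of_ne_of_ne]
    · exact h.fix x hx
    · exact fun h' => hx (h' ▸ hu)
    · exact fun h' => hx (h' ▸ hv)
  · have key : ∀ x ∈ K, (r.merge u v).lab x = r.lab u → (σ * swap u v).SameCycle x u := by
      intro x hx hxl
      by_cases hxv : r.lab x = r.lab v
      · exact hr x (h.same x hx v hv hxv)
      · simp only [Row.merge, if_neg hxv] at hxl
        exact hl x (h.same x hx u hu hxl)
    by_cases hxl : (r.merge u v).lab x = r.lab u
    · exact (key x hx hxl).trans (key y hy (hxy ▸ hxl)).symm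
    · have hxv : r.lab x ≠ r.lab v := fun h' => hxl (by simp [Row.merge, h'])
      have hxu : r.lab x ≠ r.lab u := fun h' => hxl (by simp [Row.merge, h'])
      have hyx : r.lab y = r.lab x := (lab_merge_eq_iff hxu hxv).1 hxy.symm
      obtain ⟨i, hi⟩ := (h.same x hx y hy hyx.symm).exists_nat_pow_eq
      refine ⟨i, ?_⟩
      rw [zpow_natCast, hother x i (fun h' => hxu (h.lab_eq h')) (fun h' => hxv (h.lab_eq h')), hi]
  · have h1 : ∀ f : Fin n → ℝ, ∑ x, f x = f u + f v + ∑ x ∈ (Finset.univ.erase u).erase v, f x := by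
      intro f
      rw [← Finset.add_sum_erase _ f (Finset.mem_univ u), ← Finset.add_sum_erase _ f
        (Finset.mem_erase.2 ⟨hne.symm, Finset.mem_univ v⟩), add_assoc]
    have h2 : ∑ x ∈ (Finset.univ.erase u).erase v, w x ((σ * swap u v) x) =
        ∑ x ∈ (Finset.univ.erase u).erase v, w x (σ x) := by
      refine Finset.sum_congr rfl fun x hx => ?_
      simp only [Finset.mem_erase] at hx
      rw [Perm.mul_apply, swap_apply_of_ne_of_ne hx.2.1 hx.1]
    have h3 := h.weight
    rw [h1] at h3 ⊢
    rw [h2]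
    simp only [Perm.mul_apply, swap_apply_left, swap_apply_right]
    linarith [hw.triangle u v (σ v), hw.triangle v u (σ u), hw.symm u v]

/-- One more step of the growing process. -/
theorem Tour.step_unkept {σ : Perm (Fin n)} (h : Tour w (R s) K σ cost)
    (H : History w lam m R typ eu ev Δ) (P : Pruning w m R typ eu ev Δ 0 K deg keep)
    (hs : s < 2 * n) (hk : keep s ≠ 1) : Tour w (R (s + 1)) K σ cost := by
  rcases H.step s hs with ⟨-, h', -⟩ | ⟨-, he, huv, h', -⟩ | ⟨-, he, huv, h', ht⟩
  · rwa [h']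
  · rw [h']; exact ⟨h.lab, h.fix, h.same, h.weight⟩
  · rw [h']
    have h1 : Tour w ((R s).grow (Δ s)) K σ cost := ⟨h.lab, h.fix, h.same, h.weight⟩
    exact h1.merge_unkept (P.unkept s (Nat.zero_le _) hs hk ht)

theorem Tour.step_kept {σ : Perm (Fin n)} (h : Tour w (R s) K σ cost)
    (H : History w lam m R typ eu ev Δ) (hw : IsMetric w)
    (P : Pruning w m R typ eu ev Δ 0 K deg keep)
    (hs : s < 2 * n) (hk : keep s = 1) :
    eu s ≠ ev s ∧ Tour w (R (s + 1)) K (σ * swap (eu s) (ev s)) (cost + w (eu s) (ev s)) := by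
  obtain ⟨ht, hu, hv⟩ := P.kept s (Nat.zero_le _) hs hk
  rcases H.step s hs with ⟨-, h', ht', -⟩ | ⟨-, he, huv, h', ht'⟩ | ⟨-, he, huv, h', -⟩
  · omega
  · omega
  · rw [h']
    have h1 : Tour w ((R s).grow (Δ s)) K σ cost := ⟨h.lab, h.fix, h.same, h.weight⟩
    exact ⟨fun h' => huv (h' ▸ rfl),
      h1.merge_kept hw huv (P.pruned.mem _ hu) (P.pruned.mem _ hv)⟩

end History

end KMinWP

namespace KMinWP

/-! ### Windows of a sequence of vertices -/

section Windows

variable {W : ℕ → ℕ → ℝ} {a b : ℕ → ℕ}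

/-- The weight of the pieces of the window `[s, s + len)` of the sequence `a`, which is cut in front
of each position with `b = 0`. -/
noncomputable def segCost (W : ℕ → ℕ → ℝ) (a b : ℕ → ℕ) (s len : ℕ) : ℝ :=
  ∑ q ∈ Finset.range len, if q = 0 ∨ b (s + q) = 0 then 0 else W (a (s + q - 1)) (a (s + q))

/-- The number of pieces of a window. -/
def segCount (b : ℕ → ℕ) (s len : ℕ) : ℕ :=
  ((Finset.range len).filter fun q => q = 0 ∨ b (s + q) = 0).card

theorem segCost_nonneg (hW : ∀ i j, 0 ≤ W i j) (s len : ℕ) : 0 ≤ segCost W a b s len :=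
  Finset.sum_nonneg fun q _ => by split_ifs; exacts [le_rfl, hW _ _]

theorem segCost_mono (hW : ∀ i j, 0 ≤ W i j) (s : ℕ) {len len' : ℕ} (h : len ≤ len') :
    segCost W a b s len ≤ segCost W a b s len' :=
  Finset.sum_le_sum_of_subset_of_nonneg (Finset.range_subset_range.2 h) fun q _ _ => by
    split_ifs; exacts [le_rfl, hW _ _]

/-- Cutting in front of position `s` can only drop the edge that enters it. -/
theorem segCost_add_le (hW : ∀ i j, 0 ≤ W i j) (s len : ℕ) :
    segCost W a b 0 s + segCost W a b s len ≤ segCost W a b 0 (s + len) := by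
  simp only [segCost, Finset.sum_range_add]
  refine add_le_add le_rfl (Finset.sum_le_sum fun q _ => ?_)
  by_cases hq : q = 0
  · simp only [hq, true_or, if_true]
    split_ifs; exacts [le_rfl, hW _ _]
  · simp [hq]

theorem sum_segCost_le (hW : ∀ i j, 0 ≤ W i j) (k f : ℕ) :
    ∑ j ∈ Finset.range f, segCost W a b (j * k) k ≤ segCost W a b 0 (f * k) := by
  induction f with
  | zero => simp [segCost]
  | succ f ih =>
    rw [Finset.sum_range_succ, Nat.succ_mul]
    linarith [segCost_add_le (a := a) (b := b) hW (f * k) k]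

/-- One of the blocks of length `k` has at most the average weight. -/
theorem exists_segCost_le (hW : ∀ i j, 0 ≤ W i j) {k N : ℕ} (hk : 1 ≤ k) (hkN : k ≤ N) :
    ∃ s, s + k ≤ N ∧ segCost W a b s k * ((N / k : ℕ) : ℝ) ≤ segCost W a b 0 N := by
  set f := N / k with hf
  have hf1 : 1 ≤ f := (Nat.one_le_div_iff (by omega)).2 hkN
  have hfk : f * k ≤ N := Nat.div_mul_le_self N k
  by_contra hcon
  push Not at hcon
  have h1 : ∀ j ∈ Finset.range f,
      segCost W a b 0 N / f < segCost W a b (j * k) k := by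
    intro j hj
    have hj' : (j + 1) * k ≤ f * k := Nat.mul_le_mul_right k (Finset.mem_range.1 hj)
    have := hcon (j * k) (by rw [Nat.succ_mul] at hj'; omega)
    rwa [div_lt_iff₀ (by exact_mod_cast hf1)]
  have h2 := Finset.sum_lt_sum_of_nonempty (by simpa using by omega) h1
  have h3 := sum_segCost_le (a := a) (b := b) hW k f
  have h4 := segCost_mono (a := a) (b := b) hW 0 hfk
  rw [Finset.sum_const, Finset.card_range, nsmul_eq_mul,
    mul_div_cancel₀ _ (by exact_mod_cast (by omega : f ≠ 0))] at h2
  linarith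

/-- The first piece of the window may begin in the middle of a piece of the sequence; it is charged
to position 0, which always begins a piece. -/
theorem segCount_le {s len N : ℕ} (h : s + len ≤ N) : segCount b s len ≤ segCount b 0 N := by
  refine Finset.card_le_card_of_injOn (fun q => if q = 0 then 0 else s + q) ?_ ?_
  · intro q hq
    simp only [Finset.coe_filter, Finset.mem_range, Set.mem_ofPred_eq] at hq ⊢
    split_ifs with h0
    · exact ⟨by omega, .inl rfl⟩
    · exact ⟨by omega, .inr (by simpa using hq.2.resolve_left h0)⟩
  · intro q _ q' _ hqq
    simp only at hqq
    split_ifs at hqq <;> omega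

end Windows

/-! ### The quality of the best window -/

section Quality

variable {n m k : ℕ} {w : Fin n → Fin n → ℝ} {α lam z : ℝ}

/-- The value `z` is at most the score of each window of some sequence of vertices that is
produced for the potential `lam`. -/
def Beaten (w : Fin n → Fin n → ℝ) (m k : ℕ) (α lam z : ℝ) : Prop :=
  ∃ (N : ℕ) (S : ℝ), m ≤ N ∧ N ≤ n ∧ 0 ≤ S ∧
    (∀ Q : Fin m → List (Fin n), Feasible k Q → S ≤ 4 * (totalWeight w Q + lam * (N - k))) ∧
    (k ≤ N → z * (4 * ((N / k : ℕ) : ℝ)) ≤ S) ∧ (N < k → α * k ≤ N → z ≤ S)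

/-- Every edge of a path of weight at most `T` itself weighs at most `T`, hence at most `M`. With
`M` the largest edge weight not above the weight of `Q`, this locates that weight between `M` and `n
* M`. -/
theorem pathWeight_le {T M : ℝ} (hw : IsMetric w) (hM : 0 ≤ M) (h : ∀ u v, w u v ≤ T → w u v ≤ M)
    (l : List (Fin n)) (hl : pathWeight w l ≤ T) : pathWeight w l ≤ l.length * M := by
  induction l using pathWeight.induct with
  | case1 => simp [pathWeight]
  | case2 => simpa [pathWeight] using hM
  | case3 u v l ih =>
    simp only [pathWeight] at hl ⊢
    have h1 := hw.nonneg u v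
    have h2 := pathWeight_nonneg hw.nonneg (v :: l)
    have h3 := ih (by linarith)
    have h4 := h u v (by linarith)
    rw [List.length_cons]
    push_cast
    linarith

theorem IsPathSystem.card_spanned {Q : Fin m → List (Fin n)} (hQ : IsPathSystem Q) :
    (spanned Q).card = ∑ i, (Q i).length := by
  rw [spanned, Finset.card_biUnion]
  · exact Finset.sum_congr rfl fun i _ => List.toFinset_card_of_nodup (hQ.nodup i)
  · intro i _ j _ hij
    refine Finset.disjoint_left.2 fun x hx hx' => ?_
    exact hQ.disjoint i j hij (List.mem_toFinset.1 hx) (List.mem_toFinset.1 hx')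

theorem totalWeight_nonneg (hw : IsMetric w) (Q : Fin m → List (Fin n)) : 0 ≤ totalWeight w Q :=
  Finset.sum_nonneg fun _ _ => pathWeight_nonneg hw.nonneg _

theorem Feasible.totalWeight_pos {Q : Fin m → List (Fin n)} (hQ : Feasible k Q) (hw : IsMetric w)
    (hmk : m < k) : 0 < totalWeight w Q := by
  -- Pigeonhole: `m` single vertices cannot span `k > m` vertices.
  obtain ⟨i, hi⟩ : ∃ i, 2 ≤ (Q i).length := by
    by_contra hcon
    push Not at hcon
    have h1 := hQ.2
    rw [hQ.1.card_spanned] at h1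
    have h2 : ∑ i, (Q i).length ≤ ∑ _i : Fin m, 1 :=
      Finset.sum_le_sum fun i _ => Nat.le_of_lt_succ (hcon i)
    simp at h2
    omega
  refine Finset.sum_pos' (fun i _ => pathWeight_nonneg hw.nonneg _) ⟨i, Finset.mem_univ i, ?_⟩
  obtain ⟨x, y, l, hl⟩ : ∃ x y l, Q i = x :: y :: l := by
    match h : Q i with
    | [] => rw [h] at hi; simp at hi
    | [x] => rw [h] at hi; simp at hi
    | x :: y :: l => exact ⟨x, y, l, rfl⟩
  have hnd := hQ.1.nodup i
  rw [hl] at hnd ⊢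
  have hxy : x ≠ y := by
    rintro rfl
    simp at hnd
  have := pathWeight_nonneg hw.nonneg (y :: l)
  simp only [pathWeight]
  linarith [hw.pos x y hxy]

/-- Here `l` is a potential for which fewer than `α * K` vertices were kept, so `l ≤ wt / ((1 - α) *
K)`; for the potential `2 * l`, `A ≥ K` vertices were kept, and `f` is the number of blocks of
length `K`. Substituting gives `wt + 2 * l * (A - K) ≤ 2 * wt * A / ((1 - α) * K)`, and `A ≤ 2 * K *
f` cancels `f`. -/
theorem le_of_density {wt K A f l : ℝ} (hα : 0 < α) (hα' : α < 1) (hwt : 0 ≤ wt) (hK : 0 < K)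
    (hA : K ≤ A) (hAf : A ≤ 2 * K * f) (hf : 1 ≤ f) (h1 : l * ((1 - α) * K) ≤ wt)
    (h2 : z * (4 * f) ≤ 4 * (wt + 2 * l * (A - K))) : z * (1 - α) ≤ 4 * wt := by
  have hα1 : 0 < 1 - α := by linarith
  have q1 := mul_le_mul_of_nonneg_right h2 (by positivity : 0 ≤ (1 - α) * K)
  have q2 := mul_le_mul_of_nonneg_right h1 (by linarith : 0 ≤ A - K)
  have q3 : wt * ((1 - α) * K) ≤ wt * K := mul_le_mul_of_nonneg_left (by nlinarith) hwt
  have q4 := mul_nonneg hwt hK.le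
  have q5 : z * (4 * f) * ((1 - α) * K) ≤ 8 * (wt * A) := by linarith
  have q6 := mul_le_mul_of_nonneg_left hAf hwt
  have q7 : (z * (1 - α)) * (4 * f * K) ≤ (4 * wt) * (4 * f * K) := by linarith
  exact le_of_mul_le_mul_right q7 (by positivity)

/-- If all potentials of a geometric grid have been tried, the best score is small. -/
theorem le_of_beaten (hw : IsMetric w) (hα : 0 < α) (hα' : α < 1) (hm : 1 ≤ m) (hmk : m ≤ k)
    (hkn : k ≤ n)
    (h : ∀ u v : Fin n, ∀ i < 2 * n, Beaten w m k α (w u v * 2 ^ n / 2 ^ i) z)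
    {Q : Fin m → List (Fin n)} (hQ : Feasible k Q) : z * (1 - α) ≤ 4 * totalWeight w Q := by
  have hwt := totalWeight_nonneg hw Q
  have hfloor : ∀ N : ℕ, k ≤ N → (1 : ℝ) ≤ ((N / k : ℕ) : ℝ) ∧
      (N : ℝ) ≤ 2 * k * ((N / k : ℕ) : ℝ) := by
    intro N hN
    have h1 : 1 ≤ N / k := (Nat.one_le_div_iff (by omega)).2 hN
    have h2 : N < k * (N / k + 1) := Nat.lt_mul_div_succ N (by omega)
    refine ⟨by exact_mod_cast h1, ?_⟩
    have h3 : N ≤ 2 * k * (N / k) := by nlinarith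
    exact_mod_cast h3
  have hz0 : ∀ x : ℝ, z ≤ x → x ≤ 4 * totalWeight w Q → z * (1 - α) ≤ 4 * totalWeight w Q := by
    intro x h1 h2
    by_cases hz : z ≤ 0
    · nlinarith
    · push Not at hz; nlinarith
  have hn : 0 < n := by omega
  rcases hmk.eq_or_lt with rfl | hmk
  -- For `m = k` the weight of `Q` may be zero. The diagonal pairs of the grid supply the potential
  -- 0, for which `N ≥ m = k` and the Lagrangian term vanishes.
  · obtain ⟨N, S, h1, h2, h3, h4, h5, -⟩ := h ⟨0, hn⟩ ⟨0, hn⟩ 0 (by omega)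
    have h6 := h4 Q hQ
    simp only [hw.self, zero_mul, zero_div, add_zero] at h6
    have h7 := h5 h1
    have h8 := (hfloor N h1).1
    by_cases hz : z ≤ 0
    · nlinarith
    · push Not at hz; nlinarith
  have hpos := hQ.totalWeight_pos hw hmk
  -- The scale of the grid: the largest edge weight `M` not exceeding the weight of `Q`, so that `M
  -- ≤ w(Q) ≤ n * M`.
  obtain ⟨p, hp, hmax⟩ := Finset.exists_max_image
    (Finset.univ.filter fun p : Fin n × Fin n => w p.1 p.2 ≤ totalWeight w Q)
    (fun p => w p.1 p.2) ⟨(⟨0, hn⟩, ⟨0, hn⟩), by simpa [hw.self] using hwt⟩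
  simp only [Finset.mem_filter, Finset.mem_univ, true_and] at hp hmax
  set M := w p.1 p.2 with hM
  have hM0 : 0 ≤ M := hw.nonneg _ _
  have hwM : totalWeight w Q ≤ n * M := by
    have h1 : ∀ i, pathWeight w (Q i) ≤ (Q i).length * M := fun i => by
      refine pathWeight_le hw hM0 (fun u v huv => hmax (u, v) huv) _ ?_
      exact Finset.single_le_sum (f := fun i => pathWeight w (Q i))
        (fun i _ => pathWeight_nonneg hw.nonneg _) (Finset.mem_univ i)
    have h2 : ∑ i, (Q i).length ≤ n := by
      rw [← hQ.1.card_spanned]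
      exact (Finset.card_le_univ _).trans_eq (Fintype.card_fin n)
    calc totalWeight w Q ≤ ∑ i, ((Q i).length : ℝ) * M := Finset.sum_le_sum fun i _ => h1 i
      _ = ((∑ i, (Q i).length : ℕ) : ℝ) * M := by push_cast; rw [Finset.sum_mul]
      _ ≤ n * M := by gcongr
  have hMpos : 0 < M := by
    by_contra hcon
    nlinarith [(Nat.cast_nonneg n : (0 : ℝ) ≤ n)]
  choose! N S h1 h2 h3 h4 h5 h6 using h p.1 p.2
  have hlam : ∀ i : ℕ, 0 ≤ M * 2 ^ n / 2 ^ i := fun i => by positivity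
  have h2n : (n : ℝ) < 2 ^ n := by exact_mod_cast Nat.lt_two_pow_self
  have hk : (k : ℝ) ≤ n := by exact_mod_cast hkn
  have hk0 : (0 : ℝ) < k := by exact_mod_cast (by omega : 0 < k)
  by_cases hall : ∀ i < 2 * n, k ≤ N i
  -- Even the smallest potential, `M / 2 ^ (n - 1)`, keeps `k` vertices. It is at most `M / n`, so
  -- the Lagrangian term costs at most `w(Q)` and `S ≤ 8 * w(Q)`.
  · have hi : 2 * n - 1 < 2 * n := by omega
    have hN := hall _ hi
    have e1 := h4 _ hi Q hQ
    have e2 := h5 _ hi hN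
    have e3 := (hfloor _ hN).1
    have e4 : (N (2 * n - 1) : ℝ) ≤ n := by exact_mod_cast h2 _ hi
    have e5 : M * 2 ^ n / 2 ^ (2 * n - 1) * n ≤ M := by
      have q1 : (n : ℝ) ≤ 2 ^ (n - 1) := by
        have : n - 1 < 2 ^ (n - 1) := Nat.lt_two_pow_self
        exact_mod_cast (by omega : n ≤ 2 ^ (n - 1))
      have q2 : M * 2 ^ n / 2 ^ (2 * n - 1) = M / 2 ^ (n - 1) := by
        rw [show 2 * n - 1 = n + (n - 1) by omega, pow_add]
        field_simp
      rw [q2, div_mul_eq_mul_div, div_le_iff₀ (by positivity)]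
      exact mul_le_mul_of_nonneg_left q1 hM0
    have e6 : M * 2 ^ n / 2 ^ (2 * n - 1) * (N (2 * n - 1) - k) ≤ M * 2 ^ n / 2 ^ (2 * n - 1) * n :=
      mul_le_mul_of_nonneg_left (by linarith) (hlam _)
    refine hz0 (max z 0) (le_max_left _ _) (max_le ?_ (by linarith))
    by_contra hcon
    push Not at hcon
    nlinarith
  · push Not at hall
    classical
    obtain ⟨hi, hik⟩ := Nat.find_spec hall
    have hmin := fun j (hj : j < Nat.find hall) => Nat.find_min hall hj
    generalize Nat.find hall = i at hi hik hmin
    have e1 := h4 i hi Q hQ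
    have eS := h3 i hi
    have hik' : (N i : ℝ) + 1 ≤ k := by exact_mod_cast hik
    -- The largest potential `M * 2 ^ n` exceeds `n * M ≥ w(Q)`; missing even one of the `k`
    -- vertices would make the upper bound on `S` negative.
    have hi0 : i ≠ 0 := by
      rintro rfl
      have : M * 2 ^ n / 2 ^ 0 * (k - N 0) ≤ totalWeight w Q := by linarith
      rw [pow_zero, div_one] at this
      have q1 : M * 2 ^ n * 1 ≤ M * 2 ^ n * (k - N 0) :=
        mul_le_mul_of_nonneg_left (by linarith) (by positivity)
      have q2 := mul_lt_mul_of_pos_left h2n hMpos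
      linarith
    by_cases hαN : α * k ≤ N i
    · have e2 := h6 i hi hik hαN
      have : M * 2 ^ n / 2 ^ i * (N i - k) ≤ 0 :=
        mul_nonpos_of_nonneg_of_nonpos (hlam i) (by linarith)
      exact hz0 _ e2 (by linarith)
    · push Not at hαN
      obtain ⟨j, rfl⟩ : ∃ j, i = j + 1 := ⟨i - 1, by omega⟩
      have hj : j < 2 * n := by omega
      have hNj : k ≤ N j := by
        have := hmin j (by omega)
        push Not at this
        exact this hj
      have e2 := h4 _ hj Q hQ
      have e3 := h5 _ hj hNj
      obtain ⟨e4, e5⟩ := hfloor _ hNj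
      -- The last potential with `N ≥ k` before the failure is exactly twice the failing one.
      have e6 : M * 2 ^ n / 2 ^ j = 2 * (M * 2 ^ n / 2 ^ (j + 1)) := by
        rw [pow_succ]
        field_simp
      rw [e6] at e2
      refine le_of_density hα hα' hwt hk0 (by exact_mod_cast hNj) e5 e4 ?_
        (e3.trans e2)
      have : M * 2 ^ n / 2 ^ (j + 1) * (k - N (j + 1)) ≤ totalWeight w Q := by linarith
      exact le_trans (mul_le_mul_of_nonneg_left (by linarith) (hlam _)) this

end Quality

/-- The problem has a feasible solution. -/
theorem exists_feasible {n m k : ℕ} (hm : 1 ≤ m) (hmk : m ≤ k) (hkn : k ≤ n) :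
    ∃ P : Fin m → List (Fin n), Feasible k P := by
  -- The first `m - 1` vertices are paths of their own; all remaining vertices form the last path.
  refine ⟨fun i => (List.finRange n).filter fun x => min x.val (m - 1) = i.val,
    ⟨fun i => ?_, fun i => (List.nodup_finRange n).filter _, fun i j hij x hx hx' => ?_⟩, ?_⟩
  · refine List.ne_nil_of_mem (a := ⟨i, by omega⟩) ?_
    simp
    omega
  · simp at hx hx'
    exact hij (Fin.ext (hx.symm.trans hx'))
  · have : spanned (fun i : Fin m => (List.finRange n).filter fun x : Fin n =>
        min x.val (m - 1) = i.val) = Finset.univ := by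
      ext x
      simp only [spanned, Finset.mem_biUnion, Finset.mem_univ, true_and, List.mem_toFinset,
        iff_true]
      exact ⟨⟨min x.val (m - 1), by omega⟩, by simp⟩
    rw [this, Finset.card_univ, Fintype.card_fin]
    exact hkn

theorem le_opt {n m k : ℕ} {w : Fin n → Fin n → ℝ} (hm : 1 ≤ m) (hmk : m ≤ k) (hkn : k ≤ n) {x : ℝ}
    (h : ∀ Q : Fin m → List (Fin n), Feasible k Q → x ≤ totalWeight w Q) : x ≤ opt w m k := by
  obtain ⟨P, hP⟩ := exists_feasible hm hmk hkn
  refine le_csInf ⟨_, P, hP, rfl⟩ ?_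
  rintro y ⟨Q, hQ, rfl⟩
  exact h Q hQ

end KMinWP

namespace KMinWP

/-! ### The program

Arrays of natural numbers, besides input and output: `5` labels, `6` activity, `7` number of active
components, `8`, `9` pairs of vertices that trigger events, `10` types of the events, `12` kept
vertices, `13` degrees, `14` kept edges, `15` successors on tours, `16`, `17`, `18` length, vertices
and cuts of the sequence, `19`, `20`, `21` vertices, cuts and length of the best window, `22` whether
there is one. Arrays of real numbers: `3` moats, `4` potentials, `5` growths, `7` initial potential,
`8` the product of `α` and `k`, `9` weight and `10` length of the current window, `11` best score. -/

namespace Prog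

open Stm

/-- The scalar with name `a`. -/
abbrev var (a : ℕ) : NExpr := .read a (.const 0) (.const 0)

/-- Entry `i` of the vector with name `a`. -/
abbrev vec (a : ℕ) (i : NExpr) : NExpr := .read a i (.const 0)

/-- The real scalar with name `a`. -/
abbrev rvar (a : ℕ) : RExpr := .read a (.const 0) (.const 0)

/-- The equality test. -/
abbrev eqTest (e f : NExpr) : Test := .and (.nle e f) (.nle f e)

/-- The disjunction of two tests. -/
abbrev orTest (b c : Test) : Test := .not (.and (.not b) (.not c))

/-- Assignment to a scalar. -/
abbrev setVar (a : ℕ) (e : NExpr) : Stm := .setN a (.const 0) (.const 0) e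

/-- Assignment to a real scalar. -/
abbrev setRvar (a : ℕ) (e : RExpr) : Stm := .setR a (.const 0) (.const 0) e

/-- The current step. -/
abbrev cs : NExpr := var 40

/-- The next step. -/
abbrev ns : NExpr := .add (var 40) (.const 1)

/-- The endpoints of the pair of the current step. -/
abbrev eU : NExpr := vec 8 cs
abbrev eV : NExpr := vec 9 cs

/-- The current label of a vertex. -/
abbrev labE (x : NExpr) : NExpr := .read 5 cs x

/-- The current activity of a label. -/
abbrev actE (c : NExpr) : NExpr := .read 6 cs c

/-- Initialization of row `0` of the growing process. -/
def growInit : Stm :=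
  .seq
    (.iter 41 1 (.seq (.setN 5 (.const 0) (var 41) (var 41))
      (.seq (.setN 6 (.const 0) (var 41) (.const 1))
      (.seq (.setR 3 (.const 0) (var 41) (.const 0))
        (.setR 4 (.const 0) (var 41) (rvar 7))))))
    (.setN 7 (.const 0) (.const 0) (var 0))

/-- The gap between the moats of a pair of vertices. -/
def gapE : RExpr :=
  .sub (.sub (.read 0 (var 42) (var 43)) (.read 3 cs (var 42))) (.read 3 cs (var 43))

/-- Comparison of a pair of vertices with the best pair found so far. -/
def scanBody : Stm :=
  .seq
    (.ite (eqTest (labE (var 42)) (labE (var 43)))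
      (setRvar 6 (.read 4 cs (labE (var 42))))
      (.ite (eqTest (actE (labE (var 43))) (.const 1)) (setRvar 6 (.half gapE)) (setRvar 6 gapE)))
    (.ite (orTest (eqTest (var 11) (.const 0)) (.not (.rle (.read 5 cs (.const 0)) (rvar 6))))
      (.seq (.setR 5 cs (.const 0) (rvar 6))
        (.seq (.setN 8 cs (.const 0) (var 42))
        (.seq (.setN 9 cs (.const 0) (var 43)) (setVar 11 (.const 1)))))
      .skip)

/-- Search for the pair of vertices that triggers the next event. -/
def scan : Stm :=
  .seq (setVar 11 (.const 0))
    (.iter 42 1 (.ite (eqTest (actE (labE (var 42))) (.const 1)) (.iter 43 1 scanBody) .skip))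

/-- Copying a row while the moats of the active components grow. -/
def copyGrow : Stm :=
  .seq
    (.iter 41 1 (.seq (.setN 5 ns (var 41) (labE (var 41)))
      (.seq (.setN 6 ns (var 41) (actE (var 41)))
      (.seq (.setR 3 ns (var 41) (.read 3 cs (var 41)))
      (.seq (.setR 4 ns (var 41) (.read 4 cs (var 41)))
      (.seq
        (.ite (eqTest (actE (labE (var 41))) (.const 1))
          (.setR 3 ns (var 41) (.add (.read 3 cs (var 41)) (.read 5 cs (.const 0)))) .skip)
        (.ite (eqTest (actE (var 41)) (.const 1))
          (.setR 4 ns (var 41) (.sub (.read 4 cs (var 41)) (.read 5 cs (.const 0)))) .skip)))))))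
    (.setN 7 ns (.const 0) (vec 7 cs))

/-- Deactivation of a component. -/
def deactS : Stm :=
  .seq (.setN 6 ns (labE eU) (.const 0)) (.setN 7 ns (.const 0) (.sub (vec 7 cs) (.const 1)))

/-- Merging of two components. -/
def mergeS : Stm :=
  .seq (.setR 4 ns (labE eU) (.add (.read 4 ns (labE eU)) (.read 4 ns (labE eV))))
    (.seq (.ite (eqTest (actE (labE eV)) (.const 1))
      (.setN 7 ns (.const 0) (.sub (vec 7 cs) (.const 1))) .skip)
      (.iter 41 1 (.ite (eqTest (labE (var 41)) (labE eV)) (.setN 5 ns (var 41) (labE eU)) .skip)))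

/-- One step of the growing process. -/
def stepS : Stm :=
  .seq (.setR 5 cs (.const 0) (.const 0))
  (.seq (.setN 8 cs (.const 0) (.const 0))
  (.seq (.setN 9 cs (.const 0) (.const 0))
  (.seq (.setN 10 cs (.const 0) (.const 0))
  (.seq (.ite (.nle (vec 7 cs) (var 1)) .skip scan)
  (.seq copyGrow
    (.ite (.nle (vec 7 cs) (var 1)) .skip
      (.ite (eqTest (labE eU) (labE eV)) deactS
        (.seq (.setN 10 cs (.const 0) (.const 1)) mergeS))))))))

/-- The growing process. -/
def growS : Stm := .seq growInit (.iter 40 2 stepS)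

/-- The number of steps of the growing process. -/
abbrev two : NExpr := .add (var 0) (var 0)

/-- Initialization of the pruning process. -/
def pruneInit : Stm :=
  .iter 41 1 (.seq (.setN 12 (var 41) (.const 0) (.read 6 two (.read 5 two (var 41))))
    (.setN 13 (var 41) (.const 0) (.const 0)))

/-- Whether the component at the far end of an edge is active or has a kept edge. -/
def pruneTest : Stm :=
  .seq (setVar 23 (actE (labE eV)))
    (.iter 41 1 (.ite (.and (eqTest (labE (var 41)) (labE eV)) (.not (.nle (vec 13 (var 41)) (.const 0))))
      (setVar 23 (.const 1)) .skip))

/-- Keeping an edge. -/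
def pruneKeep : Stm :=
  .seq (.setN 14 cs (.const 0) (.const 1))
    (.seq (.setN 13 eU (.const 0) (.add (vec 13 eU) (.const 1)))
      (.setN 13 eV (.const 0) (.add (vec 13 eV) (.const 1))))

/-- Deleting the vertices of a component. -/
def pruneDelete : Stm :=
  .iter 41 1 (.ite (eqTest (labE (var 41)) (labE eV)) (.setN 12 (var 41) (.const 0) (.const 0)) .skip)

/-- Undoing one step of the growing process. -/
def pruneStep : Stm :=
  .seq (setVar 40 (.sub (.sub two (.const 1)) (var 44)))
    (.seq (.setN 14 cs (.const 0) (.const 0))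
      (.ite (eqTest (vec 10 cs) (.const 1))
        (.seq pruneTest
          (.ite (.and (eqTest (vec 12 eU) (.const 1)) (eqTest (var 23) (.const 1))) pruneKeep
            pruneDelete))
        .skip))

/-- The pruning process. -/
def pruneS : Stm := .seq pruneInit (.iter 44 2 pruneStep)

/-- Joining tours along the kept edges. -/
def tourS : Stm :=
  .seq (.iter 41 1 (.setN 15 (var 41) (.const 0) (var 41)))
    (.iter 40 2 (.ite (eqTest (vec 14 cs) (.const 1))
      (.seq (setVar 23 (vec 15 eU))
        (.seq (.setN 15 eU (.const 0) (vec 15 eV)) (.setN 15 eV (.const 0) (var 23))))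
      .skip))

/-- One step along a tour; a vertex that is visited for the first time is appended to the sequence. -/
def walkBody : Stm :=
  .seq
    (.ite (eqTest (vec 12 (var 24)) (.const 1))
      (.seq (.setN 17 (var 16) (.const 0) (var 24))
      (.seq (.setN 18 (var 16) (.const 0) (var 46))
      (.seq (.setN 12 (var 24) (.const 0) (.const 0))
        (setVar 16 (.add (var 16) (.const 1))))))
      .skip)
    (setVar 24 (vec 15 (var 24)))

/-- Listing the kept vertices along the tours. -/
def walkS : Stm :=
  .seq (setVar 16 (.const 0)) (.iter 45 1 (.seq (setVar 24 (var 45)) (.iter 46 1 walkBody)))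

/-- The length of the current window. -/
abbrev winLen : NExpr := .sub (.add (var 48) (.const 1)) (var 47)

/-- Copying the current window. -/
def copyBest : Stm :=
  .iter 49 1 (.seq (.setN 19 (var 49) (.const 0) (vec 17 (.add (var 47) (var 49))))
    (.setN 20 (var 49) (.const 0) (vec 18 (.add (var 47) (var 49)))))

/-- The score of the current window. -/
def scoreS : Stm :=
  .seq (setVar 23 (.const 0))
    (.ite (.nle (var 2) winLen)
      (.seq (setVar 23 (.const 1)) (setRvar 12 (.half (.half (rvar 9)))))
      (.ite (.and (.rle (rvar 8) (rvar 10)) (.nle (var 1) winLen))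
        (.seq (setVar 23 (.const 1)) (setRvar 12 (rvar 9))) .skip))

/-- Replacing the best window by the current one, if that is better. -/
def updateBest : Stm :=
  .ite (.and (eqTest (var 23) (.const 1))
      (orTest (eqTest (var 22) (.const 0)) (.not (.rle (rvar 11) (rvar 12)))))
    (.seq (setRvar 11 (rvar 12)) (.seq (setVar 22 (.const 1)) (.seq (setVar 21 winLen) copyBest)))
    .skip

/-- Extending the current window by one vertex. -/
def extendS : Stm :=
  .seq
    (.ite (.and (.nle (.add (var 47) (.const 1)) (var 48)) (.nle (.const 1) (vec 18 (var 48))))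
      (setRvar 9 (.add (rvar 9) (.read 0 (vec 17 (.sub (var 48) (.const 1))) (vec 17 (var 48)))))
      .skip)
    (setRvar 10 (.add (rvar 10) (.const 1)))

/-- Considering all windows. -/
def windowS : Stm :=
  .iter 47 1 (.seq (setRvar 9 (.const 0)) (.seq (setRvar 10 (.const 0))
    (.iter 48 1 (.ite (.and (.nle (var 47) (var 48)) (.nle (.add (var 48) (.const 1)) (var 16)))
      (.seq extendS (.seq scoreS updateBest)) .skip))))

/-- The computation for one initial potential. -/
def runS : Stm := .seq growS (.seq pruneS (.seq tourS (.seq walkS windowS)))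

/-- The computations for all initial potentials of a geometric grid below each weight. -/
def searchS : Stm :=
  .iter 50 1 (.iter 51 1 (.seq (setRvar 7 (.read 0 (var 50) (var 51)))
    (.seq (.iter 41 1 (setRvar 7 (.add (rvar 7) (rvar 7))))
      (.iter 52 2 (.seq runS (setRvar 7 (.half (rvar 7))))))))

/-- The product of `α` and `k`. -/
def thresholdS : Stm :=
  .seq (setRvar 8 (.const 0))
    (.iter 41 1 (.ite (.nle (.add (var 41) (.const 1)) (var 2)) (setRvar 8 (.add (rvar 8) (rvar 1)))
      .skip))

/-- Distributing one vertex of the best window to the paths. -/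
def outputBody : Stm :=
  .ite (.nle (.add (var 41) (.const 1)) (var 21))
    (.seq
      (.ite (orTest (eqTest (var 41) (.const 0)) (orTest (eqTest (vec 20 (var 41)) (.const 0))
          (.nle (.add (var 25) (.sub (var 21) (var 41))) (var 1))))
        (.seq (.setN 3 (var 25) (.const 0) (.const 0)) (setVar 25 (.add (var 25) (.const 1))))
        .skip)
      (.seq (.setN 4 (.sub (var 25) (.const 1)) (vec 3 (.sub (var 25) (.const 1))) (vec 19 (var 41)))
        (.setN 3 (.sub (var 25) (.const 1)) (.const 0)
          (.add (vec 3 (.sub (var 25) (.const 1))) (.const 1)))))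
    .skip

/-- Splitting the best window into `m` paths. -/
def outputS : Stm := .seq (setVar 25 (.const 0)) (.iter 41 1 outputBody)

/-- The algorithm. -/
def mainS : Stm := .seq thresholdS (.seq searchS outputS)

theorem wellFormed_mainS : mainS.WellFormed := by
  simp [mainS, thresholdS, searchS, outputS, runS, growS, pruneS, tourS, walkS, windowS, outputBody,
    WellFormed, natWrites, growInit, stepS, scan, scanBody, copyGrow, deactS, mergeS, pruneInit,
    pruneStep, pruneTest, pruneKeep, pruneDelete, walkBody, extendS, scoreS, updateBest, copyBest]

end Prog

end KMinWP

namespace KMinWP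

/-! ### Evaluation of statements -/

namespace Stm

variable {n : ℕ} {s : Memory}

@[simp] theorem run_skip : skip.run n s = s := rfl

@[simp] theorem run_setN {a : ℕ} {i j e : NExpr} :
    (setN a i j e).run n s = s.writeNat a (i.eval s) (j.eval s) (e.eval s) := rfl

@[simp] theorem run_setR {a : ℕ} {i j : NExpr} {e : RExpr} :
    (setR a i j e).run n s = s.writeReal a (i.eval s) (j.eval s) (e.eval s) := rfl

@[simp] theorem run_seq {p q : Stm} : (seq p q).run n s = q.run n (p.run n s) := rfl

open Classical in
@[simp] theorem run_ite {b : Test} {p q : Stm} :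
    (ite b p q).run n s = if b.Holds s then p.run n s else q.run n s := rfl

end Stm

attribute [simp] NExpr.eval RExpr.eval Test.Holds Memory.nat_writeNat_of_ne Memory.nat_writeNat_self
  Memory.real_writeNat Memory.real_writeReal_of_ne Memory.real_writeReal_self Memory.nat_writeReal

@[simp] theorem le_and_ge_iff_eq {α : Type*} [PartialOrder α] {a b : α} : a ≤ b ∧ b ≤ a ↔ a = b := le_antisymm_iff.symm

/-! ### Correctness of the growing process -/

namespace Prog

open Stm Row

variable {n m : ℕ} {w : Fin n → Fin n → ℝ} {s : Memory} {r : Row n} {i : ℕ}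

/-- The memory holds the weights. -/
def WeightAt (s : Memory) (w : Fin n → Fin n → ℝ) : Prop := ∀ u v : Fin n, s.real 0 u v = w u v

/-- Row `i` of the memory holds a state of the growing process. -/
structure RowAt (s : Memory) (i : ℕ) (r : Row n) : Prop where
  lab : ∀ x : Fin n, s.nat 5 i x = r.lab x
  act : ∀ x : Fin n, s.nat 6 i x = r.act x
  d : ∀ x : Fin n, s.real 3 i x = r.d x
  pot : ∀ x : Fin n, s.real 4 i x = r.pot x
  cnt : s.nat 7 i 0 = r.cnt

theorem growInit_spec {lam : ℝ} (hn : s.nat 0 0 0 = n) (hlam : s.real 7 0 0 = lam) :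
    RowAt (growInit.run n s) 0 (Row.init n lam) := by
  set p : Stm := .seq (.setN 5 (.const 0) (var 41) (var 41))
    (.seq (.setN 6 (.const 0) (var 41) (.const 1))
    (.seq (.setR 3 (.const 0) (var 41) (.const 0))
      (.setR 4 (.const 0) (var 41) (rvar 7)))) with hp
  have key : ∀ x < 1 * n, _ ∧ _ := run_iter (n := n) (v := 41) (c := 1) (p := p) (s := s)
    (fun i s' => ∀ x < i, (s'.nat 5 0 x = x ∧ s'.nat 6 0 x = 1) ∧
      (s'.real 3 0 x = 0 ∧ s'.real 4 0 x = lam)) (fun i s j h => by simpa using h) (by simp) (by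
      intro i s' hi hN hR hv h x hx
      have e7 : s'.real 7 = s.real 7 := hR 7 (by simp [hp, realWrites])
      simp only [hp, run_seq, run_setN, run_setR]
      simp [hv, e7, hlam]
      by_cases hxi : x = i
      · simp [hxi]
      · simpa [hxi] using h x (by omega))
  have e0 : ((Stm.iter 41 1 p).run n s).nat 0 = s.nat 0 :=
    run_nat_of_notMem _ _ (by simp [hp, natWrites])
  rw [one_mul] at key
  constructor
  · intro x; simpa [growInit, Row.init] using (key x x.2).1.1
  · intro x; simpa [growInit, Row.init] using (key x x.2).1.2
  · intro x; simpa [growInit, Row.init] using (key x x.2).2.1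
  · intro x; simpa [growInit, Row.init] using (key x x.2).2.2
  · simp [growInit, Row.init, ← hp, e0, hn]

/-- The state of the search for the next event, after the pairs in `D` have been considered. -/
structure ScanInv (w : Fin n → Fin n → ℝ) (r : Row n) (i : ℕ) (s s' : Memory)
    (D : Fin n → Fin n → Prop) : Prop where
  rows : ∀ j, j ≠ i → s'.nat 8 j = s.nat 8 j ∧ s'.nat 9 j = s.nat 9 j
  best : (s'.nat 11 0 0 = 0 ∧ ∀ u v, D u v → r.act (r.lab u) ≠ 1) ∨
    (s'.nat 11 0 0 ≠ 0 ∧ ∃ u v : Fin n, s'.nat 8 i 0 = u ∧ s'.nat 9 i 0 = v ∧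
      r.act (r.lab u) = 1 ∧ r.val w u v = s'.real 5 i 0 ∧
      ∀ u' v', D u' v' → r.act (r.lab u') = 1 → s'.real 5 i 0 ≤ r.val w u' v')

theorem scanBody_spec {s' : Memory} {D : Fin n → Fin n → Prop} {u v : Fin n}
    (h : ScanInv w r i s s' D) (hi : s'.nat 40 0 0 = i) (hrow : RowAt s' i r) (hw : WeightAt s' w)
    (hu : s'.nat 42 0 0 = u) (hv : s'.nat 43 0 0 = v) (hact : r.act (r.lab u) = 1) :
    ScanInv w r i s (scanBody.run n s') (fun x y => D x y ∨ (x = u ∧ y = v)) := by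
  have e1 : (Stm.ite (eqTest (labE (var 42)) (labE (var 43)))
      (setRvar 6 (.read 4 cs (labE (var 42))))
      (.ite (eqTest (actE (labE (var 43))) (.const 1)) (setRvar 6 (.half gapE))
        (setRvar 6 gapE))).run n s' = s'.writeReal 6 0 0 (r.val w u v) := by
    simp [hi, hu, hv, hrow.lab, hrow.act, hrow.d, hrow.pot, gapE, hw u v, val]
    split_ifs <;> rfl
  rw [scanBody, run_seq, e1]
  have hD : (s'.nat 11 0 0 = 0 ∨ r.val w u v < s'.real 5 i 0) ∨
      (s'.nat 11 0 0 ≠ 0 ∧ s'.real 5 i 0 ≤ r.val w u v) := by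
    rcases lt_or_ge (r.val w u v) (s'.real 5 i 0) with h' | h'
    · exact .inl (.inr h')
    · by_cases h0 : s'.nat 11 0 0 = 0
      · exact .inl (.inl h0)
      · exact .inr ⟨h0, h'⟩
  rcases hD with hD | ⟨hD, hD'⟩
  · have hD' : s'.nat 11 0 0 = 0 ∨ ¬ s'.real 5 i 0 ≤ r.val w u v := by rwa [not_le]
    have e2 : Test.Holds (s'.writeReal 6 0 0 (r.val w u v))
        (orTest (eqTest (var 11) (.const 0)) (.not (.rle (.read 5 cs (.const 0)) (rvar 6)))) := by
      simp [hi]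
      rcases hD with h' | h'
      · simp [h']
      · exact fun _ => h'
    rw [run_ite, if_pos e2]
    simp [hi, hu, hv]
    refine ⟨fun j hj => ?_, .inr ⟨by simp, u, v, by simp, by simp, hact, by simp, ?_⟩⟩
    · obtain ⟨h1, h2⟩ := h.rows j hj
      refine ⟨?_, ?_⟩ <;> funext y <;> simp [hj, h1, h2]
    · rintro u' v' (hd | ⟨rfl, rfl⟩) ha
      · simp
        rcases h.best with ⟨hb, hb'⟩ | ⟨hb, -, -, -, -, -, -, hb'⟩
        · exact absurd ha (hb' _ _ hd)
        · rcases hD with h' | h'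
          · exact absurd h' hb
          · exact h'.le.trans (hb' _ _ hd ha)
      · simp
  · have e2 : ¬ Test.Holds (s'.writeReal 6 0 0 (r.val w u v))
        (orTest (eqTest (var 11) (.const 0)) (.not (.rle (.read 5 cs (.const 0)) (rvar 6)))) := by
      simp [hi, hD, hD']
    rw [run_ite, if_neg e2, run_skip]
    refine ⟨fun j hj => by simpa using h.rows j hj, .inr ?_⟩
    rcases h.best with ⟨hb, -⟩ | ⟨hb, u', v', h1, h2, h3, h4, h5⟩
    · exact absurd hb hD
    · refine ⟨by simpa using hb, u', v', by simpa using h1, by simpa using h2, h3, by simpa using h4,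
        ?_⟩
      rintro u'' v'' (hd | ⟨rfl, rfl⟩) ha
      · simpa using h5 u'' v'' hd ha
      · simpa using hD'

/-- Only pairs with an active first vertex compete, so all pairs of an inactive vertex count as
considered for free. -/
theorem ScanInv.congr {s' : Memory} {D D' : Fin n → Fin n → Prop} (h : ScanInv w r i s s' D)
    (hD : ∀ x y, D' x y → r.act (r.lab x) = 1 → D x y) : ScanInv w r i s s' D' := by
  refine ⟨h.rows, ?_⟩
  rcases h.best with ⟨h1, h2⟩ | ⟨h1, u, v, h2, h3, h4, h5, h6⟩
  · exact .inl ⟨h1, fun u v hd hu => h2 u v (hD u v hd hu) hu⟩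
  · exact .inr ⟨h1, u, v, h2, h3, h4, h5, fun u' v' hd hu => h6 u' v' (hD u' v' hd hu) hu⟩

theorem ScanInv.write {s' : Memory} {D : Fin n → Fin n → Prop} (h : ScanInv w r i s s' D) {a x : ℕ}
    (h8 : 8 ≠ a) (h9 : 9 ≠ a) (h11 : 11 ≠ a) : ScanInv w r i s (s'.writeNat a 0 0 x) D := by
  refine ⟨fun j hj => ?_, ?_⟩
  · simpa [h8, h9] using h.rows j hj
  · simpa [h8, h9, h11] using h.best

theorem RowAt.congr {s' : Memory} (h : RowAt s i r) (h5 : s'.nat 5 i = s.nat 5 i)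
    (h6 : s'.nat 6 i = s.nat 6 i) (h7 : s'.nat 7 i = s.nat 7 i) (h3 : s'.real 3 i = s.real 3 i)
    (h4 : s'.real 4 i = s.real 4 i) : RowAt s' i r :=
  ⟨fun x => by rw [h5, h.lab], fun x => by rw [h6, h.act], fun x => by rw [h3, h.d],
    fun x => by rw [h4, h.pot], by rw [h7, h.cnt]⟩

theorem scan_spec (hi : s.nat 40 0 0 = i) (hrow : RowAt s i r) (hw : WeightAt s w)
    (hact : ∃ x, r.act (r.lab x) = 1) :
    (∀ j, j ≠ i → (scan.run n s).nat 8 j = s.nat 8 j ∧ (scan.run n s).nat 9 j = s.nat 9 j) ∧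
    ∃ u v : Fin n, (scan.run n s).nat 8 i 0 = u ∧ (scan.run n s).nat 9 i 0 = v ∧
      r.IsEvent w u v ((scan.run n s).real 5 i 0) := by
  have hcongr : ∀ s' : Memory, (∀ a, a = 5 ∨ a = 6 ∨ a = 7 → s'.nat a = s.nat a) →
      (∀ a, a = 3 ∨ a = 4 → s'.real a = s.real a) → RowAt s' i r := fun s' h h' =>
    hrow.congr (by rw [h 5 (by simp)]) (by rw [h 6 (by simp)]) (by rw [h 7 (by simp)])
      (by rw [h' 3 (by simp)]) (by rw [h' 4 (by simp)])
  have key : ScanInv w r i s (scan.run n s) (fun x _ => x.val < 1 * n) := by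
    refine run_iter (n := n) (s := s.writeNat 11 0 0 0)
      (fun j s' => ScanInv w r i s s' (fun x _ => x.val < j))
      (fun j s' x h => h.write (by simp) (by simp) (by simp)) ⟨by simp, .inl (by simp)⟩ ?_
    intro u s' hu hN hR hv h
    have hrow' : RowAt s' i r := by
      refine hcongr s' ?_ ?_
      · rintro a (rfl | rfl | rfl) <;>
        · rw [hN _ (by simp) (by simp [natWrites, scanBody])]
          simp
      · rintro a (rfl | rfl) <;>
        · rw [hR _ (by simp [realWrites, scanBody])]
          simp
    have hw' : WeightAt s' w := fun x y => by
      rw [hR 0 (by simp [realWrites, scanBody])]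
      exact hw x y
    have hi' : s'.nat 40 0 0 = i := by
      rw [hN 40 (by simp) (by simp [natWrites, scanBody])]
      simpa using hi
    rw [one_mul] at hu
    obtain ⟨u, rfl⟩ : ∃ u' : Fin n, u = u'.val := ⟨⟨u, hu⟩, rfl⟩
    by_cases ha : r.act (r.lab u) = 1
    · have e : Test.Holds s' (eqTest (actE (labE (var 42))) (.const 1)) := by
        simp [hi', hv, hrow'.lab, hrow'.act, ha]
      rw [run_ite, if_pos e]
      have := run_iter (n := n) (v := 43) (c := 1) (p := scanBody) (s := s')
        (fun j s'' => ScanInv w r i s s'' (fun x y => x.val < u ∨ (x = u ∧ y.val < j)))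
        (fun j s' x h => h.write (by simp) (by simp) (by simp)) (h.congr (by simp +contextual)) (by
          intro v s'' hv' hN' hR' hv'' h'
          have hrow'' : RowAt s'' i r := by
            refine hrow'.congr ?_ ?_ ?_ ?_ ?_
            · rw [hN' 5 (by simp) (by simp [natWrites, scanBody])]
            · rw [hN' 6 (by simp) (by simp [natWrites, scanBody])]
            · rw [hN' 7 (by simp) (by simp [natWrites, scanBody])]
            · rw [hR' 3 (by simp [realWrites, scanBody])]
            · rw [hR' 4 (by simp [realWrites, scanBody])]
          have hw'' : WeightAt s'' w := fun x y => by
            rw [hR' 0 (by simp [realWrites, scanBody])]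
            exact hw' x y
          rw [one_mul] at hv'
          obtain ⟨v, rfl⟩ : ∃ v' : Fin n, v = v'.val := ⟨⟨v, hv'⟩, rfl⟩
          refine (scanBody_spec (u := u) (v := v) h' ?_ hrow'' hw'' ?_ hv'' ha).congr ?_
          · rw [hN' 40 (by simp) (by simp [natWrites, scanBody]), hi']
          · rw [hN' 42 (by simp) (by simp [natWrites, scanBody]), hv]
          · rintro x y hxy -
            rcases hxy with hxy | ⟨rfl, hxy⟩
            · exact .inl (.inl hxy)
            · rcases Nat.lt_succ_iff_lt_or_eq.1 hxy with h1 | h1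
              · exact .inl (.inr ⟨rfl, h1⟩)
              · exact .inr ⟨rfl, Fin.ext h1⟩)
      refine this.congr ?_
      rintro x y hxy -
      rcases Nat.lt_succ_iff_lt_or_eq.1 hxy with h1 | h1
      · exact .inl h1
      · exact .inr ⟨Fin.ext h1, by rw [one_mul]; exact y.2⟩
    · have e : ¬ Test.Holds s' (eqTest (actE (labE (var 42))) (.const 1)) := by
        simp [hi', hv, hrow'.lab, hrow'.act, ha]
      rw [run_ite, if_neg e, run_skip]
      refine h.congr ?_
      rintro x y hxy hx
      rcases Nat.lt_succ_iff_lt_or_eq.1 hxy with h1 | h1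
      · exact h1
      · exact absurd (Fin.ext h1 ▸ hx) ha
  refine ⟨key.rows, ?_⟩
  -- The pair `x`, `x` of an active vertex was considered, so the search cannot have come back
  -- empty-handed.
  obtain ⟨x, hx⟩ := hact
  rcases key.best with ⟨-, h⟩ | ⟨-, u, v, h1, h2, h3, h4, h5⟩
  · exact absurd hx (h x x (by rw [one_mul]; exact x.2))
  · exact ⟨u, v, h1, h2, h3, h4, fun u' v' => h5 u' v' (by rw [one_mul]; exact u'.2)⟩

end Prog

end KMinWP

/-! ### Copying, deactivating and merging rows in memory; the complete growing loop -/

namespace KMinWP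

namespace Prog

open Stm Row

variable {n m : ℕ} {w : Fin n → Fin n → ℝ} {s s' s'' : Memory} {r : Row n} {i : ℕ} {Δ lam : ℝ}
  {u v : Fin n}

/-- Only row `i` of the growing process may have changed. -/
structure SameRows (s s' : Memory) (i : ℕ) : Prop where
  lab : ∀ j, j ≠ i → s'.nat 5 j = s.nat 5 j
  act : ∀ j, j ≠ i → s'.nat 6 j = s.nat 6 j
  cnt : ∀ j, j ≠ i → s'.nat 7 j = s.nat 7 j
  d : ∀ j, j ≠ i → s'.real 3 j = s.real 3 j
  pot : ∀ j, j ≠ i → s'.real 4 j = s.real 4 j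

theorem SameRows.rowAt (h : SameRows s s' i) {j : ℕ} (hr : RowAt s j r) (hj : j ≠ i) :
    RowAt s' j r :=
  hr.congr (h.lab j hj) (h.act j hj) (h.cnt j hj) (h.d j hj) (h.pot j hj)

theorem SameRows.trans (h : SameRows s s' i) (h' : SameRows s' s'' i) : SameRows s s'' i :=
  ⟨fun j hj => (h'.lab j hj).trans (h.lab j hj), fun j hj => (h'.act j hj).trans (h.act j hj),
    fun j hj => (h'.cnt j hj).trans (h.cnt j hj), fun j hj => (h'.d j hj).trans (h.d j hj),
    fun j hj => (h'.pot j hj).trans (h.pot j hj)⟩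

theorem SameRows.of_eq (h5 : s'.nat 5 = s.nat 5) (h6 : s'.nat 6 = s.nat 6) (h7 : s'.nat 7 = s.nat 7)
    (h3 : s'.real 3 = s.real 3) (h4 : s'.real 4 = s.real 4) (i : ℕ) : SameRows s s' i :=
  ⟨fun _ _ => by rw [h5], fun _ _ => by rw [h6], fun _ _ => by rw [h7], fun _ _ => by rw [h3],
    fun _ _ => by rw [h4]⟩

/-- Every state gets a row of its own instead of overwriting the previous one, since the pruning
process reads the labels and activities of all earlier states. -/
theorem copyGrow_spec (hi : s.nat 40 0 0 = i) (hrow : RowAt s i r) (hΔ : s.real 5 i 0 = Δ) :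
    SameRows s (copyGrow.run n s) (i + 1) ∧ RowAt (copyGrow.run n s) (i + 1) (r.grow Δ) := by
  rw [copyGrow, run_seq]
  set p : Stm := .seq (.setN 5 ns (var 41) (labE (var 41)))
    (.seq (.setN 6 ns (var 41) (actE (var 41)))
    (.seq (.setR 3 ns (var 41) (.read 3 cs (var 41)))
    (.seq (.setR 4 ns (var 41) (.read 4 cs (var 41)))
    (.seq
      (.ite (eqTest (actE (labE (var 41))) (.const 1))
        (.setR 3 ns (var 41) (.add (.read 3 cs (var 41)) (.read 5 cs (.const 0)))) .skip)
      (.ite (eqTest (actE (var 41)) (.const 1))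
        (.setR 4 ns (var 41) (.sub (.read 4 cs (var 41)) (.read 5 cs (.const 0)))) .skip))))) with hp
  have hpN : p.natWrites = [5, 6] := rfl
  have hpR : p.realWrites = [3, 4, 3, 4] := rfl
  have key := run_iter (n := n) (v := 41) (c := 1) (p := p) (s := s)
    (fun x s' => SameRows s s' (i + 1) ∧ ∀ y : Fin n, y.val < x →
      (s'.nat 5 (i + 1) y = r.lab y ∧ s'.nat 6 (i + 1) y = r.act y) ∧
      (s'.real 3 (i + 1) y = (r.grow Δ).d y ∧ s'.real 4 (i + 1) y = (r.grow Δ).pot y))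
    (fun x s' j h => ⟨⟨by simpa using h.1.lab, by simpa using h.1.act, by simpa using h.1.cnt,
      by simpa using h.1.d, by simpa using h.1.pot⟩, by simpa using h.2⟩)
    ⟨.of_eq rfl rfl rfl rfl rfl _, by simp⟩ (by
      rintro x s' hx hN hR hv ⟨h, h'⟩
      have hrow' := h.rowAt hrow (by omega)
      have hi' : s'.nat 40 0 0 = i := by rw [hN 40 (by simp) (by simp [hpN]), hi]
      have hΔ' : s'.real 5 i 0 = Δ := by rw [hR 5 (by simp [hpR]), hΔ]
      rw [one_mul] at hx
      obtain ⟨x, rfl⟩ : ∃ x' : Fin n, x = x'.val := ⟨⟨x, hx⟩, rfl⟩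
      constructor
      · by_cases h1 : r.act (r.lab x) = 1 <;> by_cases h2 : r.act x = 1 <;>
          simp only [hp, run_seq, run_setN, run_setR, run_ite] <;>
          simp [hi', hv, hrow'.lab, hrow'.act, h1, h2] <;>
          refine ⟨fun j hj => ?_, fun j hj => ?_, fun j hj => ?_, fun j hj => ?_, fun j hj => ?_⟩ <;>
          funext y <;>
          simp [hj, h.lab j hj, h.act j hj, h.cnt j hj, h.d j hj, h.pot j hj]
      · intro y hy
        by_cases hyx : y = x
        · subst hyx
          by_cases h1 : r.act (r.lab y) = 1 <;> by_cases h2 : r.act y = 1 <;>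
            simp only [hp, run_seq, run_setN, run_setR, run_ite] <;>
            simp [hi', hv, hrow'.lab, hrow'.act, hrow'.d, hrow'.pot, hΔ', h1, h2, Row.grow]
        · have hyx' : y.val ≠ x.val := fun h' => hyx (Fin.ext h')
          obtain ⟨⟨q1, q2⟩, q3, q4⟩ := h' y (by omega)
          by_cases h1 : r.act (r.lab x) = 1 <;> by_cases h2 : r.act x = 1 <;>
            simp only [hp, run_seq, run_setN, run_setR, run_ite] <;>
            simp [hi', hv, hrow'.lab, hrow'.act, h1, h2, hyx', q1, q2, q3, q4])
  have hi' : ((Stm.iter 41 1 p).run n s).nat 40 0 0 = i := by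
    rw [run_nat_of_notMem _ _ (by simp [natWrites, hpN]), hi]
  obtain ⟨h, h'⟩ := key
  rw [one_mul] at h'
  have hrow' := h.rowAt hrow (by omega)
  constructor
  · refine ⟨fun j hj => ?_, fun j hj => ?_, fun j hj => ?_, fun j hj => ?_, fun j hj => ?_⟩ <;>
      funext y <;>
      simp [hi', hj, h.lab j hj, h.act j hj, h.cnt j hj, h.d j hj, h.pot j hj]
  · constructor
    · intro y; simpa [Row.grow] using (h' y y.2).1.1
    · intro y; simpa [Row.grow] using (h' y y.2).1.2
    · intro y; simpa using (h' y y.2).2.1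
    · intro y; simpa using (h' y y.2).2.2
    · simp [hi', hrow'.cnt, Row.grow]

theorem deactS_spec (hi : s.nat 40 0 0 = i) (hrow : RowAt s i r) (hrow' : RowAt s (i + 1) (r.grow Δ))
    (hu : s.nat 8 i 0 = u) :
    SameRows s (deactS.run n s) (i + 1) ∧ RowAt (deactS.run n s) (i + 1) ((r.grow Δ).deact u) := by
  constructor
  · simp only [deactS, run_seq, run_setN]
    refine ⟨fun j hj => ?_, fun j hj => ?_, fun j hj => ?_, fun j hj => ?_, fun j hj => ?_⟩ <;>
      funext y <;> simp [hi, hj]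
  · constructor
    · intro x; simpa [deactS, Row.deact] using hrow'.lab x
    · intro x
      by_cases hx : x = r.lab u
      · simp [deactS, hi, hu, hrow.lab, Row.deact, Row.grow, hx]
      · have hx' : x.val ≠ (r.lab u).val := fun h => hx (Fin.ext h)
        simp [deactS, hi, hu, hrow.lab, hrow'.act, Row.deact, Row.grow, hx, hx']
    · intro x; simpa [deactS, Row.deact] using hrow'.d x
    · intro x; simpa [deactS, Row.deact] using hrow'.pot x
    · simp [deactS, hi, hrow.cnt, Row.deact, Row.grow]

theorem mergeS_spec (hi : s.nat 40 0 0 = i) (hrow : RowAt s i r) (hrow' : RowAt s (i + 1) (r.grow Δ))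
    (hu : s.nat 8 i 0 = u) (hv : s.nat 9 i 0 = v) :
    SameRows s (mergeS.run n s) (i + 1) ∧ RowAt (mergeS.run n s) (i + 1) ((r.grow Δ).merge u v) := by
  set r' := r.grow Δ with hr'
  have el : r'.lab = r.lab := rfl
  have ea : r'.act = r.act := rfl
  have ec : r'.cnt = r.cnt := rfl
  set s₁ := s.writeReal 4 (i + 1) (r.lab u) (r'.pot (r.lab u) + r'.pot (r.lab v)) with hs₁
  set s₂ := if r.act (r.lab v) = 1 then s₁.writeNat 7 (i + 1) 0 (r.cnt - 1) else s₁ with hs₂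
  set p : Stm := .ite (eqTest (labE (var 41)) (labE eV)) (.setN 5 ns (var 41) (labE eU)) .skip with hp
  have hpN : p.natWrites = [5] := rfl
  have hpR : p.realWrites = [] := rfl
  have e : mergeS.run n s = (Stm.iter 41 1 p).run n s₂ := by
    simp only [mergeS, run_seq]
    congr 1
    simp only [run_setR, run_ite, run_setN, run_skip]
    simp [hi, hu, hv, hrow.lab, hrow'.pot, hrow.act, hrow.cnt, hs₂, hs₁]
  have hN2 : ∀ a, a ≠ 7 → s₂.nat a = s.nat a := fun a ha => by
    rw [hs₂]; split_ifs <;> simp [hs₁, ha]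
  have hN2' : s₂.nat 7 (i + 1) 0 = (r'.merge u v).cnt := by
    have := hrow'.cnt
    rw [hs₂]
    split_ifs with h <;> simp [hs₁, Row.merge, el, ea, ec, h, this]
  have hR2 : ∀ x : Fin n, s₂.real 4 (i + 1) x = (r'.merge u v).pot x := fun x => by
    rw [hs₂]
    split_ifs with h <;> simp [hs₁, Row.merge, el, hrow'.pot, Fin.val_inj]
  have hR2' : s₂.real 3 = s.real 3 := by
    rw [hs₂]; split_ifs <;> simp [hs₁]
  have h2 : SameRows s s₂ (i + 1) := by
    refine ⟨fun j hj => ?_, fun j hj => ?_, fun j hj => ?_, fun j hj => ?_, fun j hj => ?_⟩ <;>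
      funext y <;> rw [hs₂] <;> split_ifs <;> simp [hs₁, hj]
  -- Labels are compared in row `i` and rewritten in row `i + 1`, so relabelling one vertex does not
  -- affect the test for the next.
  have key := run_iter (n := n) (v := 41) (c := 1) (p := p) (s := s₂)
    (fun x s' => (∀ j, j ≠ i + 1 → s'.nat 5 j = s₂.nat 5 j) ∧ ∀ y : Fin n,
      s'.nat 5 (i + 1) y = if y.val < x then (r'.merge u v).lab y else r.lab y)
    (fun x s' j h => by simpa using h)
    ⟨fun _ _ => rfl, fun y => by simp [hN2, hrow'.lab, el]⟩ (by
      rintro x s' hx hN hR hx' ⟨h, h'⟩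
      have hi' : s'.nat 40 0 0 = i := by
        rw [hN 40 (by simp) (by simp [hpN]), hN2 40 (by simp), hi]
      have hu' : s'.nat 8 i 0 = u := by
        rw [hN 8 (by simp) (by simp [hpN]), hN2 8 (by simp), hu]
      have hv' : s'.nat 9 i 0 = v := by
        rw [hN 9 (by simp) (by simp [hpN]), hN2 9 (by simp), hv]
      have hl' : ∀ y : Fin n, s'.nat 5 i y = r.lab y := fun y => by
        rw [h i (by omega), hN2 5 (by simp), hrow.lab]
      rw [one_mul] at hx
      obtain ⟨x, rfl⟩ : ∃ x' : Fin n, x = x'.val := ⟨⟨x, hx⟩, rfl⟩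
      have hle : ∀ y : Fin n, y ≤ x ↔ y = x ∨ y.val < x.val := fun y => by
        rw [le_iff_eq_or_lt, Fin.lt_def]
      by_cases hc : r.lab x = r.lab v
      · simp only [hp, run_ite]
        simp [hi', hx', hu', hv', hl', hc]
        refine ⟨fun j hj => ?_, fun y => ?_⟩
        · funext y; simp [hj, h j hj]
        · by_cases hyx : y = x
          · subst hyx; simp [Row.merge, el, hc]
          · have hyx' : ¬ y.val = x.val := fun h' => hyx (Fin.ext h')
            simp only [hyx', if_false, h', hle, hyx, false_or]
      · simp only [hp, run_ite]
        simp [hi', hx', hv', hl', hc]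
        refine ⟨h, fun y => ?_⟩
        by_cases hyx : y = x
        · subst hyx
          rw [h']
          simp [Row.merge, el, hc]
        · rw [h']
          simp only [hle, hyx, false_or])
  rw [e]
  obtain ⟨h, h'⟩ := key
  have hN3 : ∀ a, a ≠ 41 → a ≠ 5 → ((Stm.iter 41 1 p).run n s₂).nat a = s₂.nat a := fun a ha ha' =>
    run_nat_of_notMem _ _ (by simp [natWrites, hpN, ha, ha'])
  have hR3 : ∀ a, ((Stm.iter 41 1 p).run n s₂).real a = s₂.real a := fun a =>
    run_real_of_notMem _ _ (by simp [realWrites, hpR])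
  constructor
  · exact h2.trans ⟨h, fun j hj => by rw [hN3 6 (by simp) (by simp)],
      fun j hj => by rw [hN3 7 (by simp) (by simp)], fun j hj => by rw [hR3 3],
      fun j hj => by rw [hR3 4]⟩
  · refine ⟨fun x => ?_, fun x => ?_, fun x => ?_, fun x => ?_, ?_⟩
    · rw [h' x, if_pos (by rw [one_mul]; exact x.2)]
    · rw [hN3 6 (by simp) (by simp), hN2 6 (by simp), hrow'.act]; rfl
    · rw [hR3 3, hR2', hrow'.d]; rfl
    · rw [hR3 4, hR2]
    · rw [hN3 7 (by simp) (by simp), hN2']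

theorem grow_zero (r : Row n) : r.grow 0 = r := by
  simp [Row.grow]

theorem stepS_spec (hn : 0 < n) (hi : s.nat 40 0 0 = i) (hrow : RowAt s i r) (hw : WeightAt s w)
    (hm : s.nat 1 0 0 = m) (hcnt : r.CntOk) :
    SameRows s (stepS.run n s) (i + 1) ∧
    (∀ j, j ≠ i → (stepS.run n s).nat 8 j = s.nat 8 j ∧ (stepS.run n s).nat 9 j = s.nat 9 j ∧
      (stepS.run n s).nat 10 j = s.nat 10 j) ∧
    ∃ (r' : Row n) (u v : Fin n) (Δ : ℝ), RowAt (stepS.run n s) (i + 1) r' ∧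
      (stepS.run n s).nat 8 i 0 = u ∧ (stepS.run n s).nat 9 i 0 = v ∧
      Step w m r r' ((stepS.run n s).nat 10 i 0) u v Δ := by
  set s₀ := (((s.writeReal 5 i 0 0).writeNat 8 i 0 0).writeNat 9 i 0 0).writeNat 10 i 0 0 with hs₀
  have hi₀ : s₀.nat 40 0 0 = i := by simp [hs₀, hi]
  have hm₀ : s₀.nat 1 0 0 = m := by simp [hs₀, hm]
  have hsr₀ : SameRows s s₀ (i + 1) := .of_eq (by simp [hs₀]) (by simp [hs₀]) (by simp [hs₀])
    (by simp [hs₀]) (by simp [hs₀]) _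
  have hrow₀ : RowAt s₀ i r := hsr₀.rowAt hrow (by omega)
  have hw₀ : WeightAt s₀ w := by simpa [WeightAt, hs₀] using hw
  have h₀ : ∀ j, j ≠ i → s₀.nat 8 j = s.nat 8 j ∧ s₀.nat 9 j = s.nat 9 j ∧
      s₀.nat 10 j = s.nat 10 j := fun j hj => by
    refine ⟨?_, ?_, ?_⟩ <;> funext y <;> simp [hs₀, hj]
  have e : stepS.run n s = (Stm.ite (.nle (vec 7 cs) (var 1)) .skip
      (.ite (eqTest (labE eU) (labE eV)) deactS
        (.seq (.setN 10 cs (.const 0) (.const 1)) mergeS))).run n (copyGrow.run n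
      ((Stm.ite (.nle (vec 7 cs) (var 1)) .skip scan).run n s₀)) := by
    simp only [stepS, run_seq, run_setN, run_setR]
    simp [hi, hs₀]
  have hcgN : ∀ (s : Memory) a, a ∉ [41, 5, 6, 7] → (copyGrow.run n s).nat a = s.nat a :=
    fun s a ha => run_nat_of_notMem _ _ (by simpa [copyGrow, natWrites] using ha)
  have hscN : ∀ (s : Memory) a, a ∉ [11, 42, 43, 8, 9] → (scan.run n s).nat a = s.nat a :=
    fun s a ha => run_nat_of_notMem _ _ (by
      simp only [List.mem_cons, not_or] at ha
      simp [scan, scanBody, natWrites, ha])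
  have hscR : ∀ (s : Memory) a, a ∉ [5, 6] → (scan.run n s).real a = s.real a :=
    fun s a ha => run_real_of_notMem _ _ (by
      simp only [List.mem_cons, not_or] at ha
      simp [scan, scanBody, realWrites, ha])
  by_cases hc : r.cnt ≤ m
  · have e1 : (Stm.ite (.nle (vec 7 cs) (var 1)) .skip scan).run n s₀ = s₀ := by
      simp [hi₀, hm₀, hrow₀.cnt, hc]
    obtain ⟨h1, h2⟩ := copyGrow_spec (Δ := 0) hi₀ hrow₀ (by simp [hs₀])
    rw [grow_zero] at h2
    have e2 : stepS.run n s = copyGrow.run n s₀ := by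
      have := (h1.rowAt hrow₀ (by omega)).cnt
      rw [e, e1]
      simp [hcgN s₀ 40 (by simp), hcgN s₀ 1 (by simp), hi₀, hm₀, this, hc]
    rw [e2, hcgN s₀ 8 (by simp), hcgN s₀ 9 (by simp), hcgN s₀ 10 (by simp)]
    -- After the process has stopped the row is copied with growth 0; the pair `0`, `0` is a mere
    -- default.
    exact ⟨hsr₀.trans h1, h₀, r, ⟨0, hn⟩, ⟨0, hn⟩, 0, h2, by simp [hs₀], by simp [hs₀],
      .inl ⟨hc, rfl, by simp [hs₀], rfl⟩⟩
  · have e1 : (Stm.ite (.nle (vec 7 cs) (var 1)) .skip scan).run n s₀ = scan.run n s₀ := by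
      simp [hi₀, hm₀, hrow₀.cnt, hc]
    obtain ⟨hrows, u, v, hu, hv, hev⟩ := scan_spec hi₀ hrow₀ hw₀ (hcnt.exists_act (by omega))
    set s₁ := scan.run n s₀ with hs₁
    have hi₁ : s₁.nat 40 0 0 = i := by rw [hs₁, hscN s₀ 40 (by simp), hi₀]
    have hm₁ : s₁.nat 1 0 0 = m := by rw [hs₁, hscN s₀ 1 (by simp), hm₀]
    have hsr₁ : SameRows s s₁ (i + 1) := hsr₀.trans (.of_eq (hscN _ _ (by simp)) (hscN _ _ (by simp))
      (hscN _ _ (by simp)) (hscR _ _ (by simp)) (hscR _ _ (by simp)) _)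
    obtain ⟨h1, h2⟩ := copyGrow_spec hi₁ (hsr₁.rowAt hrow (by omega)) rfl
    set s₂ := copyGrow.run n s₁ with hs₂
    have hN₂ : ∀ a, a ∉ [41, 5, 6, 7] → s₂.nat a = s₁.nat a := hcgN s₁
    have hsr₂ := hsr₁.trans h1
    have hrow₂ := hsr₂.rowAt hrow (by omega)
    have hi₂ : s₂.nat 40 0 0 = i := by rw [hN₂ 40 (by simp), hi₁]
    have hm₂ : s₂.nat 1 0 0 = m := by rw [hN₂ 1 (by simp), hm₁]
    have hu₂ : s₂.nat 8 i 0 = u := by rw [hN₂ 8 (by simp), hu]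
    have hv₂ : s₂.nat 9 i 0 = v := by rw [hN₂ 9 (by simp), hv]
    have h10 : s₂.nat 10 = s₀.nat 10 := by rw [hN₂ 10 (by simp), hs₁, hscN s₀ 10 (by simp)]
    have h₂ : ∀ j, j ≠ i → s₂.nat 8 j = s.nat 8 j ∧ s₂.nat 9 j = s.nat 9 j ∧
        s₂.nat 10 j = s.nat 10 j := fun j hj => by
      rw [hN₂ 8 (by simp), hN₂ 9 (by simp), h10]
      exact ⟨(hrows j hj).1.trans (h₀ j hj).1, (hrows j hj).2.trans (h₀ j hj).2.1, (h₀ j hj).2.2⟩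
    rw [e1] at e
    by_cases huv : r.lab u = r.lab v
    · have e2 : stepS.run n s = deactS.run n s₂ := by
        rw [e, ← hs₂]
        simp [hi₂, hm₂, hrow₂.cnt, hrow₂.lab, hu₂, hv₂, hc, huv]
      have hN₃ : ∀ a, a ∉ [6, 7] → (deactS.run n s₂).nat a = s₂.nat a := fun a ha =>
        run_nat_of_notMem _ _ (by simpa [deactS, natWrites] using ha)
      obtain ⟨h3, h4⟩ := deactS_spec hi₂ hrow₂ h2 hu₂
      rw [e2, hN₃ 8 (by simp), hN₃ 9 (by simp), hN₃ 10 (by simp)]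
      exact ⟨hsr₂.trans h3, h₂, _, u, v, _, h4, hu₂, hv₂,
        .inr (.inl ⟨by omega, hev, huv, rfl, by rw [h10]; simp [hs₀]⟩)⟩
    · set s₃ := s₂.writeNat 10 i 0 1 with hs₃
      have e2 : stepS.run n s = mergeS.run n s₃ := by
        rw [e, ← hs₂]
        simp [hi₂, hm₂, hrow₂.cnt, hrow₂.lab, hu₂, hv₂, hc, huv, hs₃]
      have hsr₃ : SameRows s₂ s₃ (i + 1) := .of_eq (by simp [hs₃]) (by simp [hs₃]) (by simp [hs₃])
        (by simp [hs₃]) (by simp [hs₃]) _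
      have hN₃ : ∀ a, a ∉ [5, 7, 41] → (mergeS.run n s₃).nat a = s₃.nat a := fun a ha =>
        run_nat_of_notMem _ _ (by
          simp only [List.mem_cons, not_or] at ha
          simp [mergeS, natWrites, ha])
      have h2' : RowAt s₃ (i + 1) (r.grow (s₁.real 5 i 0)) :=
        h2.congr (by simp [hs₃]) (by simp [hs₃]) (by simp [hs₃]) (by simp [hs₃]) (by simp [hs₃])
      obtain ⟨h3, h4⟩ := mergeS_spec (u := u) (v := v) (by simp [hs₃, hi₂])
        (hsr₃.rowAt hrow₂ (by omega)) h2' (by simp [hs₃, hu₂]) (by simp [hs₃, hv₂])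
      rw [e2, hN₃ 8 (by simp), hN₃ 9 (by simp), hN₃ 10 (by simp)]
      refine ⟨(hsr₂.trans hsr₃).trans h3, fun j hj => ?_, _, u, v, _, h4, by simp [hs₃, hu₂],
        by simp [hs₃, hv₂], .inr (.inr ⟨by omega, hev, huv, rfl, by simp [hs₃]⟩)⟩
      obtain ⟨q1, q2, q3⟩ := h₂ j hj
      refine ⟨by simpa [hs₃] using q1, by simpa [hs₃] using q2, ?_⟩
      rw [← q3]
      funext y
      simp [hs₃, hj]

/-- The memory holds a run of the growing process. -/
structure HistoryAt (s : Memory) (w : Fin n → Fin n → ℝ) (lam : ℝ) (m : ℕ) (R : ℕ → Row n)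
    (typ : ℕ → ℕ) (eu ev : ℕ → Fin n) (Δ : ℕ → ℝ) : Prop where
  history : History w lam m R typ eu ev Δ
  row : ∀ i ≤ 2 * n, RowAt s i (R i)
  typ_eq : ∀ i < 2 * n, s.nat 10 i 0 = typ i
  eu_eq : ∀ i < 2 * n, s.nat 8 i 0 = eu i
  ev_eq : ∀ i < 2 * n, s.nat 9 i 0 = ev i

/-- The count of active components is needed inside the loop, when only the first `i` steps are
known and `History` is not yet available. -/
theorem History.of_partial {R : ℕ → Row n} {typ : ℕ → ℕ} {eu ev : ℕ → Fin n} {Δ : ℕ → ℝ}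
    (h0 : R 0 = Row.init n lam)
    (hs : ∀ j < i, Step w m (R j) (R (j + 1)) (typ j) (eu j) (ev j) (Δ j)) : (R i).CntOk := by
  induction i with
  | zero => rw [h0]; exact .init lam
  | succ i ih =>
    have ih := ih fun j hj => hs j (by omega)
    rcases hs i (by omega) with ⟨-, h, -⟩ | ⟨-, he, -, h, -⟩ | ⟨-, he, huv, h, -⟩
    · rwa [h]
    · rw [h]; exact ih.grow.deact he.act
    · rw [h]; exact ih.grow.merge huv

theorem growS_spec (hn : 0 < n) (h0 : s.nat 0 0 0 = n) (hm : s.nat 1 0 0 = m) (hw : WeightAt s w)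
    (hlam : s.real 7 0 0 = lam) :
    ∃ R typ eu ev Δ, HistoryAt (growS.run n s) w lam m R typ eu ev Δ := by
  rw [growS, run_seq]
  have hinit := growInit_spec h0 hlam
  have hiN : ∀ a, a ∉ [41, 5, 6, 7] → (growInit.run n s).nat a = s.nat a := fun a ha =>
    run_nat_of_notMem _ _ (by simpa [growInit, natWrites] using ha)
  have hiR : ∀ a, a ∉ [3, 4] → (growInit.run n s).real a = s.real a := fun a ha =>
    run_real_of_notMem _ _ (by simpa [growInit, realWrites] using ha)
  set s₁ := growInit.run n s
  have hpN : stepS.natWrites =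
      [8, 9, 10, 11, 42, 43, 8, 9, 11, 41, 5, 6, 7, 6, 7, 10, 7, 41, 5] := rfl
  have hpR : stepS.realWrites = [5, 6, 6, 6, 5, 3, 4, 3, 4, 4] := rfl
  obtain ⟨R, typ, eu, ev, Δ, h1, h2, h3, h4⟩ := run_iter (n := n) (v := 40) (c := 2) (p := stepS)
    (s := s₁) (fun i s' => ∃ (R : ℕ → Row n) (typ : ℕ → ℕ) (eu ev : ℕ → Fin n) (Δ : ℕ → ℝ),
      R 0 = Row.init n lam ∧
      (∀ j < i, Step w m (R j) (R (j + 1)) (typ j) (eu j) (ev j) (Δ j)) ∧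
      (∀ j ≤ i, RowAt s' j (R j)) ∧
      ∀ j < i, s'.nat 10 j 0 = typ j ∧ s'.nat 8 j 0 = eu j ∧ s'.nat 9 j 0 = ev j)
    (fun i s' j h => by
      obtain ⟨R, typ, eu, ev, Δ, h1, h2, h3, h4⟩ := h
      exact ⟨R, typ, eu, ev, Δ, h1, h2, fun j hj => (h3 j hj).congr (by simp) (by simp) (by simp)
        (by simp) (by simp), by simpa using h4⟩)
    ⟨fun _ => Row.init n lam, fun _ => 0, fun _ => ⟨0, hn⟩, fun _ => ⟨0, hn⟩, fun _ => 0, rfl,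
      by simp, by simpa using hinit, by simp⟩ (by
      rintro i s' hi hN hR hv ⟨R, typ, eu, ev, Δ, h1, h2, h3, h4⟩
      have hw' : WeightAt s' w := fun x y => by
        rw [hR 0 (by simp [hpR]), hiR 0 (by simp), hw]
      have hm' : s'.nat 1 0 0 = m := by
        rw [hN 1 (by simp) (by simp [hpN]), hiN 1 (by simp), hm]
      obtain ⟨q1, q2, r', u, v, D, q3, q4, q5, q6⟩ := stepS_spec hn hv (h3 i le_rfl) hw' hm'
        (History.of_partial h1 h2)
      have hle : ∀ j, j < i + 1 → j ≠ i → j < i := fun j h h' => by omega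
      refine ⟨fun j => if j ≤ i then R j else r', fun j => (stepS.run n s').nat 10 j 0,
        fun j => if j = i then u else eu j, fun j => if j = i then v else ev j,
        fun j => if j = i then D else Δ j, by simpa using h1, fun j hj => ?_, fun j hj => ?_,
        fun j hj => ?_⟩
      · by_cases hji : j = i
        · subst hji; simpa using q6
        · have hj' := hle j hj hji
          simp only [if_neg hji, if_pos hj'.le, if_pos (show j + 1 ≤ i by omega)]
          rw [(q2 j hji).2.2, (h4 j hj').1]
          exact h2 j hj'
      · by_cases hji : j ≤ i
        · simp only [if_pos hji]
          exact q1.rowAt (h3 j hji) (by omega)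
        · obtain rfl : j = i + 1 := by omega
          simpa using q3
      · by_cases hji : j = i
        · subst hji; simp [q4, q5]
        · simp only [if_neg hji]
          rw [(q2 j hji).1, (q2 j hji).2.1]
          exact ⟨trivial, (h4 j (hle j hj hji)).2⟩)
  exact ⟨R, typ, eu, ev, Δ, ⟨h1, h2⟩, h3, fun i hi => (h4 i hi).1, fun i hi => (h4 i hi).2.1,
    fun i hi => (h4 i hi).2.2⟩

end Prog

end KMinWP

namespace KMinWP

namespace Prog

open Stm Row Equiv

variable {n m : ℕ} {w : Fin n → Fin n → ℝ} {s s' : Memory} {lam : ℝ}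
  {R : ℕ → Row n} {typ : ℕ → ℕ} {eu ev : ℕ → Fin n} {Δ : ℕ → ℝ}

theorem HistoryAt.congr (h : HistoryAt s w lam m R typ eu ev Δ)
    (hN : ∀ a, a ∈ [5, 6, 7, 8, 9, 10] → s'.nat a = s.nat a)
    (hR : ∀ a, a ∈ [3, 4] → s'.real a = s.real a) : HistoryAt s' w lam m R typ eu ev Δ where
  history := h.history
  row i hi := (h.row i hi).congr (by rw [hN 5 (by simp)]) (by rw [hN 6 (by simp)])
    (by rw [hN 7 (by simp)]) (by rw [hR 3 (by simp)]) (by rw [hR 4 (by simp)])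
  typ_eq i hi := by rw [hN 10 (by simp), h.typ_eq i hi]
  eu_eq i hi := by rw [hN 8 (by simp), h.eu_eq i hi]
  ev_eq i hi := by rw [hN 9 (by simp), h.ev_eq i hi]

/-! ### Correctness of the pruning process -/

/-- The set of vertices that the memory marks as kept. -/
def keptSet (n : ℕ) (s : Memory) : Finset (Fin n) := {x | s.nat 12 x 0 = 1}

theorem mem_keptSet {x : Fin n} : x ∈ keptSet n s ↔ s.nat 12 x 0 = 1 := by simp [keptSet]

theorem pruneInit_spec (h0 : s.nat 0 0 0 = n) (H : HistoryAt s w lam m R typ eu ev Δ) :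
    keptSet n (pruneInit.run n s) =
      Finset.univ.filter (fun x => (R (2 * n)).act ((R (2 * n)).lab x) = 1) ∧
    ∀ x : Fin n, (pruneInit.run n s).nat 13 x 0 = 0 := by
  have key := run_iter (n := n) (v := 41) (c := 1) (s := s)
    (p := .seq (.setN 12 (var 41) (.const 0) (.read 6 two (.read 5 two (var 41))))
      (.setN 13 (var 41) (.const 0) (.const 0)))
    (fun i s' => ∀ x : Fin n, x.val < i →
      s'.nat 12 x 0 = (R (2 * n)).act ((R (2 * n)).lab x) ∧ s'.nat 13 x 0 = 0)
    (fun i s' j h => by simpa using h) (by simp) (by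
      intro i s' hi hN hR hv h x hx
      have h0' : s'.nat 0 0 0 = n := by rw [hN 0 (by simp) (by simp [natWrites]), h0]
      have H' := (H.congr (s' := s') (fun a ha => hN a (by rintro rfl; simp at ha) (by
        simp only [natWrites, List.mem_cons, List.cons_append, List.nil_append]
        rintro (rfl | rfl | h) <;> simp_all)) (fun a ha => hR a (by simp [realWrites]))).row (2 * n)
        le_rfl
      rw [two_mul] at H' ⊢
      by_cases hxi : x.val = i
      · subst hxi
        simp [h0', hv, H'.lab, H'.act]
      · have := h x (by omega)
        rw [two_mul] at this
        simpa [hv, hxi] using this)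
  rw [one_mul] at key
  refine ⟨?_, fun x => (key x x.2).2⟩
  ext x
  rw [mem_keptSet, pruneInit, (key x x.2).1]
  simp

/-- Decides the keep-or-delete alternative of `Pruned.of_merge_keep` and `Pruned.of_merge_delete`,
apart from the condition that `u` is kept. -/
theorem pruneTest_spec {r : Row n} {j : ℕ} {v : Fin n} (hj : s.nat 40 0 0 = j) (hr : RowAt s j r)
    (hv : s.nat 9 j 0 = v) :
    (pruneTest.run n s).nat 23 0 0 = 1 ↔
      r.act (r.lab v) = 1 ∨ ∃ x : Fin n, r.lab x = r.lab v ∧ s.nat 13 x 0 ≠ 0 := by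
  rw [pruneTest, run_seq]
  have e : (setVar 23 (actE (labE eV))).run n s = s.writeNat 23 0 0 (r.act (r.lab v)) := by
    simp [hj, hv, hr.lab, hr.act]
  rw [e]
  set p : Stm := .ite (.and (eqTest (labE (var 41)) (labE eV)) (.not (.nle (vec 13 (var 41)) (.const 0))))
    (setVar 23 (.const 1)) .skip with hp
  have hpN : p.natWrites = [23] := rfl
  have key := run_iter (n := n) (v := 41) (c := 1) (s := s.writeNat 23 0 0 (r.act (r.lab v)))
    (p := p)
    (fun i s' => s'.nat 23 0 0 = 1 ↔ r.act (r.lab v) = 1 ∨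
      ∃ x : Fin n, x.val < i ∧ r.lab x = r.lab v ∧ s.nat 13 x 0 ≠ 0)
    (fun i s' j h => by simpa using h) (by simp) (by
      intro i s' hi hN hR hv' h
      have hN' : ∀ a, a ≠ 41 → a ≠ 23 → s'.nat a = s.nat a := fun a h1 h2 => by
        rw [hN a h1 (by simp [hpN, h2])]
        simp [h2]
      rw [one_mul] at hi
      obtain ⟨i, rfl⟩ : ∃ i' : Fin n, i = i'.val := ⟨⟨i, hi⟩, rfl⟩
      have hc : Test.Holds s' (.and (eqTest (labE (var 41)) (labE eV))
          (.not (.nle (vec 13 (var 41)) (.const 0)))) ↔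
          (r.lab i = r.lab v ∧ s.nat 13 i 0 ≠ 0) := by
        simp [hN' 40, hN' 9, hN' 5, hN' 13, hj, hv, hv', hr.lab]
      rw [hp, run_ite]
      split_ifs with hc'
      · rw [hc] at hc'
        simp only [run_setN, NExpr.eval, Memory.nat_writeNat_self, and_self, if_true, true_iff]
        exact .inr ⟨i, by omega, hc'⟩
      · rw [hc] at hc'
        rw [run_skip, h]
        refine or_congr Iff.rfl ⟨fun ⟨x, hx, hx'⟩ => ⟨x, by omega, hx'⟩, fun ⟨x, hx, hx'⟩ => ?_⟩
        rcases Nat.lt_succ_iff_lt_or_eq.1 hx with hx | hx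
        · exact ⟨x, hx, hx'⟩
        · exact absurd (Fin.ext hx ▸ hx') hc')
  rw [key]
  simp

theorem pruneDelete_spec {r : Row n} {j : ℕ} {v : Fin n} (hj : s.nat 40 0 0 = j) (hr : RowAt s j r)
    (hv : s.nat 9 j 0 = v) :
    keptSet n (pruneDelete.run n s) = (keptSet n s).filter fun x => r.lab x ≠ r.lab v := by
  set p : Stm := .ite (eqTest (labE (var 41)) (labE eV)) (.setN 12 (var 41) (.const 0) (.const 0))
    .skip with hp
  have hpN : p.natWrites = [12] := rfl
  have key := run_iter (n := n) (v := 41) (c := 1) (s := s) (p := p)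
    (fun i s' => ∀ x : Fin n, s'.nat 12 x 0 =
      if x.val < i ∧ r.lab x = r.lab v then 0 else s.nat 12 x 0)
    (fun i s' j h => by simpa using h) (by simp) (by
      intro i s' hi hN hR hv' h x
      have hN' : ∀ a, a ≠ 41 → a ≠ 12 → s'.nat a = s.nat a := fun a h1 h2 =>
        hN a h1 (by simp [hpN, h2])
      rw [one_mul] at hi
      obtain ⟨i, rfl⟩ : ∃ i' : Fin n, i = i'.val := ⟨⟨i, hi⟩, rfl⟩
      have hc : Test.Holds s' (eqTest (labE (var 41)) (labE eV)) ↔ r.lab i = r.lab v := by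
        simp [hN' 40, hN' 9, hN' 5, hj, hv, hv', hr.lab]
      rw [hp, run_ite]
      by_cases hxi : x = i
      · subst hxi
        split_ifs with hc' h1 h1
        · simp [hv']
        · exact absurd ⟨Nat.lt_succ_self _, hc.1 hc'⟩ h1
        · exact absurd (hc.2 h1.2) hc'
        · rw [run_skip, h, if_neg (by simp)]
      · have hxi' : x.val ≠ i.val := fun h => hxi (Fin.ext h)
        have h1 : x.val < i.val + 1 ↔ x.val < i.val := by omega
        simp only [h1]
        rw [← h]
        split_ifs
        · simp [hv', hxi']
        · rfl)
  ext x
  rw [Finset.mem_filter, mem_keptSet, mem_keptSet, pruneDelete, key]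
  by_cases h : r.lab x = r.lab v
  · simp [h]
  · simp [h]

theorem pruneStep_spec {i : ℕ} (hi : i < 2 * n) (hi' : s.nat 44 0 0 = i) (h0 : s.nat 0 0 0 = n)
    (H : HistoryAt s w lam m R typ eu ev Δ) (hw : IsMetric w) (hlam : 0 ≤ lam)
    {Q : Fin m → List (Fin n)} (hQ : IsPathSystem Q)
    (P : Pruning w m R typ eu ev Δ (2 * n - i) (keptSet n s) (fun x => s.nat 13 x 0)
      (fun j => s.nat 14 j 0)) :
    Pruning w m R typ eu ev Δ (2 * n - (i + 1)) (keptSet n (pruneStep.run n s))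
      (fun x => (pruneStep.run n s).nat 13 x 0) (fun j => (pruneStep.run n s).nat 14 j 0) := by
  obtain ⟨j, hj, hj'⟩ : ∃ j, 2 * n - i = j + 1 ∧ j = 2 * n - (i + 1) := ⟨2 * n - (i + 1), by omega, rfl⟩
  rw [← hj']
  rw [hj] at P
  have hjn : j < 2 * n := by omega
  set s₁ := (s.writeNat 40 0 0 j).writeNat 14 j 0 0 with hs₁
  have hk₁ : ∀ l, l ≠ j → s₁.nat 14 l 0 = s.nat 14 l 0 := fun l hl => by simp [hs₁, hl]
  have hj₁ : s₁.nat 40 0 0 = j := by simp [hs₁]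
  have H₁ : HistoryAt s₁ w lam m R typ eu ev Δ := H.congr (fun a ha => by
    have h1 : a ≠ 14 := by rintro rfl; simp at ha
    have h2 : a ≠ 40 := by rintro rfl; simp at ha
    simp [hs₁, h1, h2]) (fun a _ => rfl)
  have hK₁ : keptSet n s₁ = keptSet n s := by simp [keptSet, hs₁]
  have hd₁ : s₁.nat 13 = s.nat 13 := by simp [hs₁]
  have e : pruneStep.run n s = (Stm.ite (eqTest (vec 10 cs) (.const 1))
        (.seq pruneTest
          (.ite (.and (eqTest (vec 12 eU) (.const 1)) (eqTest (var 23) (.const 1))) pruneKeep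
            pruneDelete))
        .skip).run n s₁ := by
    -- Round `i` of the pruning undoes step `2 * n - 1 - i`.
    have : n + n - 1 - i = j := by omega
    simp only [pruneStep, run_seq, run_setN]
    simp [h0, hi', this, hs₁]
  by_cases ht : typ j = 1
  · have e2 : pruneStep.run n s = (Stm.ite (.and (eqTest (vec 12 eU) (.const 1))
        (eqTest (var 23) (.const 1))) pruneKeep pruneDelete).run n (pruneTest.run n s₁) := by
      rw [e, run_ite, if_pos (by simp [hj₁, H₁.typ_eq j hjn, ht]), run_seq]
    have htest := pruneTest_spec hj₁ (H₁.row j hjn.le) (H₁.ev_eq j hjn)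
    have hN₂ : ∀ a, a ≠ 23 → a ≠ 41 → (pruneTest.run n s₁).nat a = s₁.nat a := fun a h1 h2 =>
      run_nat_of_notMem _ _ (by simp [pruneTest, natWrites, h1, h2])
    have hR₂ : ∀ a, (pruneTest.run n s₁).real a = s₁.real a := fun a =>
      run_real_of_notMem _ _ (by simp [pruneTest, realWrites])
    set s₂ := pruneTest.run n s₁ with hs₂
    have H₂ : HistoryAt s₂ w lam m R typ eu ev Δ := H₁.congr (fun a ha =>
      hN₂ a (by rintro rfl; simp at ha) (by rintro rfl; simp at ha)) (fun a _ => hR₂ a)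
    have hj₂ : s₂.nat 40 0 0 = j := by rw [hN₂ 40 (by simp) (by simp), hj₁]
    have hK₂ : keptSet n s₂ = keptSet n s := by
      rw [← hK₁]; simp [keptSet, hN₂ 12]
    have hc : Test.Holds s₂ (.and (eqTest (vec 12 eU) (.const 1)) (eqTest (var 23) (.const 1))) ↔
        eu j ∈ keptSet n s ∧ ((R j).act ((R j).lab (ev j)) = 1 ∨
          ∃ x, (R j).lab x = (R j).lab (ev j) ∧ s.nat 13 x 0 ≠ 0) := by
      rw [← hd₁, ← htest, ← hK₂, mem_keptSet]
      simp [hj₂, H₂.eu_eq j hjn]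
    rw [run_ite] at e2
    split_ifs at e2 with hc'
    · rw [hc] at hc'
      have e3 : pruneStep.run n s = ((s₂.writeNat 14 j 0 1).writeNat 13 (eu j) 0
          (s.nat 13 (eu j) 0 + 1)).writeNat 13 (ev j) 0
            ((if ev j = eu j then s.nat 13 (eu j) 0 + 1 else s.nat 13 (ev j) 0) + 1) := by
        rw [e2]
        simp only [pruneKeep, run_seq, run_setN]
        simp [hj₂, H₂.eu_eq j hjn, H₂.ev_eq j hjn, hN₂ 13, hd₁, Fin.val_inj]
      have hd : (fun x : Fin n => (pruneStep.run n s).nat 13 x 0) =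
          fun x : Fin n => s.nat 13 x 0 + (if x = eu j then 1 else 0) + (if x = ev j then 1 else 0) := by
        funext x
        rw [e3]
        have := hN₂ 13 (by simp) (by simp)
        by_cases h1 : x = ev j
        · subst h1
          by_cases h2 : ev j = eu j
          · simp [h2]
          · simp [h2]
        · have h1' : x.val ≠ (ev j).val := fun h => h1 (Fin.ext h)
          by_cases h2 : x = eu j
          · subst h2; simp [h1, h1']
          · have h2' : x.val ≠ (eu j).val := fun h => h2 (Fin.ext h)
            simp [h1, h2, h1', h2', this, hd₁]
      have hK : keptSet n (pruneStep.run n s) = keptSet n s := by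
        rw [e3, ← hK₂]; simp [keptSet]
      rw [hd, hK]
      refine P.of_keep H.history hw hlam hQ hjn ht (fun l hl => ?_) ?_ hc'.1 hc'.2
      · rw [e3, ← hk₁ l hl]; simp [hl, hN₂ 14]
      · rw [e3]; simp
    · rw [hc] at hc'
      have hN₃ : ∀ a, a ≠ 12 → a ≠ 41 → (pruneDelete.run n s₂).nat a = s₂.nat a := fun a h1 h2 =>
        run_nat_of_notMem _ _ (by simp [pruneDelete, natWrites, h1, h2])
      rw [e2, pruneDelete_spec hj₂ (H₂.row j hjn.le) (H₂.ev_eq j hjn), hK₂]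
      rw [hN₃ 13 (by simp) (by simp), hN₃ 14 (by simp) (by simp), hN₂ 13 (by simp) (by simp),
        hN₂ 14 (by simp) (by simp), hd₁]
      exact P.of_delete H.history hw hlam hQ hjn ht hk₁ (by simp [hs₁]) hc'
  · have e2 : pruneStep.run n s = s₁ := by
      rw [e, run_ite, if_neg (by simp [hj₁, H₁.typ_eq j hjn, ht]), run_skip]
    rw [e2, hK₁, hd₁]
    exact P.of_typ_ne H.history hw hlam hQ hjn ht hk₁ (by simp [hs₁])

theorem pruneS_spec (h0 : s.nat 0 0 0 = n) (H : HistoryAt s w lam m R typ eu ev Δ)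
    (hw : IsMetric w) (hlam : 0 ≤ lam) (hm : 1 ≤ m) (hmn : m ≤ n) :
    Pruning w m R typ eu ev Δ 0 (keptSet n (pruneS.run n s))
      (fun x => (pruneS.run n s).nat 13 x 0) (fun j => (pruneS.run n s).nat 14 j 0) := by
  -- Some path system is needed to know that all growths are nonnegative; which one is irrelevant.
  obtain ⟨Q, hQ⟩ := exists_feasible hm le_rfl hmn
  rw [pruneS, run_seq]
  obtain ⟨h1, h2⟩ := pruneInit_spec h0 H
  have hiN : ∀ a, a ∉ [41, 12, 13] → (pruneInit.run n s).nat a = s.nat a := fun a ha =>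
    run_nat_of_notMem _ _ (by simpa [pruneInit, natWrites] using ha)
  have hiR : ∀ a, (pruneInit.run n s).real a = s.real a := fun a =>
    run_real_of_notMem _ _ (by simp [pruneInit, realWrites])
  set s₁ := pruneInit.run n s
  have hpN : pruneStep.natWrites = [40, 14, 23, 41, 23, 14, 13, 13, 41, 12] := rfl
  have hpR : pruneStep.realWrites = [] := rfl
  have H₁ : HistoryAt s₁ w lam m R typ eu ev Δ := H.congr (fun a ha => hiN a (by
    intro h; simp only [List.mem_cons, List.not_mem_nil, or_false] at h ha; omega)) (fun a _ => hiR a)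
  have key := run_iter (n := n) (v := 44) (c := 2) (p := pruneStep) (s := s₁)
    (fun i s' => Pruning w m R typ eu ev Δ (2 * n - i) (keptSet n s') (fun x => s'.nat 13 x 0)
      (fun j => s'.nat 14 j 0))
    (fun i s' j h => by simpa [keptSet] using h)
    (by
      have := Pruning.of_final H.history hm hmn (fun j => s₁.nat 14 j 0)
      rw [h1]
      simpa [h2] using this)
    (by
      intro i s' hi hN hR hv h
      refine pruneStep_spec hi hv ?_ (H₁.congr (fun a ha => hN a ?_ ?_) (fun a _ => hR a ?_)) hw hlam
        hQ.1 h
      · rw [hN 0 (by simp) (by simp [hpN]), hiN 0 (by simp), h0]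
      · rintro rfl; simp at ha
      · intro h
        simp only [hpN, List.mem_cons, List.not_mem_nil, or_false] at h ha
        omega
      · simp [hpR])
  simpa using key

/-! ### Correctness of the tours -/

/-- The merges are replayed forward. Exchanging two entries of the successor array is multiplication
by a transposition, so `Tour.step_kept` and `Tour.step_unkept` apply round by round. -/
theorem tourS_spec {K : Finset (Fin n)} {deg : Fin n → ℕ}
    (H : HistoryAt s w lam m R typ eu ev Δ) (hw : IsMetric w)
    (P : Pruning w m R typ eu ev Δ 0 K deg (fun j => s.nat 14 j 0)) :
    ∃ σ : Perm (Fin n), (∀ x : Fin n, (tourS.run n s).nat 15 x 0 = σ x) ∧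
      Tour w (R (2 * n)) K σ
        (∑ j ∈ Finset.Ico 0 (2 * n) with s.nat 14 j 0 = 1, w (eu j) (ev j)) := by
  rw [tourS, run_seq]
  have hinit := run_iter (n := n) (v := 41) (c := 1) (s := s)
    (p := .setN 15 (var 41) (.const 0) (var 41))
    (fun i s' => ∀ x < i, s'.nat 15 x 0 = x)
    (fun i s' j h => by simpa using h) (by simp) (by
      intro i s' hi hN hR hv h x hx
      by_cases hxi : x = i
      · simp [hv, hxi]
      · simpa [hv, hxi] using h x (by omega))
  have hiN : ∀ a, a ∉ [41, 15] →
      ((Stm.iter 41 1 (.setN 15 (var 41) (.const 0) (var 41))).run n s).nat a = s.nat a := fun a ha =>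
    run_nat_of_notMem _ _ (by simpa [natWrites] using ha)
  have hiR : ∀ a,
      ((Stm.iter 41 1 (.setN 15 (var 41) (.const 0) (var 41))).run n s).real a = s.real a := fun a =>
    run_real_of_notMem _ _ (by simp [realWrites])
  set s₁ := (Stm.iter 41 1 (.setN 15 (var 41) (.const 0) (var 41))).run n s
  set p : Stm := .ite (eqTest (vec 14 cs) (.const 1))
      (.seq (setVar 23 (vec 15 eU))
        (.seq (.setN 15 eU (.const 0) (vec 15 eV)) (.setN 15 eV (.const 0) (var 23))))
      .skip with hp
  have hpN : p.natWrites = [23, 15, 15] := rfl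
  have hpR : p.realWrites = [] := rfl
  have key := run_iter (n := n) (v := 40) (c := 2) (p := p) (s := s₁)
    (fun i s' => ∃ σ : Perm (Fin n), (∀ x : Fin n, s'.nat 15 x 0 = σ x) ∧
      Tour w (R i) K σ (∑ j ∈ Finset.Ico 0 i with s.nat 14 j 0 = 1, w (eu j) (ev j)))
    (fun i s' j h => by simpa using h)
    ⟨1, fun x => by simpa using hinit x (by rw [one_mul]; exact x.2), by
      rw [H.history.init]
      simpa using Tour.init hw⟩
    (by
      rintro i s' hi hN hR hv ⟨σ, h1, h2⟩
      have hN' : ∀ a, a ∉ [40, 41, 23, 15] → s'.nat a = s.nat a := fun a ha => by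
        simp only [List.mem_cons, not_or] at ha
        rw [hN a ha.1 (by simp [hpN, ha]), hiN a (by simp [ha])]
      have H' : HistoryAt s' w lam m R typ eu ev Δ := H.congr (fun a ha => hN' a (by
        intro h; simp only [List.mem_cons, List.not_mem_nil, or_false] at h ha; omega)) (fun a _ => by
          rw [hR a (by simp [hpR]), hiR])
      rw [Finset.sum_filter, Finset.sum_Ico_succ_top (Nat.zero_le _), ← Finset.sum_filter]
      rw [hp, run_ite]
      have hc : Test.Holds s' (eqTest (vec 14 cs) (.const 1)) ↔ s.nat 14 i 0 = 1 := by
        simp [hv, hN' 14]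
      split_ifs with hc' h' h'
      · obtain ⟨hne, h3⟩ := h2.step_kept H.history hw P hi h'
        refine ⟨_, fun x => ?_, h3⟩
        simp only [run_seq, run_setN]
        simp [hv, H'.eu_eq i hi, H'.ev_eq i hi, h1]
        by_cases hxv : x = ev i
        · subst hxv; simp
        · have hxv' : x.val ≠ (ev i).val := fun h => hxv (Fin.ext h)
          by_cases hxu : x = eu i
          · subst hxu; simp [hxv']
          · have hxu' : x.val ≠ (eu i).val := fun h => hxu (Fin.ext h)
            simp [hxv', hxu', swap_apply_of_ne_of_ne hxu hxv]
      · exact absurd (hc.1 hc') h'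
      · exact absurd (hc.2 h') hc'
      · rw [run_skip, add_zero]
        exact ⟨σ, h1, h2.step_unkept H.history P hi h'⟩)
  exact key

end Prog

end KMinWP

namespace KMinWP

open Equiv

variable {n m : ℕ} {w : Fin n → Fin n → ℝ}

/-! ### Walking along the tours -/

/-- The weights as a function on pairs of natural numbers. -/
noncomputable def natWeight (w : Fin n → Fin n → ℝ) (i j : ℕ) : ℝ :=
  if h : i < n ∧ j < n then w ⟨i, h.1⟩ ⟨j, h.2⟩ else 0

@[simp] theorem natWeight_val (u v : Fin n) : natWeight w u v = w u v := by
  simp [natWeight]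

theorem natWeight_nonneg (hw : IsMetric w) (i j : ℕ) : 0 ≤ natWeight w i j := by
  unfold natWeight
  split_ifs
  exacts [hw.nonneg _ _, le_rfl]

/-- A sequence `a` of length `N` lists the elements of `K` that are not in `C`; unless it is cut in
front of a position, the entry there is the successor of the preceding one. -/
structure Walk (σ : Perm (Fin n)) (K C : Finset (Fin n)) (a b : ℕ → ℕ) (N : ℕ) : Prop where
  sub : C ⊆ K
  card : N + C.card = K.card
  mem : ∀ p < N, ∃ x ∈ K, x ∉ C ∧ a p = x
  inj : ∀ p < N, ∀ q < N, a p = a q → p = q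
  succ : ∀ p < N, b p ≠ 0 → 0 < p ∧ ∃ x : Fin n, a (p - 1) = x ∧ a p = σ x

section Walk

variable {σ : Perm (Fin n)} {K C : Finset (Fin n)} {a b a' b' : ℕ → ℕ} {N i : ℕ} {x : Fin n}

theorem Walk.init (σ : Perm (Fin n)) (K : Finset (Fin n)) (a b : ℕ → ℕ) : Walk σ K K a b 0 where
  sub := subset_rfl
  card := by simp
  mem := by simp
  inj := by simp
  succ := by simp

/-- Listed vertices have left `C`, so `x ∈ C` is new to the sequence; a nonzero mark is allowed only
if the last entry is the predecessor of `x` on its tour. -/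
theorem Walk.emit (h : Walk σ K C a b N) (hx : x ∈ C)
    (ha : ∀ p, a' p = if p = N then x.val else a p) (hb : ∀ p, b' p = if p = N then i else b p)
    (hi : i ≠ 0 → 0 < N ∧ ∃ y : Fin n, a (N - 1) = y ∧ σ y = x) :
    Walk σ K (C.erase x) a' b' (N + 1) where
  sub := (Finset.erase_subset _ _).trans h.sub
  card := by
    have := Finset.card_erase_add_one hx
    have := h.card
    omega
  mem p hp := by
    by_cases hpN : p = N
    · exact ⟨x, h.sub hx, by simp, by simp [ha, hpN]⟩
    · obtain ⟨y, h1, h2, h3⟩ := h.mem p (by omega)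
      exact ⟨y, h1, fun h' => h2 (Finset.mem_of_mem_erase h'), by simp [ha, hpN, h3]⟩
  inj p hp q hq := by
    have hne : ∀ p < N, a p ≠ x := fun p hp hpx => by
      obtain ⟨y, -, h2, h3⟩ := h.mem p hp
      rw [hpx] at h3
      exact h2 (Fin.ext h3 ▸ hx)
    rw [ha, ha]
    split_ifs with h1 h2 h2
    · omega
    · exact fun h' => absurd h'.symm (hne q (by omega))
    · exact fun h' => absurd h' (hne p (by omega))
    · exact h.inj p (by omega) q (by omega)
  succ p hp := by
    rw [hb]
    split_ifs with hpN
    · subst hpN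
      intro hi'
      obtain ⟨h1, y, h2, h3⟩ := hi hi'
      exact ⟨h1, y, by rw [ha, if_neg (by omega), h2], by rw [ha, if_pos rfl, h3]⟩
    · intro hb'
      obtain ⟨h1, y, h2, h3⟩ := h.succ p (by omega) hb'
      exact ⟨h1, y, by rw [ha, if_neg (by omega), h2], by rw [ha, if_neg hpN, h3]⟩

theorem segCount_succ (b : ℕ → ℕ) (s len : ℕ) :
    segCount b s (len + 1) = segCount b s len + if len = 0 ∨ b (s + len) = 0 then 1 else 0 := by
  rw [segCount, Finset.range_add_one, Finset.filter_insert]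
  split_ifs with h
  · rw [Finset.card_insert_of_notMem (by simp), segCount]
  · rfl

theorem segCount_congr {s t len : ℕ} (h : ∀ q < len, b (s + q) = b' (t + q)) :
    segCount b s len = segCount b' t len := by
  unfold segCount
  congr 1
  refine Finset.filter_congr fun q hq => ?_
  rw [h q (Finset.mem_range.1 hq)]

theorem segCost_succ (W : ℕ → ℕ → ℝ) (a b : ℕ → ℕ) (s len : ℕ) :
    segCost W a b s (len + 1) = segCost W a b s len +
      if len = 0 ∨ b (s + len) = 0 then 0 else W (a (s + len - 1)) (a (s + len)) :=
  Finset.sum_range_succ _ _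

/-- The weight of the sequence is at most that of the tours. -/
theorem Walk.segCost_le (h : Walk σ K C a b N) (hw : IsMetric w) :
    segCost (natWeight w) a b 0 N ≤ ∑ x, w x (σ x) := by
  set G : ℕ → ℝ := fun i => if h : i < n then w ⟨i, h⟩ (σ ⟨i, h⟩) else 0 with hG
  have hGv : ∀ x : Fin n, G x = w x (σ x) := fun x => by simp [hG]
  set F := (Finset.range N).filter fun q => ¬ (q = 0 ∨ b (0 + q) = 0) with hF
  have hsucc : ∀ q ∈ F, ∃ x : Fin n, a (q - 1) = x ∧ a q = σ x := fun q hq => by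
    simp only [hF, Finset.mem_filter, Finset.mem_range, zero_add, not_or] at hq
    exact (h.succ q hq.1 hq.2.2).2
  have h1 : segCost (natWeight w) a b 0 N = ∑ q ∈ F, G (a (q - 1)) := by
    rw [hF, Finset.sum_filter]
    refine Finset.sum_congr rfl fun q hq => ?_
    rw [ite_not]
    split_ifs with hq'
    · rfl
    · obtain ⟨x, hx, hx'⟩ := hsucc q (by rw [hF, Finset.mem_filter]; exact ⟨hq, hq'⟩)
      rw [zero_add, hx, hx', hGv, natWeight_val]
  -- Each edge of the sequence is the edge of `σ` leaving its first endpoint, and different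
  -- positions have different first endpoints.
  have h2 : Set.InjOn (fun q => a (q - 1)) F := fun p hp q hq hpq => by
    simp only [hF, Finset.coe_filter, Finset.mem_range, Set.mem_ofPred_eq, not_or] at hp hq
    have := h.inj (p - 1) (by omega) (q - 1) (by omega) hpq
    omega
  rw [h1, ← Finset.sum_image h2, ← Fintype.sum_congr _ _ hGv, Fin.sum_univ_eq_sum_range G]
  refine Finset.sum_le_sum_of_subset_of_nonneg (fun y hy => ?_) fun y _ _ => ?_
  · obtain ⟨q, hq, rfl⟩ := Finset.mem_image.1 hy
    obtain ⟨x, hx, -⟩ := hsucc q hq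
    simp [hx]
  · simp only [hG]
    split_ifs
    exacts [hw.nonneg _ _, le_rfl]

/-- A cycle has at most `n` vertices, so `n` steps go all the way round. -/
theorem exists_lt_pow_eq {x y : Fin n} (h : σ.SameCycle x y) : ∃ j < n, (σ ^ j) x = y := by
  by_cases hx : x ∈ σ.support
  · obtain ⟨j, hj, hj'⟩ := h.exists_pow_eq_of_mem_support hx
    exact ⟨j, hj.trans_le ((Finset.card_le_univ _).trans_eq (Fintype.card_fin n)), hj'⟩
  · rw [Perm.notMem_support] at hx
    exact ⟨0, x.pos, (h.eq_of_left hx)⟩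

end Walk

/-! ### The walk along the tours in memory -/

namespace Prog

open Stm

variable {s s' : Memory} {σ : Perm (Fin n)} {K C : Finset (Fin n)} {i c : ℕ} {r : Fin n}

/-- The memory holds a walk that has left out the vertices marked as kept. -/
abbrev WalkAt (s : Memory) (σ : Perm (Fin n)) (K : Finset (Fin n)) : Prop :=
  Walk σ K (keptSet n s) (fun p => s.nat 17 p 0) (fun p => s.nat 18 p 0) (s.nat 16 0 0)

/-- The number of pieces of the sequence in the memory. -/
abbrev pieces (s : Memory) : ℕ := segCount (fun p => s.nat 18 p 0) 0 (s.nat 16 0 0)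

/-- The state after `i` steps from the vertex `r` along its tour. -/
structure TourWalk (s : Memory) (σ : Perm (Fin n)) (K C : Finset (Fin n)) (c i : ℕ) (r : Fin n) :
    Prop where
  walk : WalkAt s σ K
  cur : s.nat 24 0 0 = (σ ^ i) r
  left : ∀ x, x ∈ keptSet n s ↔ x ∈ C ∧ ∀ j < i, (σ ^ j) r ≠ x
  prev : ∀ j, i = j + 1 → (σ ^ i) r ∈ keptSet n s →
    0 < s.nat 16 0 0 ∧ s.nat 17 (s.nat 16 0 0 - 1) 0 = (σ ^ j) r
  count : pieces s ≤ c + if i ≠ 0 ∧ r ∈ C then 1 else 0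

/-- A tour is unlisted or listed as a whole. On an unlisted one the vertices are emitted
consecutively from `r` on, and once the walk has come back to a listed vertex, all later ones are
listed too. So an emitted vertex that is not the first follows its predecessor directly, as `prev`
records. -/
theorem walkBody_spec (h : TourWalk s σ K C c i r) (hi : s.nat 46 0 0 = i)
    (hσ : ∀ x : Fin n, s.nat 15 x 0 = σ x) (hC : ∀ x, σ x ∈ C ↔ x ∈ C) :
    TourWalk (walkBody.run n s) σ K C c (i + 1) r := by
  have hpow : ∀ j, (σ ^ j) r ∈ C ↔ r ∈ C := fun j => by
    induction j with
    | zero => rfl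
    | succ j ih => rw [pow_succ', Perm.mul_apply, hC, ih]
  have hnext : ∀ j, (σ ^ (j + 1)) r = σ ((σ ^ j) r) := fun j => by
    rw [pow_succ', Perm.mul_apply]
  set x := (σ ^ i) r with hx
  have hcur : s.nat 24 0 0 = x := h.cur
  by_cases hk : x ∈ keptSet n s
  · have hrun : walkBody.run n s = ((((s.writeNat 17 (s.nat 16 0 0) 0 x).writeNat 18 (s.nat 16 0 0) 0
        i).writeNat 12 x 0 0).writeNat 16 0 0 (s.nat 16 0 0 + 1)).writeNat 24 0 0 (σ x) := by
      simp only [walkBody, run_seq, run_ite]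
      rw [if_pos (by simp [hcur, mem_keptSet.1 hk])]
      simp [hcur, hi, hσ]
    set s₁ := walkBody.run n s with hs₁
    have hkept : keptSet n s₁ = (keptSet n s).erase x := by
      ext y
      rw [Finset.mem_erase, mem_keptSet, mem_keptSet, hrun]
      by_cases hyx : y = x
      · simp [hyx]
      · have hyx' : y.val ≠ x.val := fun h => hyx (Fin.ext h)
        simp [hyx, hyx']
    have e16 : s₁.nat 16 0 0 = s.nat 16 0 0 + 1 := by simp [hrun]
    have e17 : ∀ p, s₁.nat 17 p 0 = if p = s.nat 16 0 0 then x.val else s.nat 17 p 0 := by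
      simp [hrun]
    -- The step number serves as the cut mark: it is zero exactly at the start of a tour.
    have e18 : ∀ p, s₁.nat 18 p 0 = if p = s.nat 16 0 0 then i else s.nat 18 p 0 := by
      simp [hrun]
    have hrC : r ∈ C := (hpow i).1 ((h.left x).1 hk).1
    have hprev : i ≠ 0 → 0 < s.nat 16 0 0 ∧
        ∃ y : Fin n, s.nat 17 (s.nat 16 0 0 - 1) 0 = y ∧ σ y = x := fun hi0 => by
      obtain ⟨j, rfl⟩ := Nat.exists_eq_succ_of_ne_zero hi0
      obtain ⟨h1, h2⟩ := h.prev j rfl hk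
      exact ⟨h1, _, h2, (hnext j).symm⟩
    refine ⟨?_, ?_, fun y => ?_, fun j hj _ => ?_, ?_⟩
    · unfold WalkAt
      rw [hkept, e16]
      exact h.walk.emit hk e17 e18 hprev
    · rw [hnext, hrun]; simp [hx]
    · rw [hkept, Finset.mem_erase, h.left]
      constructor
      · rintro ⟨h1, h2, h3⟩
        refine ⟨h2, fun j hj => ?_⟩
        rcases Nat.lt_succ_iff_lt_or_eq.1 hj with hj | rfl
        · exact h3 j hj
        · exact fun h' => h1 h'.symm
      · rintro ⟨h1, h2⟩
        exact ⟨fun h' => h2 i (Nat.lt_succ_self i) h'.symm, h1, fun j hj => h2 j (by omega)⟩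
    · obtain rfl : i = j := by omega
      rw [e16, e17]
      simp [hx]
    · have hcount := h.count
      unfold pieces at hcount ⊢
      rw [e16, segCount_succ, segCount_congr (b' := fun p => s.nat 18 p 0) (t := 0)
        (fun q hq => by simp only [e18]; rw [if_neg (by omega)])]
      simp only [zero_add, e18, if_true]
      by_cases hi0 : i = 0
      · subst hi0
        simp only [ne_eq, not_true_eq_false, false_and, if_false] at hcount
        simp [hrC]
        omega
      · have := (hprev hi0).1.ne'
        simp [hi0, this, hrC] at hcount ⊢
        omega
  · have hrun : walkBody.run n s = s.writeNat 24 0 0 (σ x) := by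
      simp only [walkBody, run_seq, run_ite]
      rw [if_neg (by simpa [hcur, mem_keptSet] using hk)]
      simp [hcur, hσ]
    set s₁ := walkBody.run n s with hs₁
    have hkept : keptSet n s₁ = keptSet n s := by simp [hrun, keptSet]
    have hN : ∀ a, a ≠ 24 → s₁.nat a = s.nat a := fun a ha => by simp [hrun, ha]
    refine ⟨?_, ?_, fun y => ?_, fun j hj hk' => ?_, ?_⟩
    · unfold WalkAt
      rw [hkept, hN 16 (by simp), hN 17 (by simp), hN 18 (by simp)]
      exact h.walk
    · rw [hnext, hrun]; simp [hx]
    · rw [hkept]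
      constructor
      · intro hy
        refine ⟨((h.left y).1 hy).1, fun j hj => ?_⟩
        rcases Nat.lt_succ_iff_lt_or_eq.1 hj with hj | rfl
        · exact ((h.left y).1 hy).2 j hj
        · exact fun h' => hk (hx.trans h' ▸ hy)
      · exact fun hy => (h.left y).2 ⟨hy.1, fun j hj => hy.2 j (by omega)⟩
    -- If `x` is unmarked, it was met before or its tour is not in `C`; in either case the next
    -- vertex is unmarked as well.
    · exfalso
      rw [hkept] at hk'
      have h1 := (h.left _).1 hk'
      refine hk ((h.left x).2 ⟨?_, fun j' hj' h' => ?_⟩)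
      · rw [hpow] at h1 ⊢; exact h1.1
      · have h3 : (σ ^ (j' + 1)) r = (σ ^ (i + 1)) r := by rw [hnext, hnext, h']
        rcases Nat.lt_or_ge (j' + 1) i with h4 | h4
        · exact h1.2 _ h4 h3
        · obtain rfl : i = j' + 1 := by omega
          exact hk (by rw [hx, h3]; exact hk')
    · have hcount := h.count
      unfold pieces at hcount ⊢
      rw [hN 16 (by simp), hN 18 (by simp)]
      refine hcount.trans ?_
      by_cases hr : r ∈ C
      · by_cases hi0 : i = 0 <;> simp [hr, hi0]
      · simp [hr]

/-- On kept vertices, tours and components agree. Each unlisted start vertex opens one piece and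
exhausts its component, so the number of pieces is at most the number of components met. -/
theorem walkS_spec {ro : Row n} {cost : ℝ} (T : Tour w ro (keptSet n s) σ cost)
    (hσ : ∀ x : Fin n, s.nat 15 x 0 = σ x) :
    Walk σ (keptSet n s) ∅ (fun p => (walkS.run n s).nat 17 p 0) (fun p => (walkS.run n s).nat 18 p 0)
      ((walkS.run n s).nat 16 0 0) ∧
    pieces (walkS.run n s) ≤ ((keptSet n s).image ro.lab).card := by
  set K := keptSet n s with hK
  rw [walkS, run_seq, run_setN]
  set s₁ := s.writeNat 16 0 0 0 with hs₁
  set p : Stm := .seq (setVar 24 (var 45)) (.iter 46 1 walkBody) with hp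
  have hpN : p.natWrites = [24, 46, 17, 18, 12, 16, 24] := rfl
  have hbN : walkBody.natWrites = [17, 18, 12, 16, 24] := rfl
  have key := run_iter (n := n) (v := 45) (c := 1) (p := p) (s := s₁)
    (fun i s' => WalkAt s' σ K ∧ (∀ x ∈ keptSet n s', i ≤ x.val) ∧
      (∀ x ∈ K, ∀ y ∈ keptSet n s', ro.lab x = ro.lab y → x ∈ keptSet n s') ∧
      pieces s' ≤ ((K \ keptSet n s').image ro.lab).card)
    (fun i s' j h => by simpa [WalkAt, keptSet, pieces] using h)
    (by
      have h1 : keptSet n s₁ = K := by simp [hs₁, hK, keptSet]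
      have h2 : s₁.nat 16 0 0 = 0 := by simp [hs₁]
      refine ⟨?_, by simp, fun x hx _ _ _ => by rwa [h1], ?_⟩
      · unfold WalkAt
        rw [h1, h2]
        exact .init σ K _ _
      · simp [pieces, h2, segCount])
    (by
      rintro i s' hi hN hR hv ⟨h1, h2, h3, h4⟩
      rw [one_mul] at hi
      obtain ⟨r, rfl⟩ : ∃ i' : Fin n, i = i'.val := ⟨⟨i, hi⟩, rfl⟩
      set C := keptSet n s' with hC
      have hσ' : ∀ x : Fin n, s'.nat 15 x 0 = σ x := fun x => by
        rw [hN 15 (by simp) (by simp [hpN])]; simpa [hs₁] using hσ x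
      have hlab : ∀ x, ro.lab (σ x) = ro.lab x := T.lab
      have hKσ : ∀ x, σ x ∈ K ↔ x ∈ K := fun x => by
        refine ⟨fun h => ?_, fun h => ?_⟩
        · by_contra hx
          exact hx (T.fix x hx ▸ h)
        · by_contra hx
          have := T.fix _ hx
          exact hx ((σ.injective this).symm ▸ h)
      have hCσ : ∀ x, σ x ∈ C ↔ x ∈ C := fun x =>
        ⟨fun h => h3 x ((hKσ x).1 (h1.sub h)) _ h (hlab x).symm,
          fun h => h3 _ ((hKσ x).2 (h1.sub h)) _ h (hlab x)⟩
      have h0 : TourWalk (s'.writeNat 24 0 0 r) σ K C (pieces s') 0 r := by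
        refine ⟨by simpa [WalkAt, keptSet] using h1, by simp, fun x => by simp [hC, keptSet],
          fun j hj => by omega, by simp [pieces]⟩
      have hrun : p.run n s' = (Stm.iter 46 1 walkBody).run n (s'.writeNat 24 0 0 r) := by
        rw [hp, run_seq, run_setN]
        simp [hv]
      have key := run_iter (n := n) (v := 46) (c := 1) (p := walkBody) (s := s'.writeNat 24 0 0 r)
        (fun i s'' => TourWalk s'' σ K C (pieces s') i r)
        (fun i s'' j h => ⟨by simpa [WalkAt, keptSet] using h.walk, by simpa using h.cur,
          by simpa [keptSet] using h.left, by simpa [keptSet] using h.prev,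
          by simpa [pieces] using h.count⟩) h0
        (by
          intro i s'' hi hN' hR' hv' h
          refine walkBody_spec h hv' (fun x => ?_) hCσ
          rw [hN' 15 (by simp) (by simp [hbN])]
          simpa using hσ' x)
      rw [hrun]
      set s₂ := (Stm.iter 46 1 walkBody).run n (s'.writeNat 24 0 0 r) with hs₂
      rw [one_mul] at key
      have hpow : ∀ j, ro.lab ((σ ^ j) r) = ro.lab r := fun j => by
        induction j with
        | zero => rfl
        | succ j ih => rw [pow_succ', Perm.mul_apply, hlab, ih]
      have hpowC : ∀ j, (σ ^ j) r ∈ C ↔ r ∈ C := fun j => by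
        induction j with
        | zero => rfl
        | succ j ih => rw [pow_succ', Perm.mul_apply, hCσ, ih]
      -- One round removes exactly the component of `r`, provided it was still unlisted.
      have hleft : ∀ x, x ∈ keptSet n s₂ ↔ x ∈ C ∧ (r ∈ C → ro.lab x ≠ ro.lab r) := fun x => by
        rw [key.left]
        refine and_congr_right fun hx => ⟨fun h hr h' => ?_, fun h j hj h' => ?_⟩
        · obtain ⟨j, hj, hj'⟩ := exists_lt_pow_eq (T.same r (h1.sub hr) x (h1.sub hx) h'.symm)
          exact h j hj hj'
        · subst h'
          exact h ((hpowC j).1 hx) (hpow j)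
      refine ⟨key.walk, fun x hx => ?_, fun x hx y hy hxy => ?_, key.count.trans ?_⟩
      · have hx' := (hleft x).1 hx
        have := h2 x hx'.1
        rcases this.lt_or_eq with h | h
        · exact h
        · obtain rfl : r = x := Fin.ext h
          exact absurd rfl (hx'.2 hx'.1)
      · have hy' := (hleft y).1 hy
        exact (hleft x).2 ⟨h3 x hx y hy'.1 hxy, fun hr => hxy ▸ hy'.2 hr⟩
      · by_cases hr : r ∈ C
        · have hsub : insert (ro.lab r) ((K \ C).image ro.lab) ⊆ (K \ keptSet n s₂).image ro.lab := by
            intro c hc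
            rw [Finset.mem_insert] at hc
            rcases hc with rfl | hc
            · refine Finset.mem_image_of_mem _ (Finset.mem_sdiff.2 ⟨h1.sub hr, fun h => ?_⟩)
              exact ((hleft r).1 h).2 hr rfl
            · refine Finset.image_subset_image (Finset.sdiff_subset_sdiff subset_rfl ?_) hc
              exact fun x hx => ((hleft x).1 hx).1
          -- The component of `r` was untouched so far, so the new piece is paid by a new label.
          have hnot : ro.lab r ∉ (K \ C).image ro.lab := by
            intro h
            obtain ⟨x, hx, hxr⟩ := Finset.mem_image.1 h
            rw [Finset.mem_sdiff] at hx
            exact hx.2 (h3 x hx.1 r hr hxr)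
          have := Finset.card_le_card hsub
          rw [Finset.card_insert_of_notMem hnot] at this
          split_ifs <;> omega
        · have : keptSet n s₂ = C := by
            ext x
            rw [hleft]
            simp [hr]
          rw [this]
          simpa [hr] using h4)
  rw [one_mul] at key
  obtain ⟨h1, h2, h3, h4⟩ := key
  have h5 : keptSet n ((Stm.iter 45 1 p).run n s₁) = ∅ :=
    Finset.eq_empty_of_forall_notMem fun x hx => absurd (h2 x hx) (by omega)
  unfold WalkAt at h1
  rw [h5] at h1 h4
  rw [Finset.sdiff_empty] at h4
  exact ⟨h1, h4⟩

end Prog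

end KMinWP

namespace KMinWP

open Equiv

variable {n m k N : ℕ} {w : Fin n → Fin n → ℝ} {α : ℝ} {a b a' b' : ℕ → ℕ} {i len : ℕ}

/-! ### The choice of the best window -/

/-- The sequence `a` of `N` distinct vertices, which the marks `b` cut into at most `m` pieces. -/
structure IsSeq (n m : ℕ) (a b : ℕ → ℕ) (N : ℕ) : Prop where
  le : N ≤ n
  lt : ∀ p < N, a p < n
  inj : ∀ p < N, ∀ q < N, a p = a q → p = q
  count : segCount b 0 N ≤ m

theorem Walk.isSeq {σ : Perm (Fin n)} {K C : Finset (Fin n)} (h : Walk σ K C a b N)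
    (hm : segCount b 0 N ≤ m) : IsSeq n m a b N where
  le := by
    have := h.card
    have := (Finset.card_le_univ K).trans_eq (Fintype.card_fin n)
    omega
  lt p hp := by
    obtain ⟨x, -, -, hx⟩ := h.mem p hp
    simp [hx]
  inj := h.inj
  count := hm

theorem IsSeq.window (h : IsSeq n m a b N) (hi : i + len ≤ N) (ha : ∀ p < len, a' p = a (i + p))
    (hb : ∀ p < len, b' p = b (i + p)) : IsSeq n m a' b' len where
  le := by have := h.le; omega
  lt p hp := by rw [ha p hp]; exact h.lt _ (by omega)
  inj p hp q hq := by
    rw [ha p hp, ha q hq]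
    intro h'
    have := h.inj _ (by omega) _ (by omega) h'
    omega
  count := by
    rw [segCount_congr (b' := b) (t := i) fun q hq => by rw [zero_add, hb q hq]]
    exact (segCount_le hi).trans h.count

theorem segCost_congr (W : ℕ → ℕ → ℝ) (ha : ∀ p < len, a' p = a (i + p))
    (hb : ∀ p < len, b' p = b (i + p)) : segCost W a' b' 0 len = segCost W a b i len := by
  refine Finset.sum_congr rfl fun q hq => ?_
  rw [Finset.mem_range] at hq
  rw [zero_add, hb q hq]
  by_cases hq0 : q = 0
  · simp [hq0]
  · rw [ha q hq, ha (q - 1) (by omega), Nat.add_sub_assoc (by omega)]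

/-- The score `v` of a window of length `len` and weight `x`. -/
def IsScore (m k : ℕ) (α x : ℝ) (len : ℕ) (v : ℝ) : Prop :=
  (k ≤ len ∧ v = x / 4) ∨ (len < k ∧ α * k ≤ len ∧ m ≤ len ∧ v = x)

theorem IsScore.unique {x v v' : ℝ} (h : IsScore m k α x len v) (h' : IsScore m k α x len v') :
    v = v' := by
  rcases h with ⟨h1, rfl⟩ | ⟨h1, -, -, rfl⟩ <;> rcases h' with ⟨h2, rfl⟩ | ⟨h2, -, -, rfl⟩
  all_goals first | rfl | omega

/-- A window of score `z`. -/
structure Cand (w : Fin n → Fin n → ℝ) (m k : ℕ) (α : ℝ) (a b : ℕ → ℕ) (len : ℕ) (z : ℝ) :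
    Prop where
  isSeq : IsSeq n m a b len
  score : IsScore m k α (segCost (natWeight w) a b 0 len) len z

/-! ### The search for the best window in memory -/

namespace Prog

open Stm

variable {s₀ s s' : Memory} {D : ℕ → ℕ → Prop}

/-- The state of the search for the best window: the windows in `D` have been considered. -/
structure BestAt (s₀ s : Memory) (w : Fin n → Fin n → ℝ) (m k : ℕ) (α : ℝ) (a b : ℕ → ℕ)
    (D : ℕ → ℕ → Prop) : Prop where
  cand : s.nat 22 0 0 ≠ 0 →
    Cand w m k α (fun p => s.nat 19 p 0) (fun p => s.nat 20 p 0) (s.nat 21 0 0) (s.real 11 0 0)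
  mono : s₀.nat 22 0 0 ≠ 0 → s.nat 22 0 0 ≠ 0 ∧ s.real 11 0 0 ≤ s₀.real 11 0 0
  le : ∀ i len v, D i len → IsScore m k α (segCost (natWeight w) a b i len) len v →
    s.nat 22 0 0 ≠ 0 ∧ s.real 11 0 0 ≤ v

theorem BestAt.congr (h : BestAt s₀ s w m k α a b D) (hN : ∀ a ∈ [19, 20, 21, 22], s'.nat a = s.nat a)
    (hR : s'.real 11 = s.real 11) : BestAt s₀ s' w m k α a b D where
  cand := by
    rw [hN 19 (by simp), hN 20 (by simp), hN 21 (by simp), hN 22 (by simp), hR]; exact h.cand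
  mono := by rw [hN 22 (by simp), hR]; exact h.mono
  le := by rw [hN 22 (by simp), hR]; exact h.le

theorem BestAt.subset {D' : ℕ → ℕ → Prop} (h : BestAt s₀ s w m k α a b D)
    (hD : ∀ i len, D' i len → D i len) : BestAt s₀ s w m k α a b D' where
  cand := h.cand
  mono := h.mono
  le i len v h' := h.le i len v (hD i len h')

theorem copyBest_spec (hn : len ≤ n) (hi : s.nat 47 0 0 = i) :
    ∀ p < len, (copyBest.run n s).nat 19 p 0 = s.nat 17 (i + p) 0 ∧
      (copyBest.run n s).nat 20 p 0 = s.nat 18 (i + p) 0 := by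
  have key := run_iter (n := n) (v := 49) (c := 1) (s := s)
    (p := .seq (.setN 19 (var 49) (.const 0) (vec 17 (.add (var 47) (var 49))))
      (.setN 20 (var 49) (.const 0) (vec 18 (.add (var 47) (var 49)))))
    (fun j s' => ∀ p < j, s'.nat 19 p 0 = s.nat 17 (i + p) 0 ∧ s'.nat 20 p 0 = s.nat 18 (i + p) 0)
    (fun i s' j h => by simpa using h) (by simp) (by
      intro j s' hj hN hR hv h p hp
      have h17 := hN 17 (by simp) (by simp [natWrites])
      have h18 := hN 18 (by simp) (by simp [natWrites])
      have h47 := hN 47 (by simp) (by simp [natWrites])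
      by_cases hpj : p = j
      · simp [hv, hpj, h17, h18, h47, hi]
      · simpa [hv, hpj] using h p (by omega))
  exact fun p hp => key p (by omega)

theorem scoreS_spec {x : ℝ} (h1 : s.nat 1 0 0 = m) (h2 : s.nat 2 0 0 = k)
    (h8 : s.real 8 0 0 = α * k) (h9 : s.real 9 0 0 = x) (h10 : s.real 10 0 0 = len)
    (hlen : s.nat 48 0 0 + 1 - s.nat 47 0 0 = len) :
    ((scoreS.run n s).nat 23 0 0 = 1 ∧ IsScore m k α x len ((scoreS.run n s).real 12 0 0)) ∨
      ((scoreS.run n s).nat 23 0 0 ≠ 1 ∧ ∀ v, ¬ IsScore m k α x len v) := by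
  simp only [scoreS, run_seq, run_ite]
  split_ifs with hc hc'
  · simp [h2, hlen] at hc
    refine .inl ⟨by simp, .inl ⟨hc, ?_⟩⟩
    simp [h9]
    ring
  · simp [h1, h2, hlen, h8, h10] at hc hc'
    exact .inl ⟨by simp, .inr ⟨hc, hc'.1, hc'.2, by simp [h9]⟩⟩
  · simp [h1, h2, hlen, h8, h10] at hc hc'
    refine .inr ⟨by simp, fun v hv => ?_⟩
    rcases hv with ⟨h, -⟩ | ⟨h, h', h'', -⟩
    · omega
    · have := hc' h'
      omega

/-- The window is copied, not just referenced, because the sequence is overwritten when the next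
potential is tried. -/
theorem updateBest_spec {D' : ℕ → ℕ → Prop} (h : BestAt s₀ s w m k α a b D) (hs : IsSeq n m a b N)
    (ha : ∀ p, s.nat 17 p 0 = a p) (hb : ∀ p, s.nat 18 p 0 = b p) (hN : i + len ≤ N)
    (hi : s.nat 47 0 0 = i) (hlen : s.nat 48 0 0 + 1 - s.nat 47 0 0 = len)
    (hsc : (s.nat 23 0 0 = 1 ∧ IsScore m k α (segCost (natWeight w) a b i len) len (s.real 12 0 0)) ∨
      (s.nat 23 0 0 ≠ 1 ∧ ∀ v, ¬ IsScore m k α (segCost (natWeight w) a b i len) len v))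
    (hD' : ∀ i' len', D' i' len' → D i' len' ∨ (i' = i ∧ len' = len)) :
    BestAt s₀ (updateBest.run n s) w m k α a b D' := by
  have hln : len ≤ n := by have := hs.le; omega
  rw [updateBest, run_ite]
  split_ifs with hc
  · simp at hc
    obtain ⟨hc1, hc2⟩ := hc
    have hsc' := hsc.resolve_right fun h => h.1 hc1
    simp only [run_seq, run_setR, run_setN]
    set s₁ := (((s.writeReal 11 _ _ _).writeNat 22 _ _ _).writeNat 21 _ _ _) with hs₁
    have hcopy := copyBest_spec (n := n) (s := s₁) (i := i) hln (by simp [hs₁, hi])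
    have hcN : ∀ a, a ∉ [49, 19, 20] → (copyBest.run n s₁).nat a = s₁.nat a := fun a ha =>
      run_nat_of_notMem _ _ (by simpa [copyBest, natWrites] using ha)
    have hcR : ∀ a, (copyBest.run n s₁).real a = s₁.real a := fun a =>
      run_real_of_notMem _ _ (by simp [copyBest, realWrites])
    have e17 : ∀ p, s₁.nat 17 p 0 = a p := fun p => by simp [hs₁, ha]
    have e18 : ∀ p, s₁.nat 18 p 0 = b p := fun p => by simp [hs₁, hb]
    have e21 : (copyBest.run n s₁).nat 21 0 0 = len := by
      rw [hcN 21 (by simp)]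
      simp [hs₁, hlen]
    have e22 : (copyBest.run n s₁).nat 22 0 0 = 1 := by
      rw [hcN 22 (by simp)]
      simp [hs₁]
    have e11 : (copyBest.run n s₁).real 11 0 0 = s.real 12 0 0 := by
      rw [hcR 11]
      simp [hs₁]
    simp only [e17, e18] at hcopy
    refine ⟨fun _ => ?_, fun h0 => ?_, fun i' len' v hD hv => ?_⟩
    · rw [e21, e11]
      refine ⟨hs.window hN (fun p hp => (hcopy p hp).1) fun p hp => (hcopy p hp).2, ?_⟩
      rw [segCost_congr _ (fun p hp => (hcopy p hp).1) fun p hp => (hcopy p hp).2]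
      exact hsc'.2
    · rw [e22, e11]
      obtain ⟨h3, h4⟩ := h.mono h0
      exact ⟨by simp, (hc2 h3).le.trans h4⟩
    · rw [e22, e11]
      refine ⟨by simp, ?_⟩
      rcases hD' i' len' hD with hD | ⟨rfl, rfl⟩
      · obtain ⟨h3, h4⟩ := h.le i' len' v hD hv
        exact (hc2 h3).le.trans h4
      · exact (hsc'.2.unique hv).le
  · simp at hc
    rw [run_skip]
    refine ⟨h.cand, h.mono, fun i' len' v hD hv => ?_⟩
    rcases hD' i' len' hD with hD | ⟨rfl, rfl⟩
    · exact h.le i' len' v hD hv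
    · rcases hsc with ⟨h3, h4⟩ | ⟨h3, h4⟩
      · rw [← h4.unique hv]
        exact hc h3
      · exact absurd hv (h4 v)

/-- The windows that have been considered when the one from `i` to `e` is next. -/
def Seen (N i e i' len' : ℕ) : Prop := 1 ≤ len' ∧ i' + len' ≤ N ∧ (i' < i ∨ (i' = i ∧ i' + len' ≤ e))

/-- For a fixed start the window is extended vertex by vertex, so its weight is updated by one
addition. Its length is also counted as a real number, for comparison with `α * k`. -/
theorem windowS_spec (hs : IsSeq n m (fun p => s.nat 17 p 0) (fun p => s.nat 18 p 0) (s.nat 16 0 0))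
    (h1 : s.nat 1 0 0 = m) (h2 : s.nat 2 0 0 = k) (h8 : s.real 8 0 0 = α * k)
    (hw : s.real 0 = natWeight w)
    (hc : s.nat 22 0 0 ≠ 0 →
      Cand w m k α (fun p => s.nat 19 p 0) (fun p => s.nat 20 p 0) (s.nat 21 0 0) (s.real 11 0 0)) :
    BestAt s (windowS.run n s) w m k α (fun p => s.nat 17 p 0) (fun p => s.nat 18 p 0)
      (fun i len => 1 ≤ len ∧ i + len ≤ s.nat 16 0 0) := by
  set a : ℕ → ℕ := fun p => s.nat 17 p 0 with ha
  set b : ℕ → ℕ := fun p => s.nat 18 p 0 with hb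
  set N := s.nat 16 0 0 with hN
  set body : Stm := .ite (.and (.nle (var 47) (var 48)) (.nle (.add (var 48) (.const 1)) (var 16)))
      (.seq extendS (.seq scoreS updateBest)) .skip with hbody
  set p : Stm := .seq (setRvar 9 (.const 0)) (.seq (setRvar 10 (.const 0)) (.iter 48 1 body)) with hp
  have hbN : body.natWrites = [23, 23, 23, 22, 21, 49, 19, 20] := rfl
  have hbR : body.realWrites = [9, 10, 12, 12, 11] := rfl
  have hpN : p.natWrites = [48, 23, 23, 23, 22, 21, 49, 19, 20] := rfl
  have hpR : p.realWrites = [9, 10, 9, 10, 12, 12, 11] := rfl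
  have key := run_iter (n := n) (v := 47) (c := 1) (p := p) (s := s)
    (fun i s' => BestAt s s' w m k α a b (Seen N i 0))
    (fun i s' j h => h.congr (by simp) (by simp))
    ⟨hc, fun h => ⟨h, le_rfl⟩, fun i len v h => by unfold Seen at h; omega⟩
    (by
      intro i s' hi hfN hfR hv h
      set s₁ := (s'.writeReal 9 0 0 0).writeReal 10 0 0 0 with hs₁
      have hrun : p.run n s' = (Stm.iter 48 1 body).run n s₁ := by
        simp [hp, hs₁]
      rw [hrun]
      have key := run_iter (n := n) (v := 48) (c := 1) (p := body) (s := s₁)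
        (fun e s'' => BestAt s s'' w m k α a b (Seen N i e) ∧
          -- The truncated difference is zero until `e` passes the start `i`, and it stays constant
          -- once `e` has passed the end `N` of the sequence.
          s''.real 9 0 0 = segCost (natWeight w) a b i (min e N - i) ∧
          s''.real 10 0 0 = ((min e N - i : ℕ) : ℝ))
        (fun i s'' j h => ⟨h.1.congr (by simp) (by simp), by simpa using h.2⟩)
        ⟨h.congr (by simp [hs₁]) (by simp [hs₁]), by simp [hs₁, segCost], by simp [hs₁]⟩
        (by
          rintro e s'' he hfN' hfR' hv' ⟨g1, g2, g3⟩
          have hNN : ∀ a, a ∉ [47, 48, 23, 22, 21, 49, 19, 20] → s''.nat a = s.nat a := fun a ha => by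
            simp only [List.mem_cons, not_or] at ha
            rw [hfN' a (by simp [ha]) (by simp [hbN, ha]), hs₁]
            simp only [Memory.nat_writeReal]
            rw [hfN a (by simp [ha]) (by simp [hpN, ha])]
          have hRR : ∀ a, a ∉ [9, 10, 11, 12] → s''.real a = s.real a := fun a ha => by
            simp only [List.mem_cons, not_or] at ha
            rw [hfR' a (by simp [hbR, ha]), hs₁]
            simp only [Memory.real_writeReal_of_ne ha.1, Memory.real_writeReal_of_ne ha.2.1]
            rw [hfR a (by simp [hpR, ha])]
          have e47 : s''.nat 47 0 0 = i := by
            rw [hfN' 47 (by simp) (by simp [hbN]), hs₁]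
            simpa using hv
          have e16 : s''.nat 16 0 0 = N := by rw [hNN 16 (by simp)]
          have e17 : ∀ p, s''.nat 17 p 0 = a p := fun p => by rw [hNN 17 (by simp)]
          have e18 : ∀ p, s''.nat 18 p 0 = b p := fun p => by rw [hNN 18 (by simp)]
          rw [hbody, run_ite]
          split_ifs with hcond
          · simp [e47, hv', e16] at hcond
            obtain ⟨hie, heN⟩ := hcond
            have hmin : min e N - i = e - i := by omega
            have hmin' : min (e + 1) N - i = (e - i) + 1 := by omega
            rw [hmin] at g2 g3
            rw [hmin']
            set s₂ := extendS.run n s'' with hs₂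
            have x9 : s₂.real 9 0 0 = segCost (natWeight w) a b i ((e - i) + 1) := by
              rw [segCost_succ, ← g2, Nat.add_sub_cancel' hie]
              rw [hs₂, extendS, run_seq, run_ite]
              by_cases hb0 : e - i = 0 ∨ b e = 0
              · rw [if_neg (by simp [e47, hv', e18]; omega), if_pos hb0]
                simp
              · rw [if_pos (by simp [e47, hv', e18]; omega), if_neg hb0]
                simp [hv', e17, hRR 0, hw]
            have x10 : s₂.real 10 0 0 = (((e - i) + 1 : ℕ) : ℝ) := by
              rw [hs₂, extendS, run_seq, run_ite]
              push_cast
              rw [← g3]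
              split_ifs <;> simp
            have xN : ∀ a, s₂.nat a = s''.nat a := fun a =>
              run_nat_of_notMem _ _ (by simp [extendS, natWrites])
            have xR : ∀ a, a ∉ [9, 10] → s₂.real a = s''.real a := fun a ha =>
              run_real_of_notMem _ _ (by simpa [extendS, realWrites] using ha)
            have hlen : s₂.nat 48 0 0 + 1 - s₂.nat 47 0 0 = (e - i) + 1 := by
              rw [xN, xN, hv', e47]; omega
            have hsc := scoreS_spec (n := n) (s := s₂) (m := m) (k := k) (α := α)
              (by rw [xN, hNN 1 (by simp), h1]) (by rw [xN, hNN 2 (by simp), h2])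
              (by rw [xR 8 (by simp), hRR 8 (by simp), h8]) x9 x10 hlen
            have yN : ∀ a, a ≠ 23 → (scoreS.run n s₂).nat a = s''.nat a := fun a ha => by
              rw [run_nat_of_notMem _ _ (by simpa [scoreS, natWrites] using ha), xN]
            have yR : ∀ a, a ≠ 12 → (scoreS.run n s₂).real a = s₂.real a := fun a ha =>
              run_real_of_notMem _ _ (by simpa [scoreS, realWrites] using ha)
            simp only [run_seq]
            rw [← hs₂]
            set s₃ := scoreS.run n s₂ with hs₃
            have zR : ∀ a, a ≠ 11 → (updateBest.run n s₃).real a = s₃.real a := fun a ha =>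
              run_real_of_notMem _ _ (by simpa [updateBest, realWrites, copyBest] using ha)
            refine ⟨?_, ?_, ?_⟩
            · refine updateBest_spec (i := i) (len := (e - i) + 1)
                (g1.congr (s' := s₃) (fun a ha => yN a (by rintro rfl; simp at ha))
                  (by rw [yR 11 (by simp), xR 11 (by simp)])) hs
                (fun p => by rw [yN 17 (by simp), e17]) (fun p => by rw [yN 18 (by simp), e18])
                (by omega) (by rw [yN 47 (by simp), e47]) ?_ hsc ?_
              · rw [yN 48 (by simp), yN 47 (by simp), ← xN, ← xN 47, hlen]
              · unfold Seen
                intro i' len' h'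
                omega
            · rw [zR 9 (by simp), yR 9 (by simp), x9]
            · rw [zR 10 (by simp), yR 10 (by simp), x10]
          · simp [e47, hv', e16] at hcond
            have hmin : min (e + 1) N - i = min e N - i := by
              by_cases h : i ≤ e
              · have := hcond h; omega
              · omega
            rw [run_skip, hmin]
            refine ⟨g1.subset fun i' len' h' => ?_, g2, g3⟩
            unfold Seen at h' ⊢
            by_cases h : i ≤ e
            · have := hcond h; omega
            · omega)
      refine key.1.subset fun i' len' h' => ?_
      have := hs.le
      unfold Seen at h' ⊢
      omega)
  refine key.subset fun i' len' h' => ?_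
  have := hs.le
  unfold Seen
  omega

end Prog

end KMinWP

namespace KMinWP

variable {n m k N : ℕ} {w : Fin n → Fin n → ℝ} {α : ℝ} {a b : ℕ → ℕ}

/-! ### Splitting a window into paths -/

/-- The first `q` entries of the sequence `a` of length `len` have been distributed to `g` paths. -/
structure Split (w : Fin n → Fin n → ℝ) (m len : ℕ) (a b : ℕ → ℕ) (q g : ℕ)
    (P : ℕ → List (Fin n)) : Prop where
  ne : ∀ i < g, P i ≠ []
  nodup : ∀ i < g, (P i).Nodup
  disj : ∀ i < g, ∀ j < g, i ≠ j → (P i).Disjoint (P j)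
  mem : ∀ i < g, ∀ x ∈ P i, ∃ r < q, a r = x
  length : ∑ i ∈ Finset.range g, (P i).length = q
  last : 0 < q → 0 < g ∧ ∃ (l : List (Fin n)) (x : Fin n), P (g - 1) = l ++ [x] ∧ a (q - 1) = x
  weight : ∑ i ∈ Finset.range g, pathWeight w (P i) ≤ segCost (natWeight w) a b 0 q
  lower : m ≤ g + (len - q)
  upper : g ≤ segCount b 0 q ∨ g + (len - q) = m

section Split

variable {len q g : ℕ} {P : ℕ → List (Fin n)} {x : Fin n}

theorem Split.init (hm : m ≤ len) (P : ℕ → List (Fin n)) : Split w m len a b 0 0 P where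
  ne := by simp
  nodup := by simp
  disj := by simp
  mem := by simp
  length := by simp
  last := by simp
  weight := by simp [segCost]
  lower := by simpa using hm
  upper := by simp

theorem Split.notMem (h : Split w m len a b q g P) (hs : IsSeq n m a b len) (hq : q < len)
    (hx : a q = x) {i : ℕ} (hi : i < g) : x ∉ P i := fun h' => by
  obtain ⟨r, hr, hr'⟩ := h.mem i hi x h'
  have := hs.inj q hq r (by omega) (by rw [hx, hr'])
  omega

/-- A new path is opened at a cut mark, or when the remaining vertices are only just enough to reach
`m` paths. In the latter case `g + (len - q) = m`, which persists, so every further vertex becomes a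
path of its own. -/
theorem Split.start (h : Split w m len a b q g P) (hs : IsSeq n m a b len) (hw : IsMetric w)
    (hq : q < len) (hx : a q = x) (hb : q = 0 ∨ b q = 0 ∨ g + (len - q) ≤ m) :
    Split w m len a b (q + 1) (g + 1) (Function.update P g [x]) := by
  have hP : ∀ i < g, Function.update P g [x] i = P i := fun i hi =>
    Function.update_of_ne (by omega) _ _
  have hPg : Function.update P g [x] g = [x] := Function.update_self _ _ _
  have hcases : ∀ i < g + 1, i < g ∨ i = g := fun i hi => by omega
  refine ⟨fun i hi => ?_, fun i hi => ?_, fun i hi j hj hij => ?_, fun i hi y hy => ?_, ?_,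
    fun _ => ⟨by omega, [], x, by simp, by simpa using hx⟩, ?_, ?_, ?_⟩
  · rcases hcases i hi with hi | rfl
    · rw [hP i hi]; exact h.ne i hi
    · simp
  · rcases hcases i hi with hi | rfl
    · rw [hP i hi]; exact h.nodup i hi
    · simp
  · rcases hcases i hi with hi | rfl <;> rcases hcases j hj with hj | rfl
    · rw [hP i hi, hP j hj]; exact h.disj i hi j hj hij
    · rw [hP i hi, hPg]
      simpa using h.notMem hs hq hx hi
    · rw [hP j hj, hPg]
      simpa using h.notMem hs hq hx hj
    · exact absurd rfl hij
  · rcases hcases i hi with hi | rfl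
    · rw [hP i hi] at hy
      obtain ⟨r, hr, hr'⟩ := h.mem i hi y hy
      exact ⟨r, by omega, hr'⟩
    · rw [hPg, List.mem_singleton] at hy
      exact ⟨q, by omega, by rw [hx, hy]⟩
  · rw [Finset.sum_range_succ, hPg, Finset.sum_congr rfl fun i hi => by
      rw [hP i (Finset.mem_range.1 hi)], h.length]
    rfl
  · rw [Finset.sum_range_succ, hPg, Finset.sum_congr rfl fun i hi => by
      rw [hP i (Finset.mem_range.1 hi)]]
    simp only [pathWeight, add_zero]
    exact h.weight.trans (segCost_mono (natWeight_nonneg hw) 0 (Nat.le_succ q))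
  · have := h.lower; omega
  · rw [segCount_succ, zero_add]
    have := h.lower
    rcases h.upper with hu | hu
    · by_cases hb' : q = 0 ∨ b q = 0
      · rw [if_pos hb']; omega
      · right; omega
    · right; omega

theorem pathWeight_append_pair (w : Fin n → Fin n → ℝ) (l : List (Fin n)) (x y : Fin n) :
    pathWeight w (l ++ [x] ++ [y]) = pathWeight w (l ++ [x]) + w x y := by
  induction l using pathWeight.induct with
  | case1 => simp [pathWeight]
  | case2 u => simp [pathWeight]
  | case3 u v l ih =>
    simp only [List.cons_append, pathWeight] at ih ⊢
    rw [ih, add_assoc]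

/-- Spending a vertex without opening a path is safe, as more vertices remain than are needed for
`m` paths; and the added edge is one that `segCost` counts. -/
theorem Split.extend (h : Split w m len a b q g P) (hs : IsSeq n m a b len)
    (hq : q < len) (hx : a q = x) (hb : ¬ (q = 0 ∨ b q = 0 ∨ g + (len - q) ≤ m)) :
    0 < g ∧ Split w m len a b (q + 1) g (Function.update P (g - 1) (P (g - 1) ++ [x])) := by
  push Not at hb
  obtain ⟨hb1, hb2, hb3⟩ := hb
  obtain ⟨hg, l, y, hl, hy⟩ := h.last (by omega)
  refine ⟨hg, ?_⟩
  obtain ⟨g, rfl⟩ : ∃ g', g = g' + 1 := ⟨g - 1, by omega⟩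
  rw [Nat.add_sub_cancel] at hl ⊢
  have hP : ∀ i, i ≠ g → Function.update P g (P g ++ [x]) i = P i := fun i hi =>
    Function.update_of_ne hi _ _
  have hPg : Function.update P g (P g ++ [x]) g = P g ++ [x] := Function.update_self _ _ _
  refine ⟨fun i hi => ?_, fun i hi => ?_, fun i hi j hj hij => ?_, fun i hi z hz => ?_, ?_,
    fun _ => ⟨hg, P g, x, by simp, by simpa using hx⟩, ?_, ?_, ?_⟩
  · by_cases hig : i = g
    · simp [hig]
    · rw [hP i hig]; exact h.ne i hi
  · by_cases hig : i = g
    · subst hig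
      rw [hPg, List.nodup_append]
      refine ⟨h.nodup i hi, by simp, fun z hz z' hz' => ?_⟩
      rw [List.mem_singleton] at hz'
      rintro rfl
      exact h.notMem hs hq hx hi (hz' ▸ hz)
    · rw [hP i hig]; exact h.nodup i hi
  · by_cases hig : i = g
    · subst hig
      rw [hPg, hP j hij.symm, List.disjoint_append_left]
      exact ⟨h.disj i hi j hj hij, by simpa using h.notMem hs hq hx hj⟩
    · by_cases hjg : j = g
      · subst hjg
        rw [hPg, hP i hig, List.disjoint_append_right]
        exact ⟨h.disj i hi j hj hij, by simpa using h.notMem hs hq hx hi⟩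
      · rw [hP i hig, hP j hjg]; exact h.disj i hi j hj hij
  · by_cases hig : i = g
    · subst hig
      rw [hPg, List.mem_append, List.mem_singleton] at hz
      rcases hz with hz | rfl
      · obtain ⟨r, hr, hr'⟩ := h.mem i hi z hz
        exact ⟨r, by omega, hr'⟩
      · exact ⟨q, by omega, hx⟩
    · rw [hP i hig] at hz
      obtain ⟨r, hr, hr'⟩ := h.mem i hi z hz
      exact ⟨r, by omega, hr'⟩
  · have := h.length
    rw [Finset.sum_range_succ] at this
    rw [Finset.sum_range_succ, hPg, Finset.sum_congr rfl fun i hi => by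
      rw [hP i (Finset.mem_range.1 hi).ne]]
    simp only [List.length_append, List.length_singleton]
    omega
  · have := h.weight
    rw [Finset.sum_range_succ] at this
    rw [Finset.sum_range_succ, hPg, Finset.sum_congr rfl fun i hi => by
      rw [hP i (Finset.mem_range.1 hi).ne], segCost_succ, zero_add, if_neg (by tauto), hx, hy,
      natWeight_val, hl, pathWeight_append_pair, ← hl]
    linarith
  · omega
  · rcases h.upper with hu | hu
    · rw [segCount_succ]
      left; omega
    · omega

end Split

/-! ### Writing the output paths -/

namespace Prog

open Stm

variable {s s' : Memory} {len : ℕ} {z : ℝ}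

theorem outputS_spec (hw : IsMetric w) (h1 : s.nat 1 0 0 = m) (hlen : s.nat 21 0 0 = len)
    (hm : m ≤ len) (hs : IsSeq n m (fun p => s.nat 19 p 0) (fun p => s.nat 20 p 0) len) :
    ∃ P : Fin m → List (Fin n), IsOutput (outputS.run n s) P ∧ IsPathSystem P ∧
      (spanned P).card = len ∧
      totalWeight w P ≤ segCost (natWeight w) (fun p => s.nat 19 p 0) (fun p => s.nat 20 p 0) 0 len := by
  set a : ℕ → ℕ := fun p => s.nat 19 p 0 with ha
  set b : ℕ → ℕ := fun p => s.nat 20 p 0 with hb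
  rw [outputS, run_seq, run_setN]
  set s₁ := s.writeNat 25 _ _ _ with hs₁
  have hpN : outputBody.natWrites = [3, 25, 4, 3] := rfl
  have key := run_iter (n := n) (v := 41) (c := 1) (p := outputBody) (s := s₁)
    (fun q s' => ∃ P : ℕ → List (Fin n), Split w m len a b (min q len) (s'.nat 25 0 0) P ∧
      ∀ i < s'.nat 25 0 0, (List.range (s'.nat 3 i 0)).map (fun j => s'.nat 4 i j) =
        (P i).map Fin.val)
    (fun i s' j h => by simpa using h)
    ⟨fun _ => [], by simpa [hs₁] using Split.init hm _, by simp [hs₁]⟩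
    (by
      rintro q s' hq hN hR hv ⟨P, hP, hout⟩
      have hN' : ∀ a, a ∉ [41, 25, 3, 4] → s'.nat a = s.nat a := fun a ha => by
        simp only [List.mem_cons, not_or] at ha
        rw [hN a ha.1 (by simp [hpN, ha])]
        simp [hs₁, ha]
      have e1 : s'.nat 1 0 0 = m := by rw [hN' 1 (by simp), h1]
      have e21 : s'.nat 21 0 0 = len := by rw [hN' 21 (by simp), hlen]
      have e19 : ∀ p, s'.nat 19 p 0 = a p := fun p => by rw [hN' 19 (by simp)]
      have e20 : ∀ p, s'.nat 20 p 0 = b p := fun p => by rw [hN' 20 (by simp)]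
      rw [outputBody, run_ite]
      split_ifs with hc
      · simp [hv, e21] at hc
        rw [min_eq_left (by omega)] at hP
        rw [min_eq_left (by omega : q + 1 ≤ len)]
        obtain ⟨x, hx⟩ : ∃ x : Fin n, a q = x := ⟨⟨a q, hs.lt q (by omega)⟩, rfl⟩
        rw [run_seq, run_ite]
        set g := s'.nat 25 0 0 with hg
        have hcond : Test.Holds s' (orTest (eqTest (var 41) (.const 0))
            (orTest (eqTest (vec 20 (var 41)) (.const 0))
              (.nle (.add (var 25) (.sub (var 21) (var 41))) (var 1)))) ↔
            (q = 0 ∨ b q = 0 ∨ g + (len - q) ≤ m) := by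
          simp [hv, e20, e21, e1, ← hg]
          omega
        split_ifs with hb'
        · rw [hcond] at hb'
          have hrun : ∀ t, t = (((s'.writeNat 3 g 0 0).writeNat 25 0 0 (g + 1)).writeNat 4 g 0
              x).writeNat 3 g 0 1 → ∃ P : ℕ → List (Fin n),
              Split w m len a b (q + 1) (t.nat 25 0 0) P ∧ ∀ i < t.nat 25 0 0,
                (List.range (t.nat 3 i 0)).map (fun j => t.nat 4 i j) = (P i).map Fin.val := by
            rintro t rfl
            refine ⟨_, by simpa using hP.start hs hw hc hx hb', fun i hi => ?_⟩
            by_cases hig : i = g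
            · subst hig
              simp [List.range_succ]
            · have : i < g := by simp at hi; omega
              simpa [hig] using hout i this
          refine hrun _ ?_
          simp [hv, e19, hx, ← hg]
        · rw [hcond] at hb'
          obtain ⟨hg0, hP'⟩ := hP.extend hs hc hx hb'
          have hlast := hout (g - 1) (by omega)
          have hrun : ∀ t, t = (s'.writeNat 4 (g - 1) (s'.nat 3 (g - 1) 0) x).writeNat 3 (g - 1) 0
              (s'.nat 3 (g - 1) 0 + 1) → ∃ P : ℕ → List (Fin n),
              Split w m len a b (q + 1) (t.nat 25 0 0) P ∧ ∀ i < t.nat 25 0 0,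
                (List.range (t.nat 3 i 0)).map (fun j => t.nat 4 i j) = (P i).map Fin.val := by
            rintro t rfl
            refine ⟨_, by simpa using hP', fun i hi => ?_⟩
            by_cases hig : i = g - 1
            · subst hig
              simp only [Memory.nat_writeNat_self, Function.update_self, List.map_append, ← hlast]
              simp [List.range_succ]
              intro j hj
              omega
            · have : i < g := by simpa using hi
              simpa [hig] using hout i this
          refine hrun _ ?_
          simp [hv, e19, hx, ← hg]
      · simp [hv, e21] at hc
        rw [run_skip]
        rw [min_eq_right hc] at hP
        rw [min_eq_right (by omega : len ≤ q + 1)]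
        exact ⟨P, hP, hout⟩)
  obtain ⟨P, hP, hout⟩ := key
  rw [one_mul, min_eq_right hs.le] at hP
  set t := (Stm.iter 41 1 outputBody).run n s₁ with ht
  -- With no vertices left, `lower` says `m ≤ g`, and `upper` says `g = m` or that `g` is at most
  -- the number of pieces, which is at most `m`.
  have hg : t.nat 25 0 0 = m := by
    have h2 := hP.lower
    have h3 := hs.count
    rcases hP.upper with h4 | h4 <;> omega
  rw [hg] at hP hout
  have hsys : IsPathSystem fun i : Fin m => P i :=
    ⟨fun i => hP.ne i i.2, fun i => hP.nodup i i.2, fun i j hij =>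
      hP.disj i i.2 j j.2 fun h => hij (Fin.ext h)⟩
  refine ⟨fun i => P i, fun i => hout i i.2, hsys, ?_, ?_⟩
  · rw [hsys.card_spanned, Fin.sum_univ_eq_sum_range (fun i => (P i).length), hP.length]
  · rw [totalWeight, Fin.sum_univ_eq_sum_range (fun i => pathWeight w (P i))]
    exact hP.weight

end Prog

end KMinWP

namespace KMinWP

variable {n m k : ℕ} {w : Fin n → Fin n → ℝ} {α lam : ℝ}

/-! ### Correctness of the program -/

namespace Prog

open Stm

variable {s s' : Memory}

/-- The memory holds the input and the product of `α` and `k`. -/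
structure InputAt (s : Memory) (w : Fin n → Fin n → ℝ) (m k : ℕ) (α : ℝ) : Prop where
  n_eq : s.nat 0 0 0 = n
  m_eq : s.nat 1 0 0 = m
  k_eq : s.nat 2 0 0 = k
  w_eq : s.real 0 = natWeight w
  threshold : s.real 8 0 0 = α * k

theorem InputAt.congr (h : InputAt s w m k α) (hN : ∀ a ∈ [0, 1, 2], s'.nat a = s.nat a)
    (hR : ∀ a ∈ [0, 8], s'.real a = s.real a) : InputAt s' w m k α where
  n_eq := by rw [hN 0 (by simp), h.n_eq]
  m_eq := by rw [hN 1 (by simp), h.m_eq]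
  k_eq := by rw [hN 2 (by simp), h.k_eq]
  w_eq := by rw [hR 0 (by simp), h.w_eq]
  threshold := by rw [hR 8 (by simp), h.threshold]

/-- The stored best window, if there is one, is a window of the stored score. -/
def CandAt (s : Memory) (w : Fin n → Fin n → ℝ) (m k : ℕ) (α : ℝ) : Prop :=
  s.nat 22 0 0 ≠ 0 →
    Cand w m k α (fun p => s.nat 19 p 0) (fun p => s.nat 20 p 0) (s.nat 21 0 0) (s.real 11 0 0)

/-- The stored best score is at most the scores for the potential `lam`. -/
def Beats (s : Memory) (w : Fin n → Fin n → ℝ) (m k : ℕ) (α lam : ℝ) : Prop :=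
  ∀ z, (s.nat 22 0 0 ≠ 0 → z ≤ s.real 11 0 0) → Beaten w m k α lam z

/-- The best score only decreases, so what was shown after one potential stays valid for the rest of
the search. -/
theorem Beats.mono (h : Beats s w m k α lam)
    (hs : s.nat 22 0 0 ≠ 0 → s'.nat 22 0 0 ≠ 0 ∧ s'.real 11 0 0 ≤ s.real 11 0 0) :
    Beats s' w m k α lam := fun z hz => h z fun h0 => (hz (hs h0).1).trans (hs h0).2

/-- Chains the phases. The data in `Beaten` are the length and the weight of the listed sequence,
and the stored best score competes with all of its windows. -/
theorem runS_spec (hw : IsMetric w) (hm : 1 ≤ m) (hmk : m ≤ k) (hkn : k ≤ n) (hlam : 0 ≤ lam)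
    (hI : InputAt s w m k α) (h7 : s.real 7 0 0 = lam) (hc : CandAt s w m k α) :
    CandAt (runS.run n s) w m k α ∧ Beats (runS.run n s) w m k α lam ∧
    (s.nat 22 0 0 ≠ 0 → (runS.run n s).nat 22 0 0 ≠ 0 ∧
      (runS.run n s).real 11 0 0 ≤ s.real 11 0 0) := by
  simp only [runS, run_seq]
  have gN : growS.natWrites = [41, 5, 6, 7, 40, 8, 9, 10, 11, 42, 43, 8, 9, 11, 41, 5, 6, 7, 6, 7, 10,
    7, 41, 5] := rfl
  have gR : growS.realWrites = [3, 4, 5, 6, 6, 6, 5, 3, 4, 3, 4, 4] := rfl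
  have pN : pruneS.natWrites = [41, 12, 13, 44, 40, 14, 23, 41, 23, 14, 13, 13, 41, 12] := rfl
  have pR : pruneS.realWrites = [] := rfl
  have tN : tourS.natWrites = [41, 15, 40, 23, 15, 15] := rfl
  have tR : tourS.realWrites = [] := rfl
  have wN : walkS.natWrites = [16, 45, 24, 46, 17, 18, 12, 16, 24] := rfl
  have wR : walkS.realWrites = [] := rfl
  obtain ⟨R, typ, eu, ev, Δ, H⟩ := growS_spec (by omega) hI.n_eq hI.m_eq
    (fun u v => by rw [hI.w_eq, natWeight_val]) h7
  set s₁ := growS.run n s with hs₁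
  have e₁N : ∀ a, a ∉ growS.natWrites → s₁.nat a = s.nat a := fun a ha => run_nat_of_notMem _ _ ha
  have e₁R : ∀ a, a ∉ growS.realWrites → s₁.real a = s.real a := fun a ha =>
    run_real_of_notMem _ _ ha
  have P := pruneS_spec (by rw [e₁N 0 (by simp [gN]), hI.n_eq]) H hw hlam hm (hmk.trans hkn)
  set s₂ := pruneS.run n s₁ with hs₂
  have e₂N : ∀ a, a ∉ pruneS.natWrites → s₂.nat a = s₁.nat a := fun a ha =>
    run_nat_of_notMem _ _ ha
  have e₂R : ∀ a, s₂.real a = s₁.real a := fun a => run_real_of_notMem _ _ (by simp [pR])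
  have H₂ : HistoryAt s₂ w lam m R typ eu ev Δ := H.congr (fun a ha => e₂N a (by
    intro h; simp only [pN, List.mem_cons, List.not_mem_nil, or_false] at h ha; omega))
    (fun a _ => e₂R a)
  obtain ⟨σ, hσ, T⟩ := tourS_spec H₂ hw P
  set s₃ := tourS.run n s₂ with hs₃
  have e₃N : ∀ a, a ∉ tourS.natWrites → s₃.nat a = s₂.nat a := fun a ha =>
    run_nat_of_notMem _ _ ha
  have e₃R : ∀ a, s₃.real a = s₂.real a := fun a => run_real_of_notMem _ _ (by simp [tR])
  have hK : keptSet n s₃ = keptSet n s₂ := by simp [keptSet, e₃N 12, tN]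
  rw [← hK] at T P
  obtain ⟨W, hpieces⟩ := walkS_spec T hσ
  replace hpieces := hpieces.trans (P.card_image_le H.history hm (hmk.trans hkn))
  set s₄ := walkS.run n s₃ with hs₄
  have eN : ∀ a, a ∈ [0, 1, 2, 19, 20, 21, 22] → s₄.nat a = s.nat a := fun a ha => by
    have hx : ∀ l : List ℕ, (∀ b ∈ l, b ∉ [0, 1, 2, 19, 20, 21, 22]) → a ∉ l :=
      fun l hl h => hl a h ha
    rw [hs₄, run_nat_of_notMem walkS _ (hx _ (by simp [wN])), e₃N a (hx _ (by simp [tN])),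
      e₂N a (hx _ (by simp [pN])), e₁N a (hx _ (by simp [gN]))]
  have eR : ∀ a, a ∈ [0, 8, 11] → s₄.real a = s.real a := fun a ha => by
    have hx : ∀ l : List ℕ, (∀ b ∈ l, b ∉ [0, 8, 11]) → a ∉ l := fun l hl h => hl a h ha
    rw [hs₄, run_real_of_notMem walkS _ (by simp [wR]), e₃R a, e₂R a, e₁R a (hx _ (by simp [gR]))]
  have hI' : InputAt s₄ w m k α := hI.congr (fun a ha => eN a (by simp at ha ⊢; tauto))
    (fun a ha => eR a (by simp at ha ⊢; tauto))
  have hc' : CandAt s₄ w m k α := by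
    unfold CandAt
    rw [eN 19 (by simp), eN 20 (by simp), eN 21 (by simp), eN 22 (by simp), eR 11 (by simp)]
    exact hc
  have hseq := W.isSeq hpieces
  have B := windowS_spec hseq hI'.m_eq hI'.k_eq hI'.threshold hI'.w_eq hc'
  set s₅ := windowS.run n s₄ with hs₅
  refine ⟨B.cand, fun z hz => ?_, fun h0 => ?_⟩
  · set a : ℕ → ℕ := fun p => s₄.nat 17 p 0
    set b : ℕ → ℕ := fun p => s₄.nat 18 p 0
    have hN : s₄.nat 16 0 0 = (keptSet n s₃).card := by simpa using W.card
    have hW := natWeight_nonneg hw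
    have hmN := P.le_card H.history
    rw [← hN] at hmN
    refine ⟨s₄.nat 16 0 0, segCost (natWeight w) a b 0 (s₄.nat 16 0 0), hmN, hseq.le,
      segCost_nonneg hW _ _, fun Q hQ => ?_, fun hkN => ?_, fun hNk hαN => ?_⟩
    -- Sequence at most tours, tours at most twice the forest, forest at most twice the Lagrangian
    -- value: together the factor 4.
    · have h1 := W.segCost_le hw
      have h2 := T.weight
      have h3 := P.cost_le H.history hw hlam hQ
      rw [hN] at h1 ⊢
      linarith
    · obtain ⟨i, hi, hi'⟩ := exists_segCost_le (a := a) (b := b) hW (hm.trans hmk) hkN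
      obtain ⟨h1, h2⟩ := B.le i k _ ⟨hm.trans hmk, hi⟩ (.inl ⟨le_rfl, rfl⟩)
      have h3 := (hz h1).trans h2
      calc z * (4 * ((s₄.nat 16 0 0 / k : ℕ) : ℝ))
          ≤ segCost (natWeight w) a b i k / 4 * (4 * ((s₄.nat 16 0 0 / k : ℕ) : ℝ)) := by gcongr
        _ = segCost (natWeight w) a b i k * ((s₄.nat 16 0 0 / k : ℕ) : ℝ) := by ring
        _ ≤ _ := hi'
    -- A sequence shorter than `k` is itself one of the windows.
    · obtain ⟨h1, h2⟩ := B.le 0 _ _ ⟨hm.trans hmN, (zero_add _).le⟩ (.inr ⟨hNk, hαN, hmN, rfl⟩)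
      exact (hz h1).trans h2
  · have := B.mono (by rwa [eN 22 (by simp)])
    rwa [eR 11 (by simp)] at this

theorem natWrites_runS : ∀ a ∈ runS.natWrites, a ∉ [0, 1, 2, 50, 51, 52] := by
  have : runS.natWrites = [41, 5, 6, 7, 40, 8, 9, 10, 11, 42, 43, 8, 9, 11, 41, 5, 6, 7, 6, 7, 10,
    7, 41, 5, 41, 12, 13, 44, 40, 14, 23, 41, 23, 14, 13, 13, 41, 12, 41, 15, 40, 23, 15, 15,
    16, 45, 24, 46, 17, 18, 12, 16, 24, 47, 48, 23, 23, 23, 22, 21, 49, 19, 20] := rfl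
  simp [this]

theorem realWrites_runS : ∀ a ∈ runS.realWrites, a ∉ [0, 7, 8] := by
  have : runS.realWrites = [3, 4, 5, 6, 6, 6, 5, 3, 4, 3, 4, 4, 9, 10, 9, 10, 12, 12, 11] := rfl
  simp [this]

/-- The state of the search: the potentials in `D` have been tried. -/
structure SearchAt (s : Memory) (w : Fin n → Fin n → ℝ) (m k : ℕ) (α : ℝ) (D : ℝ → Prop) : Prop where
  input : InputAt s w m k α
  cand : CandAt s w m k α
  beats : ∀ lam, D lam → Beats s w m k α lam

theorem SearchAt.congr {D D' : ℝ → Prop} (h : SearchAt s w m k α D)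
    (hN : ∀ a ∈ [0, 1, 2, 19, 20, 21, 22], s'.nat a = s.nat a)
    (hR : ∀ a ∈ [0, 8, 11], s'.real a = s.real a) (hD : ∀ lam, D' lam → D lam) :
    SearchAt s' w m k α D' where
  input := h.input.congr (fun a ha => hN a (by simp at ha ⊢; tauto))
    (fun a ha => hR a (by simp at ha ⊢; tauto))
  cand := by
    unfold CandAt
    rw [hN 19 (by simp), hN 20 (by simp), hN 21 (by simp), hN 22 (by simp), hR 11 (by simp)]
    exact h.cand
  beats lam hlam := by
    unfold Beats
    rw [hN 22 (by simp), hR 11 (by simp)]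
    exact h.beats lam (hD lam hlam)

theorem doubling_spec {x : ℝ} (hx : s.real 7 0 0 = x) :
    ((Stm.iter 41 1 (setRvar 7 (.add (rvar 7) (rvar 7)))).run n s).real 7 0 0 = x * 2 ^ n := by
  have := run_iter (n := n) (v := 41) (c := 1) (s := s) (p := setRvar 7 (.add (rvar 7) (rvar 7)))
    (fun i s' => s'.real 7 0 0 = x * 2 ^ i) (fun i s' j h => by simpa using h) (by simpa using hx) (by
      intro i s' hi hN hR hv h
      simp [h, pow_succ]
      ring)
  rwa [one_mul] at this

theorem searchBody_spec (hw : IsMetric w) (hm : 1 ≤ m) (hmk : m ≤ k) (hkn : k ≤ n) {D : ℝ → Prop}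
    {x : ℝ} (hx : 0 ≤ x) (h : SearchAt s w m k α D) (h7 : s.real 7 0 0 = x * 2 ^ n) :
    SearchAt ((Stm.iter 52 2 (.seq runS (setRvar 7 (.half (rvar 7))))).run n s) w m k α
      (fun lam => D lam ∨ ∃ i < 2 * n, lam = x * 2 ^ n / 2 ^ i) := by
  have key := run_iter (n := n) (v := 52) (c := 2) (s := s)
    (p := .seq runS (setRvar 7 (.half (rvar 7))))
    (fun i s' => s'.real 7 0 0 = x * 2 ^ n / 2 ^ i ∧
      SearchAt s' w m k α (fun lam => D lam ∨ ∃ j < i, lam = x * 2 ^ n / 2 ^ j))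
    (fun i s' j h => ⟨by simpa using h.1, h.2.congr (fun a ha => by
      have : a ≠ 52 := by rintro rfl; simp at ha
      simp [this]) (fun a ha => rfl) fun _ h => h⟩)
    ⟨by simpa using h7, h.congr (fun _ _ => rfl) (fun _ _ => rfl) (by simp)⟩ (by
      rintro i s' hi hN hR hv ⟨h1, h2⟩
      obtain ⟨r1, r2, r3⟩ := runS_spec hw hm hmk hkn (by positivity) h2.input h1 h2.cand
      have fN : ∀ a ∈ [0, 1, 2], (runS.run n s').nat a = s'.nat a := fun a ha =>
        run_nat_of_notMem _ _ fun h => natWrites_runS a h (by simp at ha ⊢; tauto)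
      have fR : ∀ a ∈ [0, 7, 8], (runS.run n s').real a = s'.real a := fun a ha =>
        run_real_of_notMem _ _ fun h => realWrites_runS a h ha
      rw [run_seq, run_setR]
      refine ⟨by simp [fR 7, h1, pow_succ]; ring, ?_⟩
      have hS : SearchAt (runS.run n s') w m k α
          (fun lam => D lam ∨ ∃ j < i + 1, lam = x * 2 ^ n / 2 ^ j) := by
        refine ⟨h2.input.congr fN (fun a ha => fR a (by simp at ha ⊢; tauto)), r1, ?_⟩
        rintro lam (h | ⟨j, hj, rfl⟩)
        · exact (h2.beats lam (.inl h)).mono r3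
        · rcases Nat.lt_succ_iff_lt_or_eq.1 hj with hj | rfl
          · exact (h2.beats _ (.inr ⟨j, hj, rfl⟩)).mono r3
          · exact r2
      refine hS.congr (fun a ha => rfl) (fun a ha => ?_) fun _ h => h
      have : a ≠ 7 := by rintro rfl; simp at ha
      simp [this])
  exact key.2

theorem searchS_spec (hw : IsMetric w) (hm : 1 ≤ m) (hmk : m ≤ k) (hkn : k ≤ n)
    (h : SearchAt s w m k α fun _ => False) :
    SearchAt (searchS.run n s) w m k α
      (fun lam => ∃ u v : Fin n, ∃ i < 2 * n, lam = w u v * 2 ^ n / 2 ^ i) := by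
  set p : Stm := .seq (setRvar 7 (.read 0 (var 50) (var 51)))
    (.seq (.iter 41 1 (setRvar 7 (.add (rvar 7) (rvar 7))))
      (.iter 52 2 (.seq runS (setRvar 7 (.half (rvar 7)))))) with hp
  have hpN : p.natWrites = 41 :: 52 :: runS.natWrites := by simp [hp, natWrites]
  have hv : ∀ (v : ℕ) (s' : Memory) (j : ℕ) (D : ℝ → Prop), v ∉ [0, 1, 2, 19, 20, 21, 22] →
      SearchAt s' w m k α D → SearchAt (s'.writeNat v 0 0 j) w m k α D := fun v s' j D hv h =>
    h.congr (fun a ha => by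
      have : a ≠ v := by rintro rfl; exact hv ha
      simp [this]) (fun a ha => rfl) fun _ h => h
  have key := run_iter (n := n) (v := 50) (c := 1) (s := s) (p := .iter 51 1 p)
    (fun u s' => SearchAt s' w m k α
      (fun lam => ∃ u' v : Fin n, u'.val < u ∧ ∃ i < 2 * n, lam = w u' v * 2 ^ n / 2 ^ i))
    (fun u s' j h => hv 50 s' j _ (by simp) h) (h.congr (fun _ _ => rfl) (fun _ _ => rfl) (by simp)) (by
      intro u s' hu hN hR hu' h
      rw [one_mul] at hu
      have key := run_iter (n := n) (v := 51) (c := 1) (s := s') (p := p)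
        (fun v s' => SearchAt s' w m k α
          (fun lam => ∃ u' v' : Fin n, (u'.val < u ∨ (u'.val = u ∧ v'.val < v)) ∧
            ∃ i < 2 * n, lam = w u' v' * 2 ^ n / 2 ^ i))
        (fun v s' j h => hv 51 s' j _ (by simp) h)
        (h.congr (fun _ _ => rfl) (fun _ _ => rfl) fun lam => by simp) (by
          intro v s'' hv hN' hR' hv' h
          rw [one_mul] at hv
          have e50 : s''.nat 50 0 0 = u := by
            rw [hN' 50 (by simp) (by
              rw [hpN]
              simp only [List.mem_cons, not_or]
              exact ⟨by simp, by simp, fun h => natWrites_runS 50 h (by simp)⟩), hu']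
          set s₁ := (Stm.iter 41 1 (setRvar 7 (.add (rvar 7) (rvar 7)))).run n
            (s''.writeReal 7 0 0 (w ⟨u, hu⟩ ⟨v, hv⟩)) with hs₁
          have hrun : p.run n s'' =
              (Stm.iter 52 2 (.seq runS (setRvar 7 (.half (rvar 7))))).run n s₁ := by
            have : s''.real 0 u v = w ⟨u, hu⟩ ⟨v, hv⟩ := by
              rw [h.input.w_eq]
              exact natWeight_val (w := w) ⟨u, hu⟩ ⟨v, hv⟩
            simp [hp, e50, hv', this, hs₁]
          rw [hrun]
          have hS : SearchAt s₁ w m k α _ := h.congr (fun a ha => by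
              rw [hs₁, run_nat_of_notMem _ _ (by
                simp only [natWrites, List.mem_cons, List.not_mem_nil, or_false]
                rintro rfl
                simp at ha)]
              rfl) (fun a ha => by
              have : a ≠ 7 := by rintro rfl; simp at ha
              rw [hs₁, run_real_of_notMem _ _ (by simpa [realWrites] using this)]
              simp [this]) fun _ h => h
          refine (searchBody_spec hw hm hmk hkn (hw.nonneg ⟨u, hu⟩ ⟨v, hv⟩) hS
            (doubling_spec (by simp))).congr (fun _ _ => rfl) (fun _ _ => rfl) ?_
          rintro lam ⟨u', v', h1, i, hi, rfl⟩
          by_cases h2 : u'.val = u ∧ v'.val = v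
          · obtain ⟨rfl, rfl⟩ := h2
            exact .inr ⟨i, hi, rfl⟩
          · exact .inl ⟨u', v', by omega, i, hi, rfl⟩)
      refine key.congr (fun _ _ => rfl) (fun _ _ => rfl) ?_
      rintro lam ⟨u', v', h1, i, hi, rfl⟩
      exact ⟨u', v', by omega, i, hi, rfl⟩)
  refine key.congr (fun _ _ => rfl) (fun _ _ => rfl) ?_
  rintro lam ⟨u', v', i, hi, rfl⟩
  exact ⟨u', v', by omega, i, hi, rfl⟩

/-- The machine cannot multiply, so `α` is added `k` times; as `k ≤ n`, the `n` rounds suffice. -/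
theorem thresholdS_spec (h1 : s.real 1 0 0 = α) (h2 : s.nat 2 0 0 = k) (hkn : k ≤ n) :
    (thresholdS.run n s).real 8 0 0 = α * k := by
  rw [thresholdS, run_seq, run_setR]
  have key := run_iter (n := n) (v := 41) (c := 1) (s := s.writeReal 8 0 0 0)
    (p := .ite (.nle (.add (var 41) (.const 1)) (var 2)) (setRvar 8 (.add (rvar 8) (rvar 1))) .skip)
    (fun i s' => s'.real 8 0 0 = α * (min i k : ℕ)) (fun i s' j h => by simpa using h) (by simp) (by
      intro i s' hi hN hR hv h
      have e1 : s'.real 1 0 0 = α := by rw [hR 1 (by simp [realWrites])]; simpa using h1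
      have e2 : s'.nat 2 0 0 = k := by rw [hN 2 (by simp) (by simp [natWrites])]; simpa using h2
      rw [run_ite]
      split_ifs with hc
      · simp [hv, e2] at hc
        rw [min_eq_left (by omega)] at h ⊢
        simp [h, e1]
        ring
      · simp [hv, e2] at hc
        rw [run_skip, h, min_eq_right (by omega), min_eq_right (by omega)])
  rw [one_mul, min_eq_right hkn] at key
  simpa using key

theorem mainS_spec {ε : ℝ} (hα : 0 < α) (hα' : α < 1) (hε : 0 < ε) (hw : IsMetric w) (hm : 1 ≤ m)
    (hmk : m ≤ k) (hkn : k ≤ n) :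
    ∃ P : Fin m → List (Fin n), IsOutput (mainS.run n (inputMemory w m k α ε)) P ∧
      (IsApprox w k (16 / (1 - α) + ε) P ∨ IsBicriteria w k α ((8 - 2 * α) / (1 - α) + ε) P) := by
  simp only [mainS, run_seq]
  set s₀ := inputMemory w m k α ε with hs₀
  have fN : ∀ a, a ≠ 41 → (thresholdS.run n s₀).nat a = s₀.nat a := fun a ha =>
    run_nat_of_notMem _ _ (by simpa [thresholdS, natWrites] using ha)
  have fR : ∀ a, a ≠ 8 → (thresholdS.run n s₀).real a = s₀.real a := fun a ha =>
    run_real_of_notMem _ _ (by simpa [thresholdS, realWrites] using ha)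
  have h22 : (thresholdS.run n s₀).nat 22 0 0 = 0 := by rw [fN 22 (by simp)]; rfl
  have hS := searchS_spec hw hm hmk hkn (s := thresholdS.run n s₀) (α := α)
    ⟨⟨by rw [fN 0 (by simp)]; rfl, by rw [fN 1 (by simp)]; rfl, by rw [fN 2 (by simp)]; rfl,
      by rw [fR 0 (by simp)]; rfl, thresholdS_spec rfl rfl hkn⟩, fun h => absurd h22 h, by simp⟩
  set s₁ := searchS.run n (thresholdS.run n s₀) with hs₁
  have hα1 : 0 < 1 - α := by linarith
  have hle : ∀ z, (s₁.nat 22 0 0 ≠ 0 → z ≤ s₁.real 11 0 0) → z * (1 - α) / 4 ≤ opt w m k :=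
    fun z hz => le_opt hm hmk hkn fun Q hQ => by
      have := le_of_beaten hw hα hα' hm hmk hkn
        (fun u v i hi => hS.beats _ ⟨u, v, i, hi, rfl⟩ z hz) hQ
      linarith
  -- Without a stored window, every real `z` would be a lower bound for the scores, so `hle` would
  -- hold for arbitrarily large `z`; this one yields `opt + 1 ≤ opt`.
  have hbest : s₁.nat 22 0 0 ≠ 0 := by
    intro h0
    have := hle ((4 * opt w m k + 4) / (1 - α)) fun h => absurd h0 h
    rw [div_mul_cancel₀ _ hα1.ne'] at this
    linarith
  have hz := hle _ fun _ => le_rfl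
  have hopt : 0 ≤ opt w m k := le_opt hm hmk hkn fun Q _ => totalWeight_nonneg hw Q
  obtain ⟨hseq, hscore⟩ := hS.cand hbest
  have hz' : s₁.real 11 0 0 ≤ 4 / (1 - α) * opt w m k := by
    rw [div_mul_eq_mul_div, le_div_iff₀ hα1]
    linarith
  have hεopt : 0 ≤ ε * opt w m k := mul_nonneg hε.le hopt
  have hlen : m ≤ s₁.nat 21 0 0 := by
    rcases hscore with ⟨h, -⟩ | ⟨-, -, h, -⟩ <;> omega
  obtain ⟨P, h1, h2, h3, h4⟩ := outputS_spec hw hS.input.m_eq rfl hlen hseq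
  refine ⟨P, h1, ?_⟩
  rcases hscore with ⟨h5, h6⟩ | ⟨-, h5, -, h6⟩
  · refine .inl ⟨⟨h2, by omega⟩, ?_⟩
    -- The score of a long window is a quarter of its weight.
    have : 16 / (1 - α) * opt w m k = 4 * (4 / (1 - α) * opt w m k) := by ring
    rw [add_mul, this]
    linarith
  · refine .inr ⟨h2, by rwa [h3], ?_⟩
    -- A short window scores its full weight, and `4 ≤ 8 - 2 * α` since `α < 1`.
    have : 4 / (1 - α) * opt w m k ≤ (8 - 2 * α) / (1 - α) * opt w m k := by
      gcongr
      linarith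
    rw [add_mul]
    linarith

end Prog

end KMinWP

theorem mainTheorem3 :
    ∃ (A : KMinWP.Program) (C d : ℕ),
      ∀ (α ε : ℝ), 0 < α → α < 1 → 0 < ε →
        ∀ (n m k : ℕ) (w : Fin n → Fin n → ℝ), KMinWP.IsMetric w → 1 ≤ m → m ≤ k → k ≤ n →
          ∃ (t : ℕ) (s : KMinWP.Memory) (P : Fin m → List (Fin n)),
            KMinWP.Exec A (KMinWP.inputMemory w m k α ε) t s ∧
            (t : ℝ) ≤ (C : ℝ) * ((n : ℝ) + 1 / ε) ^ d ∧
            KMinWP.IsOutput s P ∧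
            (KMinWP.IsApprox w k (16 / (1 - α) + ε) P ∨
              KMinWP.IsBicriteria w k α ((8 - 2 * α) / (1 - α) + ε) P) := by
  obtain ⟨C, d, hcost⟩ := KMinWP.Stm.exists_cost_le KMinWP.Prog.mainS
  refine ⟨KMinWP.Prog.mainS.toProgram, C, d, fun α ε hα hα' hε n m k w hw hm hmk hkn => ?_⟩
  obtain ⟨t, ht, ht'⟩ := KMinWP.Stm.exec_toProgram KMinWP.Prog.wellFormed_mainS
    (s := KMinWP.inputMemory w m k α ε) rfl
  obtain ⟨P, hP, hP'⟩ := KMinWP.Prog.mainS_spec hα hα' hε hw hm hmk hkn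
  refine ⟨t, _, P, ht, ?_, hP, hP'⟩
  calc (t : ℝ) ≤ (C * n ^ d : ℕ) := by exact_mod_cast ht'.trans (hcost n (by omega))
    _ = C * (n : ℝ) ^ d := by push_cast; rfl
    _ ≤ C * ((n : ℝ) + 1 / ε) ^ d := by
      gcongr
      have : 0 < 1 / ε := by positivity
      linarith
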